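/- **Theorem.** There is a fully polynomial-time approximation scheme (FPTAS) for the maximum cardinality robustness problem for knapsack. *The problem.* An instance consists of items $E=\{1,\dots,n\}$ with sizes $s(e)>0$ and values $v(e)>0$, and a capacity $C$, all real, such that $s(e)\le C$ for at least one item $e$. Let $\mathcal I=\{X\subseteq E : \sum_{e\in X}s(e)\le C\}$, let $\Delta(\mathcal I)$ be the set of probability distributions over $\mathcal I$, and for $k\in[n]=\{1,\dots,n\}$ let $$v_{\le k}(X)=\max\Big\{\sum_{e\in X'}v(e) : X'\subseteq X,\ |X'|\le k\Big\}.$$ The task is to find $p\in\Delta(\mathcal I)$ that maximizes the cardinality robustness $$\rho(p)=\min_{k\in[n]}\frac{\sum_{X\in\mathcal I}p_X\,v_{\le k}(X)}{\max_{Y\in\mathcal I}v_{\le k}(Y)}.$$ *The claim.* There are a single algorithm and a polynomial $Q$ in two variables such that, for every instance and every real $\varepsilon>0$, the algorithm, given the instance and $\varepsilon$, halts and outputs an explicit list of at most $Q(n,1/\varepsilon)$ pairs of a probability and a subset of $E$ that represents some $p\in\Delta(\mathcal I)$ (the probability of $X$ being the sum over the pairs whose set is $X$) with $$\rho(p)\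 \ge\ (1-\varepsilon)\cdot\max_{p'\in\Delta(\mathcal I)}\rho(p')\qquad(\varepsilon\le 1);$$ for $\varepsilon>1$ only $p\in\Delta(\mathcal I)$ is required. Its running time is at most $Q(n,1/\varepsilon)$ on a random access machine with unit cost for arithmetic operations ($+,-,\times,/$) and comparisons of real numbers and logarithmic cost for the natural numbers used for control and addressing. If moreover $s$, $v$, $C$ and $\varepsilon$ are rational, then its running time at logarithmic (bit) cost is at most $Q(L,1/\varepsilon)$, where $L$ is the length of the binary encoding of the input $(s,v,C,\varepsilon)$. -/

import Mathlib

namespace CardRobust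

/-! ## The maximum cardinality robustness problem for the knapsack problem -/

/-- A knapsack instance: `n` items with positive real sizes and values, and a capacity, such that
at least one item fits into the knapsack. -/
structure Instance where
  n : ℕ
  size : Fin n → ℝ
  value : Fin n → ℝ
  capacity : ℝ
  size_pos : ∀ e, 0 < size e
  value_pos : ∀ e, 0 < value e
  fits : ∃ e, size e ≤ capacity

namespace Instance

variable (I : Instance)

open Classical in
/-- The family of knapsack solutions. -/
noncomputable def feasible : Finset (Finset (Fin I.n)) :=
  Finset.univ.filter fun X => ∑ e ∈ X, I.size e ≤ I.capacity

theorem feasible_nonempty : I.feasible.Nonempty := by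
  obtain ⟨e, he⟩ := I.fits
  exact ⟨∅, by simpa [feasible] using (I.size_pos e).le.trans he⟩

theorem indices_nonempty : (Finset.Icc 1 I.n).Nonempty := by
  obtain ⟨e, -⟩ := I.fits
  exact Finset.nonempty_Icc.2 (Nat.one_le_iff_ne_zero.2 fun h => (h ▸ e).elim0)

/-- `v_{≤k}(X)`: the maximum total value of at most `k` elements of `X`. -/
noncomputable def topValue (k : ℕ) (X : Finset (Fin I.n)) : ℝ :=
  (X.powerset.filter fun X' => X'.card ≤ k).sup' ⟨∅, by simp⟩ fun X' => ∑ e ∈ X', I.value e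

/-- `v_{≤k}(X_k^*)`: the maximum of `v_{≤k}` over all knapsack solutions. -/
noncomputable def optTopValue (k : ℕ) : ℝ :=
  I.feasible.sup' I.feasible_nonempty fun Y => I.topValue k Y

/-- The probability distributions over the knapsack solutions. -/
def randomizedSolutions : Set (Finset (Fin I.n) → ℝ) :=
  {p | (∀ X, 0 ≤ p X) ∧ (∀ X, X ∉ I.feasible → p X = 0) ∧ ∑ X ∈ I.feasible, p X = 1}

/-- The cardinality robustness of a randomized solution. -/
noncomputable def robustness (p : Finset (Fin I.n) → ℝ) : ℝ :=
  (Finset.Icc 1 I.n).inf' I.indices_nonempty fun k =>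
    (∑ X ∈ I.feasible, p X * I.topValue k X) / I.optTopValue k

/-- `p` is a randomized solution whose robustness is at least `α` times the maximum. -/
def IsApproxSolution (α : ℝ) (p : Finset (Fin I.n) → ℝ) : Prop :=
  p ∈ I.randomizedSolutions ∧ ∀ p' ∈ I.randomizedSolutions, α * I.robustness p' ≤ I.robustness p

end Instance

/-! ## Programs

A random access machine with two kinds of memory cells, programmed in a small imperative language.
Index cells hold natural numbers and are used for control and addressing; number cells hold real
numbers and admit the four arithmetic operations and comparison (no rounding, and no constants
other than natural numbers). Cells are grouped into arrays; the name of an array is fixed in the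
program text, the position in it is computed. -/

/-- Memory: `idx a i` and `num a i` are the `i`-th cells of the arrays called `a`. -/
structure Memory where
  idx : ℕ → ℕ → ℕ
  num : ℕ → ℕ → ℝ

/-- Write to an index cell. -/
def Memory.setIdx (μ : Memory) (a i x : ℕ) : Memory :=
  { μ with idx := fun b j => if b = a ∧ j = i then x else μ.idx b j }

/-- Write to a number cell. -/
noncomputable def Memory.setNum (μ : Memory) (a i : ℕ) (x : ℝ) : Memory :=
  { μ with num := fun b j => if b = a ∧ j = i then x else μ.num b j }

/-- Index expressions (`sub` is truncated subtraction). -/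
inductive IdxExpr where
  | const (c : ℕ)
  | cell (a : ℕ) (i : IdxExpr)
  | add (x y : IdxExpr)
  | sub (x y : IdxExpr)
  | mul (x y : IdxExpr)

/-- Number expressions. -/
inductive NumExpr where
  | ofIdx (i : IdxExpr)
  | cell (a : ℕ) (i : IdxExpr)
  | add (x y : NumExpr)
  | sub (x y : NumExpr)
  | mul (x y : NumExpr)
  | div (x y : NumExpr)

/-- Tests. -/
inductive Test where
  | idxLE (x y : IdxExpr)
  | numLE (x y : NumExpr)

/-- Programs. -/
inductive Program where
  | skip
  | assignIdx (a : ℕ) (i x : IdxExpr)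
  | assignNum (a : ℕ) (i : IdxExpr) (x : NumExpr)
  | seq (P Q : Program)
  | ite (b : Test) (P Q : Program)
  | while (b : Test) (P : Program)

def IdxExpr.eval (μ : Memory) : IdxExpr → ℕ
  | const c => c
  | cell a i => μ.idx a (i.eval μ)
  | add x y => x.eval μ + y.eval μ
  | sub x y => x.eval μ - y.eval μ
  | mul x y => x.eval μ * y.eval μ

noncomputable def NumExpr.eval (μ : Memory) : NumExpr → ℝ
  | ofIdx i => (i.eval μ : ℝ)
  | cell a i => μ.num a (i.eval μ)
  | add x y => x.eval μ + y.eval μ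
  | sub x y => x.eval μ - y.eval μ
  | mul x y => x.eval μ * y.eval μ
  | div x y => x.eval μ / y.eval μ

def Test.Holds (μ : Memory) : Test → Prop
  | idxLE x y => x.eval μ ≤ y.eval μ
  | numLE x y => x.eval μ ≤ y.eval μ

/-- The cost of handling the natural number `m`: one plus its number of binary digits. -/
def natCost (m : ℕ) : ℕ := m.size + 1

/-- The cost of evaluating an index expression: every node is charged logarithmically, by the value
it produces. -/
def IdxExpr.cost (μ : Memory) : IdxExpr → ℕ
  | const c => natCost c
  | cell a i => i.cost μ + natCost (μ.idx a (i.eval μ))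
  | add x y => x.cost μ + y.cost μ + natCost (x.eval μ + y.eval μ)
  | sub x y => x.cost μ + y.cost μ + natCost (x.eval μ - y.eval μ)
  | mul x y => x.cost μ + y.cost μ + natCost (x.eval μ * y.eval μ)

/-- The cost of evaluating a number expression: every node that produces the real number `x` is
charged `w x`. -/
noncomputable def NumExpr.cost (w : ℝ → ℕ) (μ : Memory) : NumExpr → ℕ
  | ofIdx i => i.cost μ + w (i.eval μ)
  | cell a i => i.cost μ + w (μ.num a (i.eval μ))
  | add x y => x.cost w μ + y.cost w μ + w (x.eval μ + y.eval μ)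
  | sub x y => x.cost w μ + y.cost w μ + w (x.eval μ - y.eval μ)
  | mul x y => x.cost w μ + y.cost w μ + w (x.eval μ * y.eval μ)
  | div x y => x.cost w μ + y.cost w μ + w (x.eval μ / y.eval μ)

noncomputable def Test.cost (w : ℝ → ℕ) (μ : Memory) : Test → ℕ
  | idxLE x y => x.cost μ + y.cost μ
  | numLE x y => x.cost w μ + y.cost w μ

/-- `Exec w P μ ν t`: started with memory `μ`, the program `P` halts with memory `ν`, and the total
cost of the run is `t` when real numbers `x` are charged `w x`. -/
inductive Exec (w : ℝ → ℕ) : Program → Memory → Memory → ℕ → Prop where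
  | skip (μ : Memory) : Exec w .skip μ μ 1
  | assignIdx (μ : Memory) (a : ℕ) (i x : IdxExpr) :
      Exec w (.assignIdx a i x) μ (μ.setIdx a (i.eval μ) (x.eval μ)) (i.cost μ + x.cost μ + 1)
  | assignNum (μ : Memory) (a : ℕ) (i : IdxExpr) (x : NumExpr) :
      Exec w (.assignNum a i x) μ (μ.setNum a (i.eval μ) (x.eval μ)) (i.cost μ + x.cost w μ + 1)
  | seq {P Q : Program} {μ ν ρ : Memory} {s t : ℕ} :
      Exec w P μ ν s → Exec w Q ν ρ t → Exec w (.seq P Q) μ ρ (s + t + 1)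
  | iteTrue {b : Test} {P Q : Program} {μ ν : Memory} {t : ℕ} :
      b.Holds μ → Exec w P μ ν t → Exec w (.ite b P Q) μ ν (b.cost w μ + t + 1)
  | iteFalse {b : Test} {P Q : Program} {μ ν : Memory} {t : ℕ} :
      ¬ b.Holds μ → Exec w Q μ ν t → Exec w (.ite b P Q) μ ν (b.cost w μ + t + 1)
  | whileTrue {b : Test} {P : Program} {μ ν ρ : Memory} {s t : ℕ} :
      b.Holds μ → Exec w P μ ν s → Exec w (.while b P) ν ρ t →
        Exec w (.while b P) μ ρ (b.cost w μ + s + t + 1)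
  | whileFalse {b : Test} {P : Program} {μ : Memory} :
      ¬ b.Holds μ → Exec w (.while b P) μ μ (b.cost w μ + 1)

/-- The real-number model: every operation on real numbers has cost one. -/
def unitCost : ℝ → ℕ := fun _ => 1

/-- The length of the binary encoding of a rational number. -/
def ratLength (q : ℚ) : ℕ := q.num.natAbs.size + q.den.size + 1

open Classical in
/-- The bit model: a rational number is charged the length of its binary encoding. (On rational
data only rational numbers occur in a run, so the value at irrational numbers plays no role.) -/
noncomputable def bitCost (x : ℝ) : ℕ :=
  if h : ∃ q : ℚ, (q : ℝ) = x then ratLength h.choose else 1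

/-! ## Input, output, and fully polynomial-time approximation schemes -/

/-- The initial memory for the instance `I` and the accuracy `ε`. Index cell `0[0]` holds the number
of items, number arrays `0` and `1` hold the sizes and the values, number cells `2[0]` and `3[0]`
hold the capacity and `ε`, and all other cells are zero. -/
noncomputable def initialMemory (I : Instance) (ε : ℝ) : Memory where
  idx a i := if a = 0 ∧ i = 0 then I.n else 0
  num a i :=
    if a = 0 then (if h : i < I.n then I.size ⟨i, h⟩ else 0)
    else if a = 1 then (if h : i < I.n then I.value ⟨i, h⟩ else 0)
    else if a = 2 ∧ i = 0 then I.capacity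
    else if a = 3 ∧ i = 0 then ε
    else 0

/-- The output is an explicit list of item sets with probabilities. Index cell `1[0]` holds the
length of the list. -/
def outputLength (μ : Memory) : ℕ := μ.idx 1 0

/-- The `j`-th set of the output list, given by its characteristic vector, which is stored in the
cells `j * n, …, j * n + (n - 1)` of index array `2`. -/
def outputSet (n : ℕ) (μ : Memory) (j : ℕ) : Finset (Fin n) :=
  Finset.univ.filter fun e => μ.idx 2 (j * n + e) ≠ 0

/-- The output as a function on item sets; the probability of the `j`-th set of the output list is
stored in the `j`-th cell of number array `4`. -/
noncomputable def outputDistribution (n : ℕ) (μ : Memory) (X : Finset (Fin n)) : ℝ :=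
  ∑ j ∈ Finset.range (outputLength μ), if outputSet n μ j = X then μ.num 4 j else 0

/-- All the numbers in the input are rational. -/
def IsRationalInput (I : Instance) (ε : ℝ) : Prop :=
  (∀ e, ∃ q : ℚ, (q : ℝ) = I.size e) ∧ (∀ e, ∃ q : ℚ, (q : ℝ) = I.value e) ∧
    (∃ q : ℚ, (q : ℝ) = I.capacity) ∧ ∃ q : ℚ, (q : ℝ) = ε

/-- The length of the binary encoding of a rational input. -/
noncomputable def inputLength (I : Instance) (ε : ℝ) : ℕ :=
  ∑ e, (bitCost (I.size e) + bitCost (I.value e)) + bitCost I.capacity + bitCost ε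

/-- `P` is a fully polynomial-time approximation scheme for the maximum cardinality robustness
problem for knapsack. On every instance and every `ε > 0` it halts and outputs a
`(1 - ε)`-approximate randomized solution; the running time is polynomial in the number of items
and `1 / ε` in the real-number model, and polynomial in the length of the binary encoding of the
input and `1 / ε` in the bit model when the input is rational. -/
def IsFPTAS (P : Program) : Prop :=
  ∃ c d : ℕ, ∀ (I : Instance) (ε : ℝ), 0 < ε →
    ∃ μ : Memory,
      I.IsApproxSolution (1 - ε) (outputDistribution I.n μ) ∧
      (outputLength μ : ℝ) ≤ c * (I.n + 1 / ε + 1) ^ d ∧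
      (∃ t, Exec unitCost P (initialMemory I ε) μ t ∧ (t : ℝ) ≤ c * (I.n + 1 / ε + 1) ^ d) ∧
      (IsRationalInput I ε →
        ∃ t, Exec bitCost P (initialMemory I ε) μ t ∧
          (t : ℝ) ≤ c * (inputLength I ε + 1 / ε + 1) ^ d)

end CardRobust

namespace CardRobust

open Finset

/-! ## Executions: determinism, frames, cost -/

/-! The problem is a zero-sum game: one player mixes over knapsack solutions `X`, the adversary
picks a cardinality `k`, and the payoff is `v_{≤k}(X)` divided by its optimum. The multiplicative
weights method solves such a game approximately as soon as `∑ c_k v_{≤k}(X)` with nonnegative `c_k`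
can be maximized approximately over the solutions.

This oracle exists because of sorting. With the items in order of decreasing value, `v_{≤k}(X)` is
the sum of the first `k` values in `X` (`sum_le_firstSum`), so the combination equals the sum of
`a_j * v_i` over `i ∈ X`, where `j` is the rank of `i` in `X` and `a_j` is a tail sum of the
coefficients (`rankSum_eq_sum_firstSum`). When items are added in sorted order, the rank of a new
item is the number of items taken before (`rankSum_insert`). Hence a dynamic program indexed by the
number of items and their rounded value, storing the least size, finds an optimal set for the
rounded objective (`TableCorrect.optimal`). Rounding to multiples of `M / (n * N)`, where `M = a_0 *
u` is attained by a single item, costs a factor `1 - 1 / N` (`rounding_loss`). The same oracle with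
0-1 weights yields approximations `B k` of the optimal truncated values, which serve as
normalizations. After `2 * (n * N) ^ 2` rounds the uniform distribution over the sets found is
within a factor `1 - 5 / N` of the optimum (`average_guarantee`), and `N` is chosen with `N * ε >
5`.

Running times are proved together with correctness, in an arbitrary cost model. If in a run of a
fixed program every loop makes at most `h` iterations and every number has length at most `h`, then
the cost is polynomial in `h` (`Program.stepBound_le`); `Run` is a program logic for this kind of
statement. `LengthModel` lists what is needed of a notion of length; it holds trivially for unit
cost and, for bit cost, with bounds on numerators and denominators. The weights need no rounding:
they are products of polynomially many factors of polynomial length. Determinism shows that the runs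
in both models end in the same memory. -/

theorem Exec.deterministic {w w' : ℝ → ℕ} {P : Program} {μ ν ν' : Memory} {t t' : ℕ}
    (h : Exec w P μ ν t) (h' : Exec w' P μ ν' t') : ν = ν' := by
  induction h generalizing ν' t' with
  | skip | assignIdx | assignNum => cases h'; rfl
  | seq _ _ ih₁ ih₂ =>
    cases h' with
    | seq h₁ h₂ => obtain rfl := ih₁ h₁; exact ih₂ h₂
  | iteTrue hb _ ih =>
    cases h' with
    | iteTrue _ h₁ => exact ih h₁
    | iteFalse hb' => exact absurd hb hb'
  | iteFalse hb _ ih =>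
    cases h' with
    | iteTrue hb' => exact absurd hb' hb
    | iteFalse _ h₁ => exact ih h₁
  | whileTrue hb _ _ ih₁ ih₂ =>
    cases h' with
    | whileTrue _ h₁ h₂ => obtain rfl := ih₁ h₁; exact ih₂ h₂
    | whileFalse hb' => exact absurd hb hb'
  | whileFalse hb =>
    cases h' with
    | whileTrue hb' => exact absurd hb' hb
    | whileFalse => rfl

/-- Whether the index array `a` occurs on the left of an assignment. -/
def Program.writesIdx (a : ℕ) : Program → Bool
  | .skip => false
  | .assignIdx b _ _ => a == b
  | .assignNum _ _ _ => false
  | .seq P Q => P.writesIdx a || Q.writesIdx a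
  | .ite _ P Q => P.writesIdx a || Q.writesIdx a
  | .while _ P => P.writesIdx a

/-- Whether the number array `a` occurs on the left of an assignment. -/
def Program.writesNum (a : ℕ) : Program → Bool
  | .skip => false
  | .assignIdx _ _ _ => false
  | .assignNum b _ _ => a == b
  | .seq P Q => P.writesNum a || Q.writesNum a
  | .ite _ P Q => P.writesNum a || Q.writesNum a
  | .while _ P => P.writesNum a

/-- `μ` and `ν` agree on all arrays that `P` does not write to. -/
structure Frame (P : Program) (μ ν : Memory) : Prop where
  idx : ∀ a, P.writesIdx a = false → ν.idx a = μ.idx a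
  num : ∀ a, P.writesNum a = false → ν.num a = μ.num a

theorem Frame.refl (P : Program) (μ : Memory) : Frame P μ μ := ⟨fun _ _ => rfl, fun _ _ => rfl⟩

theorem Frame.trans {P : Program} {μ ν ρ : Memory} (h₁ : Frame P μ ν) (h₂ : Frame P ν ρ) :
    Frame P μ ρ :=
  ⟨fun a h => (h₂.idx a h).trans (h₁.idx a h), fun a h => (h₂.num a h).trans (h₁.num a h)⟩

theorem Frame.mono {P Q : Program} {μ ν : Memory} (h : Frame P μ ν)
    (hi : ∀ a, Q.writesIdx a = false → P.writesIdx a = false)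
    (hn : ∀ a, Q.writesNum a = false → P.writesNum a = false) : Frame Q μ ν :=
  ⟨fun a ha => h.idx a (hi a ha), fun a ha => h.num a (hn a ha)⟩

theorem Memory.setIdx_idx (μ : Memory) (a i x b j : ℕ) :
    (μ.setIdx a i x).idx b j = if b = a ∧ j = i then x else μ.idx b j := rfl

theorem Memory.setIdx_idx_of_ne (μ : Memory) {a b : ℕ} (i x : ℕ) (h : b ≠ a) :
    (μ.setIdx a i x).idx b = μ.idx b := by
  funext j; simp [Memory.setIdx_idx, h]

theorem Memory.setIdx_num (μ : Memory) (a i x : ℕ) : (μ.setIdx a i x).num = μ.num := rfl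

theorem Memory.setNum_num (μ : Memory) (a i : ℕ) (x : ℝ) (b j : ℕ) :
    (μ.setNum a i x).num b j = if b = a ∧ j = i then x else μ.num b j := rfl

theorem Memory.setNum_num_of_ne (μ : Memory) {a b : ℕ} (i : ℕ) (x : ℝ) (h : b ≠ a) :
    (μ.setNum a i x).num b = μ.num b := by
  funext j; simp [Memory.setNum_num, h]

theorem Memory.setNum_idx (μ : Memory) (a i : ℕ) (x : ℝ) : (μ.setNum a i x).idx = μ.idx := rfl

/-- Array names are fixed in the program text, so the preservation of an array is a syntactic fact;
for a concrete program the side condition holds by `rfl`. -/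
theorem Exec.frame {w : ℝ → ℕ} {P : Program} {μ ν : Memory} {t : ℕ} (h : Exec w P μ ν t) :
    Frame P μ ν := by
  induction h with
  | skip μ => exact Frame.refl _ _
  | assignIdx μ a i x =>
    refine ⟨fun b hb => Memory.setIdx_idx_of_ne _ _ _ ?_, fun b _ => rfl⟩
    simpa [Program.writesIdx] using hb
  | assignNum μ a i x =>
    refine ⟨fun b _ => rfl, fun b hb => Memory.setNum_num_of_ne _ _ _ ?_⟩
    simpa [Program.writesNum] using hb
  | seq _ _ ih₁ ih₂ =>
    refine (ih₁.mono ?_ ?_).trans (ih₂.mono ?_ ?_) <;>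
      simp +contextual [Program.writesIdx, Program.writesNum]
  | iteTrue _ _ ih =>
    refine ih.mono ?_ ?_ <;> simp +contextual [Program.writesIdx, Program.writesNum]
  | iteFalse _ _ ih =>
    refine ih.mono ?_ ?_ <;> simp +contextual [Program.writesIdx, Program.writesNum]
  | whileTrue _ _ _ ih₁ ih₂ =>
    exact (ih₁.mono (Q := .while _ _) (fun _ h => h) (fun _ h => h)).trans ih₂
  | whileFalse => exact Frame.refl _ _

/-! ### Cost bounds in terms of the program text -/

/-- Number of nodes of an index expression, constants being counted with their value. -/
def IdxExpr.nodes : IdxExpr → ℕ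
  | const c => c + 1
  | cell _ i => i.nodes + 1
  | add x y | sub x y | mul x y => x.nodes + y.nodes + 1

def NumExpr.nodes : NumExpr → ℕ
  | ofIdx i => i.nodes + 1
  | cell _ i => i.nodes + 1
  | add x y | sub x y | mul x y | div x y => x.nodes + y.nodes + 1

def Test.nodes : Test → ℕ
  | idxLE x y => x.nodes + y.nodes
  | numLE x y => x.nodes + y.nodes

/-- A bound, up to the factor `U + 1`, on the cost of a run in which no loop is executed more than
`U` times and all cells have length at most `U`. -/
def Program.stepBound (U : ℕ) : Program → ℕ
  | .skip => 1
  | .assignIdx _ i x => 6 * (i.nodes + x.nodes + 1) ^ 2 + 1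
  | .assignNum _ i x => 6 * (i.nodes + x.nodes + 1) ^ 2 + 1
  | .seq P Q => P.stepBound U + Q.stepBound U + 1
  | .ite b P Q => 6 * b.nodes ^ 2 + P.stepBound U + Q.stepBound U + 1
  | .while b P => (U + 1) * (6 * b.nodes ^ 2 + P.stepBound U + 1)

/-- Each loop raises the degree by one; for sequences and branches the sum of the two degrees
dominates both. -/
theorem Program.stepBound_le (P : Program) :
    ∃ c d : ℕ, ∀ U, P.stepBound U ≤ c * (U + 1) ^ d := by
  have key : ∀ (U c d d' : ℕ), c * (U + 1) ^ d ≤ c * (U + 1) ^ (d + d') := fun U c d d' =>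
    Nat.mul_le_mul_left _ (Nat.pow_le_pow_right (by omega) (by omega))
  have one : ∀ U d : ℕ, 1 ≤ (U + 1) ^ d := fun U d => Nat.one_le_pow _ _ (by omega)
  induction P with
  | skip => exact ⟨1, 0, fun U => by simp [stepBound]⟩
  | assignIdx a i x => exact ⟨_, 0, fun U => by rw [stepBound, pow_zero, mul_one]⟩
  | assignNum a i x => exact ⟨_, 0, fun U => by rw [stepBound, pow_zero, mul_one]⟩
  | seq P Q ihP ihQ =>
    obtain ⟨c, d, h⟩ := ihP
    obtain ⟨c', d', h'⟩ := ihQ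
    refine ⟨c + c' + 1, d + d', fun U => ?_⟩
    have h1 := (h U).trans (key U c d d')
    have h2 := (h' U).trans (key U c' d' d)
    rw [add_comm d' d] at h2
    have := one U (d + d')
    rw [stepBound]
    linarith [add_mul (c + c') 1 ((U + 1) ^ (d + d')), add_mul c c' ((U + 1) ^ (d + d'))]
  | ite b P Q ihP ihQ =>
    obtain ⟨c, d, h⟩ := ihP
    obtain ⟨c', d', h'⟩ := ihQ
    refine ⟨6 * b.nodes ^ 2 + c + c' + 1, d + d', fun U => ?_⟩
    have h1 := (h U).trans (key U c d d')
    have h2 := (h' U).trans (key U c' d' d)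
    rw [add_comm d' d] at h2
    have h3 := one U (d + d')
    have h4 := Nat.mul_le_mul_left (6 * b.nodes ^ 2) h3
    rw [stepBound, add_mul, add_mul, add_mul]
    linarith
  | _ b P ih =>
    obtain ⟨c, d, h⟩ := ih
    refine ⟨6 * b.nodes ^ 2 + c + 1, d + 1, fun U => ?_⟩
    have h3 := one U d
    have h4 := Nat.mul_le_mul_left (6 * b.nodes ^ 2) h3
    rw [stepBound, pow_succ (U + 1), ← mul_assoc, mul_comm (U + 1)]
    refine Nat.mul_le_mul_right _ ?_
    rw [add_mul, add_mul]
    linarith [h U]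

/-- `Λ a x` is to be read as: the real number `x` has length at most `a` in the cost model `w`. -/
structure LengthModel (w : ℝ → ℕ) (Λ : ℕ → ℝ → Prop) : Prop where
  mono : ∀ {a b x}, Λ a x → a ≤ b → Λ b x
  natCast : ∀ {a m : ℕ}, m ≤ 2 ^ a → Λ a m
  add : ∀ {a b x y}, Λ a x → Λ b y → Λ (a + b + 1) (x + y)
  sub : ∀ {a b x y}, Λ a x → Λ b y → Λ (a + b + 1) (x - y)
  mul : ∀ {a b x y}, Λ a x → Λ b y → Λ (a + b) (x * y)
  div : ∀ {a b x y}, Λ a x → Λ b y → Λ (a + b) (x / y)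
  cost_le : ∀ {a x}, Λ a x → w x ≤ 2 * a + 4

/-- All cells have length at most `h`. -/
structure Good (Λ : ℕ → ℝ → Prop) (h : ℕ) (μ : Memory) : Prop where
  idx : ∀ a i, μ.idx a i ≤ 2 ^ h
  num : ∀ a i, Λ h (μ.num a i)

section Cost

variable {w : ℝ → ℕ} {Λ : ℕ → ℝ → Prop} {h : ℕ} {μ : Memory}

theorem IdxExpr.eval_le (hμ : Good Λ h μ) (x : IdxExpr) :
    x.eval μ ≤ 2 ^ ((h + 1) * x.nodes) := by
  induction x with
  | const c =>
    -- This is why `nodes` counts a constant with its value.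
    calc c ≤ 2 ^ c := Nat.lt_two_pow_self.le
      _ ≤ 2 ^ ((h + 1) * (c + 1)) := Nat.pow_le_pow_right (by omega) (by nlinarith)
  | cell a i _ =>
    refine (hμ.idx _ _).trans (Nat.pow_le_pow_right (by omega) ?_)
    rw [nodes]; nlinarith
  | add x y hx hy =>
    have h1 : 2 ^ ((h + 1) * x.nodes) ≤ 2 ^ ((h + 1) * (x.nodes + y.nodes)) :=
      Nat.pow_le_pow_right (by omega) (by nlinarith)
    have h2 : 2 ^ ((h + 1) * y.nodes) ≤ 2 ^ ((h + 1) * (x.nodes + y.nodes)) :=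
      Nat.pow_le_pow_right (by omega) (by nlinarith)
    calc x.eval μ + y.eval μ ≤ 2 ^ ((h + 1) * (x.nodes + y.nodes) + 1) := by
          rw [pow_succ]; omega
      _ ≤ _ := Nat.pow_le_pow_right (by omega) (by rw [nodes]; nlinarith)
  | sub x y hx hy =>
    refine (Nat.sub_le _ _).trans (hx.trans (Nat.pow_le_pow_right (by omega) ?_))
    rw [nodes]; nlinarith
  | mul x y hx hy =>
    calc x.eval μ * y.eval μ ≤ 2 ^ ((h + 1) * x.nodes) * 2 ^ ((h + 1) * y.nodes) :=
          Nat.mul_le_mul hx hy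
      _ = 2 ^ ((h + 1) * x.nodes + (h + 1) * y.nodes) := (pow_add _ _ _).symm
      _ ≤ _ := Nat.pow_le_pow_right (by omega) (by rw [nodes]; nlinarith)

theorem natCost_le {m k : ℕ} (hm : m ≤ 2 ^ k) : natCost m ≤ k + 2 := by
  have : m.size ≤ k + 1 := Nat.size_le.2 (hm.trans_lt (Nat.pow_lt_pow_right (by omega) (by omega)))
  rw [natCost]; omega

/-- Every node produces a number whose length is linear in the size of its subexpression, so the
total is quadratic in the number of nodes and linear in `h + 1`. -/
theorem IdxExpr.cost_le (hμ : Good Λ h μ) (x : IdxExpr) :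
    x.cost μ ≤ 6 * x.nodes ^ 2 * (h + 1) := by
  have hv := natCost_le (x.eval_le hμ)
  induction x with
  | const c =>
    rw [cost]; rw [nodes] at hv ⊢
    rw [eval] at hv
    nlinarith
  | cell a i ih =>
    have := ih (natCost_le (i.eval_le hμ))
    rw [cost]; rw [nodes] at hv ⊢; rw [eval] at hv
    nlinarith
  | add x y hx hy =>
    have h1 := hx (natCost_le (x.eval_le hμ))
    have h2 := hy (natCost_le (y.eval_le hμ))
    rw [cost]; rw [nodes] at hv ⊢; rw [eval] at hv
    have : 0 ≤ x.nodes * y.nodes * (h + 1) := Nat.zero_le _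
    nlinarith
  | sub x y hx hy =>
    have h1 := hx (natCost_le (x.eval_le hμ))
    have h2 := hy (natCost_le (y.eval_le hμ))
    rw [cost]; rw [nodes] at hv ⊢; rw [eval] at hv
    have : 0 ≤ x.nodes * y.nodes * (h + 1) := Nat.zero_le _
    nlinarith
  | mul x y hx hy =>
    have h1 := hx (natCost_le (x.eval_le hμ))
    have h2 := hy (natCost_le (y.eval_le hμ))
    rw [cost]; rw [nodes] at hv ⊢; rw [eval] at hv
    have : 0 ≤ x.nodes * y.nodes * (h + 1) := Nat.zero_le _
    nlinarith

theorem NumExpr.length_eval (L : LengthModel w Λ) (hμ : Good Λ h μ) (x : NumExpr) :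
    Λ ((h + 1) * x.nodes) (x.eval μ) := by
  induction x with
  | ofIdx i => exact L.mono (L.natCast (i.eval_le hμ)) (by rw [nodes]; nlinarith)
  | cell a i => exact L.mono (hμ.num _ _) (by rw [nodes]; nlinarith)
  | add x y hx hy => exact L.mono (L.add hx hy) (by rw [nodes]; nlinarith)
  | sub x y hx hy => exact L.mono (L.sub hx hy) (by rw [nodes]; nlinarith)
  | mul x y hx hy => exact L.mono (L.mul hx hy) (by rw [nodes]; nlinarith)
  | div x y hx hy => exact L.mono (L.div hx hy) (by rw [nodes]; nlinarith)

theorem NumExpr.cost_le (L : LengthModel w Λ) (hμ : Good Λ h μ) (x : NumExpr) :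
    x.cost w μ ≤ 6 * x.nodes ^ 2 * (h + 1) := by
  have hv := L.cost_le (x.length_eval L hμ)
  have aux : ∀ {cx cy c a b : ℕ}, cx ≤ 6 * a ^ 2 * (h + 1) → cy ≤ 6 * b ^ 2 * (h + 1) →
      c ≤ 2 * ((h + 1) * (a + b + 1)) + 4 → cx + cy + c ≤ 6 * (a + b + 1) ^ 2 * (h + 1) := by
    intro cx cy c a b h1 h2 h3
    have : 0 ≤ a * b * (h + 1) := Nat.zero_le _
    nlinarith
  induction x with
  | ofIdx i =>
    have := aux (i.cost_le hμ) (Nat.zero_le (6 * 0 ^ 2 * (h + 1))) hv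
    simpa [cost, nodes, eval] using this
  | cell a i =>
    have := aux (i.cost_le hμ) (Nat.zero_le (6 * 0 ^ 2 * (h + 1))) hv
    simpa [cost, nodes, eval] using this
  | add x y hx hy =>
    exact aux (hx (L.cost_le (x.length_eval L hμ))) (hy (L.cost_le (y.length_eval L hμ))) hv
  | sub x y hx hy =>
    exact aux (hx (L.cost_le (x.length_eval L hμ))) (hy (L.cost_le (y.length_eval L hμ))) hv
  | mul x y hx hy =>
    exact aux (hx (L.cost_le (x.length_eval L hμ))) (hy (L.cost_le (y.length_eval L hμ))) hv
  | div x y hx hy =>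
    exact aux (hx (L.cost_le (x.length_eval L hμ))) (hy (L.cost_le (y.length_eval L hμ))) hv

theorem add_cost_le {cx cy a b : ℕ} (h1 : cx ≤ 6 * a ^ 2 * (h + 1))
    (h2 : cy ≤ 6 * b ^ 2 * (h + 1)) : cx + cy ≤ 6 * (a + b) ^ 2 * (h + 1) := by
  have : 0 ≤ a * b * (h + 1) := Nat.zero_le _
  nlinarith

theorem Test.cost_le (L : LengthModel w Λ) (hμ : Good Λ h μ) (b : Test) :
    b.cost w μ ≤ 6 * b.nodes ^ 2 * (h + 1) := by
  cases b with
  | idxLE x y => exact add_cost_le (x.cost_le hμ) (y.cost_le hμ)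
  | numLE x y => exact add_cost_le (x.cost_le L hμ) (y.cost_le L hμ)

end Cost

/-! ## A program logic for total correctness with running times -/

/-- From `μ`, the program `P` halts within its step bound in a good memory with property `Q`. -/
def Run (w : ℝ → ℕ) (Λ : ℕ → ℝ → Prop) (h : ℕ) (P : Program) (μ : Memory) (Q : Memory → Prop) :
    Prop :=
  ∃ ν t, Exec w P μ ν t ∧ t ≤ P.stepBound h * (h + 1) ∧ Good Λ h ν ∧ Q ν

namespace Run

variable {w : ℝ → ℕ} {Λ : ℕ → ℝ → Prop} {h : ℕ} {μ : Memory} {Q : Memory → Prop}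

theorem mono {P : Program} {R : Memory → Prop} (hr : Run w Λ h P μ R)
    (hq : ∀ ν, Good Λ h ν → Frame P μ ν → R ν → Q ν) : Run w Λ h P μ Q := by
  obtain ⟨ν, t, he, ht, hg, hν⟩ := hr
  exact ⟨ν, t, he, ht, hg, hq ν hg he.frame hν⟩

theorem skip (hμ : Good Λ h μ) (hq : Q μ) : Run w Λ h .skip μ Q :=
  ⟨μ, 1, .skip μ, by simp [Program.stepBound], hμ, hq⟩

theorem assignIdx {a : ℕ} {i x : IdxExpr} (hμ : Good Λ h μ) (hx : x.eval μ ≤ 2 ^ h)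
    (hq : Good Λ h (μ.setIdx a (i.eval μ) (x.eval μ)) → Q (μ.setIdx a (i.eval μ) (x.eval μ))) :
    Run w Λ h (.assignIdx a i x) μ Q := by
  have hg : Good Λ h (μ.setIdx a (i.eval μ) (x.eval μ)) :=
    ⟨fun b j => by rw [Memory.setIdx_idx]; split_ifs; exacts [hx, hμ.idx b j], hμ.num⟩
  refine ⟨_, _, .assignIdx μ a i x, ?_, hg, hq hg⟩
  have := add_cost_le (i.cost_le hμ) (x.cost_le hμ)
  have hsq : (i.nodes + x.nodes) ^ 2 ≤ (i.nodes + x.nodes + 1) ^ 2 :=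
    Nat.pow_le_pow_left (by omega) 2
  rw [Program.stepBound]
  nlinarith [Nat.mul_le_mul_right (h + 1) hsq]

theorem assignNum (L : LengthModel w Λ) {a : ℕ} {i : IdxExpr} {x : NumExpr} (hμ : Good Λ h μ)
    (hx : Λ h (x.eval μ))
    (hq : Good Λ h (μ.setNum a (i.eval μ) (x.eval μ)) → Q (μ.setNum a (i.eval μ) (x.eval μ))) :
    Run w Λ h (.assignNum a i x) μ Q := by
  have hg : Good Λ h (μ.setNum a (i.eval μ) (x.eval μ)) :=
    ⟨hμ.idx, fun b j => by rw [Memory.setNum_num]; split_ifs; exacts [hx, hμ.num b j]⟩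
  refine ⟨_, _, .assignNum μ a i x, ?_, hg, hq hg⟩
  have := add_cost_le (i.cost_le hμ) (x.cost_le L hμ)
  have hsq : (i.nodes + x.nodes) ^ 2 ≤ (i.nodes + x.nodes + 1) ^ 2 :=
    Nat.pow_le_pow_left (by omega) 2
  rw [Program.stepBound]
  nlinarith [Nat.mul_le_mul_right (h + 1) hsq]

/-- The intermediate assertion receives the frame of the first program, so data that it does not
touch need not be carried through postconditions. -/
theorem seq {P P' : Program}
    (hr : Run w Λ h P μ fun ν => Good Λ h ν → Frame P μ ν → Run w Λ h P' ν Q) :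
    Run w Λ h (.seq P P') μ Q := by
  obtain ⟨ν, t, he, ht, hg, hν⟩ := hr
  obtain ⟨ρ, t', he', ht', hg', hρ⟩ := hν hg he.frame
  refine ⟨ρ, _, .seq he he', ?_, hg', hρ⟩
  rw [Program.stepBound]
  nlinarith

theorem ite (L : LengthModel w Λ) {b : Test} {P P' : Program} (hμ : Good Λ h μ)
    (h₁ : b.Holds μ → Run w Λ h P μ Q) (h₂ : ¬ b.Holds μ → Run w Λ h P' μ Q) :
    Run w Λ h (.ite b P P') μ Q := by
  have hb := b.cost_le L hμ
  by_cases hB : b.Holds μ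
  · obtain ⟨ν, t, he, ht, hg, hν⟩ := h₁ hB
    refine ⟨ν, _, .iteTrue hB he, ?_, hg, hν⟩
    rw [Program.stepBound]
    nlinarith
  · obtain ⟨ν, t, he, ht, hg, hν⟩ := h₂ hB
    refine ⟨ν, _, .iteFalse hB he, ?_, hg, hν⟩
    rw [Program.stepBound]
    nlinarith

/-- The invariant is indexed by the number of completed iterations, and the total number `m ≤ h` is
known beforehand. This gives termination and the time bound at once. -/
theorem while_ (L : LengthModel w Λ) {b : Test} {P : Program} (Inv : ℕ → Memory → Prop) (m : ℕ)
    (hm : m ≤ h) (hμ : Good Λ h μ) (h0 : Inv 0 μ)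
    (hstep : ∀ i < m, ∀ ν, Good Λ h ν → Frame P μ ν → Inv i ν →
      b.Holds ν ∧ Run w Λ h P ν (Inv (i + 1)))
    (hend : ∀ ν, Good Λ h ν → Frame P μ ν → Inv m ν → ¬ b.Holds ν ∧ Q ν) :
    Run w Λ h (.while b P) μ Q := by
  -- Induction on the number `k` of iterations that remain; the final test accounts for the extra `+
  -- 1`.
  have key : ∀ k, k ≤ m → ∀ ν, Good Λ h ν → Frame P μ ν → Inv (m - k) ν →
      ∃ ρ t, Exec w (.while b P) ν ρ t ∧
        t ≤ (k + 1) * (6 * b.nodes ^ 2 + P.stepBound h + 1) * (h + 1) ∧ Good Λ h ρ ∧ Q ρ := by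
    intro k
    induction k with
    | zero =>
      intro _ ν hg hf hi
      obtain ⟨hb, hq⟩ := hend ν hg hf hi
      refine ⟨ν, _, .whileFalse hb, ?_, hg, hq⟩
      have := b.cost_le L hg
      nlinarith [Nat.zero_le (P.stepBound h * (h + 1))]
    | succ k ih =>
      intro hk ν hg hf hi
      obtain ⟨hb, ν', t, he, ht, hg', hi'⟩ := hstep _ (by omega) ν hg hf hi
      obtain ⟨ρ, t', he', ht', hg'', hq⟩ := ih (by omega) ν' hg' (hf.trans he.frame)
        (by rwa [show m - k = m - (k + 1) + 1 by omega])
      refine ⟨ρ, _, .whileTrue hb he he', ?_, hg'', hq⟩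
      have := b.cost_le L hg
      calc b.cost w ν + t + t' + 1 ≤ 6 * b.nodes ^ 2 * (h + 1) + P.stepBound h * (h + 1)
            + (k + 1) * (6 * b.nodes ^ 2 + P.stepBound h + 1) * (h + 1) + (h + 1) := by omega
        _ = _ := by ring
  obtain ⟨ρ, t, he, ht, hg, hq⟩ := key m le_rfl μ hμ (Frame.refl _ _) (by simpa using h0)
  refine ⟨ρ, t, he, ht.trans ?_, hg, hq⟩
  rw [Program.stepBound]
  exact Nat.mul_le_mul_right _ (Nat.mul_le_mul_right _ (by omega))

end Run

/-- `for c < x do P`, with the counter in the cell `c[0]`. -/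
def Program.for (c : ℕ) (x : IdxExpr) (P : Program) : Program :=
  .seq (.assignIdx c (.const 0) (.const 0))
    (.while (.idxLE (.add (.cell c (.const 0)) (.const 1)) x)
      (.seq P (.assignIdx c (.const 0) (.add (.cell c (.const 0)) (.const 1)))))

/-- The bound `x` is evaluated anew before each iteration, hence `hx`: it may only depend on cells
that the loop leaves alone. The invariant is stated for the memory in which the counter is already
increased. -/
theorem Run.for {w : ℝ → ℕ} {Λ : ℕ → ℝ → Prop} {h : ℕ} {μ : Memory} {Q : Memory → Prop}
    (L : LengthModel w Λ) {c : ℕ} {x : IdxExpr} {P : Program} (Inv : ℕ → Memory → Prop) (m : ℕ)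
    (hm : m ≤ h) (hμ : Good Λ h μ) (hc : P.writesIdx c = false)
    (hx : ∀ ν, Frame (.for c x P) μ ν → x.eval ν = m)
    (h0 : Inv 0 (μ.setIdx c 0 0))
    (hstep : ∀ i < m, ∀ ν, Good Λ h ν → Frame (.for c x P) μ ν → ν.idx c 0 = i → Inv i ν →
      Run w Λ h P ν fun ρ => Inv (i + 1) (ρ.setIdx c 0 (i + 1)))
    (hend : ∀ ν, Good Λ h ν → Frame (.for c x P) μ ν → ν.idx c 0 = m → Inv m ν → Q ν) :
    Run w Λ h (.for c x P) μ Q := by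
  have hmh : m ≤ 2 ^ h := hm.trans Nat.lt_two_pow_self.le
  refine .seq (.assignIdx hμ (Nat.zero_le _) fun hg _ hf₀ => ?_)
  have hf₁ : Frame (.for c x P) μ (μ.setIdx c 0 0) :=
    hf₀.mono (by simp +contextual [Program.for, Program.writesIdx])
      (by simp +contextual [Program.for, Program.writesNum])
  have hfm : ∀ {ν ρ}, Frame (.seq P (.assignIdx c (.const 0) (.add (.cell c (.const 0))
      (.const 1)))) ν ρ → Frame (.for c x P) ν ρ := fun hf =>
    hf.mono (by simp +contextual [Program.for, Program.writesIdx])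
      (by simp +contextual [Program.for, Program.writesNum])
  refine Run.while_ L (fun i ν => ν.idx c 0 = i ∧ Inv i ν) m hm hg
    ⟨by simp [Memory.setIdx_idx, IdxExpr.eval], h0⟩ ?_ ?_
  · rintro i hi ν hν hf ⟨hci, hinv⟩
    have hf' := hf₁.trans (hfm hf)
    refine ⟨by simp only [Test.Holds, IdxExpr.eval, hci, hx ν hf']; omega, .seq ?_⟩
    refine (hstep i hi ν hν hf' hci hinv).mono fun ρ hρ hfρ hi' _ _ => ?_
    have hcρ : ρ.idx c 0 = i := by rw [hfρ.idx c hc, hci]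
    refine .assignIdx hρ (by simp only [IdxExpr.eval, hcρ]; omega) fun _ => ?_
    simp only [IdxExpr.eval, hcρ]
    exact ⟨by simp [Memory.setIdx_idx], hi'⟩
  · rintro ν hν hf ⟨hci, hinv⟩
    have hf' := hf₁.trans (hfm hf)
    exact ⟨by simp only [Test.Holds, IdxExpr.eval, hci, hx ν hf']; omega, hend ν hν hf' hci hinv⟩

/-! ## Sets of positions in the sorted order -/

/-- The number of elements of `X` in front of `i`. -/
def rankIn (X : Finset ℕ) (i : ℕ) : ℕ := #{j ∈ X | j < i}

/-- The sum over `i ∈ X` of weights that depend on `i` and on the rank of `i` in `X`. -/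
def rankSum {M : Type*} [AddCommMonoid M] (g : ℕ → ℕ → M) (X : Finset ℕ) : M :=
  ∑ i ∈ X, g (rankIn X i) i

/-- The sum of the first `k` values in `X`. -/
def firstSum (v : ℕ → ℝ) (k : ℕ) (X : Finset ℕ) : ℝ :=
  rankSum (fun j i => if j < k then v i else 0) X

/-- The new element exceeds all others, so its rank is `#X` and no other rank changes. A dynamic
program in sorted order therefore only has to remember the cardinality. -/
theorem rankSum_insert {M : Type*} [AddCommMonoid M] (g : ℕ → ℕ → M) {X : Finset ℕ} {i : ℕ}
    (hX : X ⊆ range i) : rankSum g (insert i X) = rankSum g X + g #X i := by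
  have hi : i ∉ X := fun h => by simpa using hX h
  have h1 : rankIn (insert i X) i = #X := by
    rw [rankIn, filter_insert, if_neg (lt_irrefl i), filter_true_of_mem]
    exact fun j hj => mem_range.1 (hX hj)
  have h2 : ∀ j ∈ X, rankIn (insert i X) j = rankIn X j := fun j hj => by
    rw [rankIn, filter_insert, if_neg (mem_range.1 (hX hj)).le.not_gt, rankIn]
  rw [rankSum, sum_insert hi, h1, add_comm, rankSum]
  congr 1
  exact sum_congr rfl fun j hj => by rw [h2 j hj]

/-- A set of numbers below `i + 1` either lies below `i` or arises from such a set by adding `i`. -/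
theorem subset_range_succ {X : Finset ℕ} {i : ℕ} (h : X ⊆ range (i + 1)) :
    X ⊆ range i ∨ ∃ Y ⊆ range i, X = insert i Y := by
  by_cases hi : i ∈ X
  · refine .inr ⟨X.erase i, fun j hj => ?_, (insert_erase hi).symm⟩
    have h1 := ne_of_mem_erase hj
    have h2 := mem_range.1 (h (mem_of_mem_erase hj))
    simp; omega
  · refine .inl fun j hj => ?_
    have h1 : j ≠ i := fun e => hi (e ▸ hj)
    have h2 := mem_range.1 (h hj)
    simp; omega

theorem notMem_of_subset_range {X : Finset ℕ} {i : ℕ} (h : X ⊆ range i) : i ∉ X :=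
  fun hi => by simpa using h hi

theorem subset_range_induction {p : ℕ → Finset ℕ → Prop} (h0 : p 0 ∅)
    (hkeep : ∀ i X, X ⊆ range i → p i X → p (i + 1) X)
    (hins : ∀ i X, X ⊆ range i → p i X → p (i + 1) (insert i X)) :
    ∀ i X, X ⊆ range i → p i X := by
  intro i
  induction i with
  | zero => intro X hX; obtain rfl : X = ∅ := by simpa using hX
            exact h0
  | succ i ih =>
    intro X hX
    obtain h | ⟨Y, hY, rfl⟩ := subset_range_succ hX
    · exact hkeep i X h (ih X h)
    · exact hins i Y hY (ih Y hY)

theorem card_le_of_subset_range {X : Finset ℕ} {i : ℕ} (h : X ⊆ range i) : #X ≤ i := by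
  simpa using card_le_card h

theorem rankIn_lt_card {X : Finset ℕ} {i : ℕ} (hi : i ∈ X) : rankIn X i < #X :=
  card_lt_card ⟨filter_subset _ _, fun h => by simpa using h hi⟩

theorem rankIn_injOn (X : Finset ℕ) : Set.InjOn (rankIn X) X := by
  have key : ∀ i ∈ X, ∀ j, i < j → rankIn X i < rankIn X j := by
    intro i hi j hij
    refine card_lt_card ⟨fun k hk => ?_, fun h => ?_⟩
    · simp only [mem_filter] at hk ⊢; exact ⟨hk.1, hk.2.trans hij⟩
    · simpa using h (mem_filter.2 ⟨hi, hij⟩)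
  intro i hi j hj hij
  rcases lt_trichotomy i j with h | h | h
  · exact absurd hij (key i hi j h).ne
  · exact h
  · exact absurd hij (key j hj i h).ne'

theorem card_filter_rankIn_le (X : Finset ℕ) (k : ℕ) : #{i ∈ X | rankIn X i < k} ≤ k := by
  calc #{i ∈ X | rankIn X i < k} = #({i ∈ X | rankIn X i < k}.image (rankIn X)) :=
        (card_image_of_injOn
          ((rankIn_injOn X).mono fun x hx => (mem_filter.1 (mem_coe.1 hx)).1)).symm
    _ ≤ #(range k) := card_le_card fun j hj => by
        obtain ⟨i, hi, rfl⟩ := mem_image.1 hj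
        exact mem_range.2 (mem_filter.1 hi).2
    _ = k := card_range k

theorem firstSum_eq_sum_filter (v : ℕ → ℝ) (k : ℕ) (X : Finset ℕ) :
    firstSum v k X = ∑ i ∈ X with rankIn X i < k, v i := by
  rw [firstSum, rankSum, sum_filter]

theorem firstSum_of_card_le {v : ℕ → ℝ} {k : ℕ} {X : Finset ℕ} (h : #X ≤ k) :
    firstSum v k X = ∑ i ∈ X, v i := by
  rw [firstSum, rankSum]
  exact sum_congr rfl fun i hi => if_pos ((rankIn_lt_card hi).trans_le h)

theorem firstSum_insert (v : ℕ → ℝ) (k : ℕ) {X : Finset ℕ} {i : ℕ} (hX : X ⊆ range i) :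
    firstSum v k (insert i X) = firstSum v k X + if #X < k then v i else 0 :=
  rankSum_insert _ hX

theorem firstSum_nonneg {v : ℕ → ℝ} {X : Finset ℕ} (hv : ∀ i ∈ X, 0 ≤ v i) (k : ℕ) :
    0 ≤ firstSum v k X :=
  sum_nonneg fun i hi => by dsimp only; split_ifs; exacts [hv i hi, le_rfl]

/-- If the values are sorted in decreasing order then the first `k` elements are the best ones. -/
theorem sum_le_firstSum {v : ℕ → ℝ} {n : ℕ} (hv : ∀ i < n, 0 ≤ v i)
    (ha : ∀ i j, i ≤ j → j < n → v j ≤ v i) (k : ℕ) {X : Finset ℕ} (hX : X ⊆ range n) :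
    ∀ X' ⊆ X, #X' ≤ k → ∑ i ∈ X', v i ≤ firstSum v k X := by
  revert hX
  suffices H : ∀ m X, X ⊆ range m → m ≤ n → ∀ X' ⊆ X, #X' ≤ k →
      ∑ i ∈ X', v i ≤ firstSum v k X from fun hX => H n X hX le_rfl
  refine subset_range_induction ?_ (fun m X _ ih hm => ih (by omega)) ?_
  · intro _ X' hX' _
    rw [subset_empty.1 hX']; simp [firstSum, rankSum]
  · intro m X hX ih hm X' hX' hk
    have hm' : m < n := by omega
    rw [firstSum_insert v k hX]
    split_ifs with hc
    · rw [firstSum_of_card_le hc.le, add_comm, ← sum_insert (notMem_of_subset_range hX)]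
      refine sum_le_sum_of_subset_of_nonneg hX' fun i hi _ => hv i ?_
      obtain rfl | hi := mem_insert.1 hi
      · exact hm'
      · have := mem_range.1 (hX hi); omega
    · rw [add_zero]
      by_cases hmem : m ∈ X'
      · have hsub : X'.erase m ⊆ X := fun i hi => by
          have := hX' (mem_of_mem_erase hi)
          exact mem_of_mem_insert_of_ne this (ne_of_mem_erase hi)
        have hcard : #(X'.erase m) < #X := by
          have := card_erase_lt_of_mem hmem
          omega
        -- Exchange argument: `X` has at least `k` elements, so some `y ∈ X` is unused; replacing
        -- `m` by the earlier `y` does not decrease the value.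
        obtain ⟨y, hy, hy'⟩ := exists_mem_notMem_of_card_lt_card hcard
        have hym := mem_range.1 (hX hy)
        have h1 := ih hm'.le (insert y (X'.erase m)) (insert_subset hy hsub) (by
          rw [card_insert_of_notMem hy', card_erase_add_one hmem]; exact hk)
        rw [sum_insert hy'] at h1
        have h2 := ha y m hym.le hm'
        rw [← add_sum_erase _ _ hmem]
        linarith
      · refine ih hm'.le X' (fun i hi => ?_) hk
        exact mem_of_mem_insert_of_ne (hX' hi) fun e => hmem (e ▸ hi)

/-- The objective with weights `a_j = ∑_{k ≥ j} c_k` is a weighted sum of truncated values. -/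
theorem rankSum_eq_sum_firstSum {n : ℕ} {a c v : ℕ → ℝ} {X : Finset ℕ}
    (ha : ∀ j < n, a j = ∑ k ∈ range n with j ≤ k, c k) (hX : X ⊆ range n) :
    rankSum (fun j i => a j * v i) X = ∑ k ∈ range n, c k * firstSum v (k + 1) X := by
  simp only [firstSum, rankSum, mul_sum]
  rw [sum_comm]
  refine sum_congr rfl fun i hi => ?_
  -- The value of an element of rank `j` occurs in exactly those truncated sums with `j ≤ k`, and
  -- the coefficients of these add up to `a j`.
  rw [ha _ ((rankIn_lt_card hi).trans_le (card_le_of_subset_range hX)), sum_mul, sum_filter]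
  refine sum_congr rfl fun k _ => ?_
  simp only [Nat.lt_succ_iff, mul_ite, mul_zero]

/-! ## Sets as binary numbers -/

/-- The binary number whose `i`-th digit from the left (out of `n`) tells whether `i ∈ X`, with the
digits in front of the `i`-th replaced by zeros. -/
def maskFrom (n : ℕ) (X : Finset ℕ) (i : ℕ) : ℕ := ∑ j ∈ X with i ≤ j, 2 ^ (n - 1 - j)

theorem maskFrom_eq (n : ℕ) (X : Finset ℕ) (i : ℕ) :
    maskFrom n X i = (if i ∈ X then 2 ^ (n - 1 - i) else 0) + maskFrom n X (i + 1) := by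
  simp only [maskFrom, sum_filter]
  split_ifs with hi
  · rw [← add_sum_erase _ _ hi, if_pos le_rfl, ← add_sum_erase (a := i) (s := X) _ hi,
      if_neg (by omega), zero_add]
    congr 1
    refine sum_congr rfl fun j hj => ?_
    have := ne_of_mem_erase hj
    exact if_congr (by omega) rfl rfl
  · rw [zero_add]
    refine sum_congr rfl fun j hj => ?_
    have : j ≠ i := fun e => hi (e ▸ hj)
    exact if_congr (by omega) rfl rfl

theorem maskFrom_lt {n : ℕ} {X : Finset ℕ} (hX : X ⊆ range n) (d : ℕ) (hd : d ≤ n) :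
    maskFrom n X (n - d) < 2 ^ d := by
  induction d with
  | zero =>
    rw [maskFrom, filter_false_of_mem]
    · simp
    · intro j hj; have := mem_range.1 (hX hj); omega
  | succ d ih =>
    have h1 := ih (by omega)
    rw [maskFrom_eq, show n - (d + 1) + 1 = n - d by omega,
      show n - 1 - (n - (d + 1)) = d by omega, pow_succ]
    split_ifs <;> omega

theorem maskFrom_zero_insert (n : ℕ) {X : Finset ℕ} {i : ℕ} (hi : i ∉ X) :
    maskFrom n (insert i X) 0 = maskFrom n X 0 + 2 ^ (n - 1 - i) := by
  simp [maskFrom, sum_insert hi, add_comm]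

/-- The later digits contribute less than `2 ^ (n - 1 - i)` altogether. So a mask is decoded from
its leading digit on by comparison and subtraction; the machine has no division of natural numbers.
-/
theorem mem_iff_le_maskFrom {n : ℕ} {X : Finset ℕ} (hX : X ⊆ range n) {i : ℕ} (hi : i < n) :
    i ∈ X ↔ 2 ^ (n - 1 - i) ≤ maskFrom n X i := by
  have h := maskFrom_lt hX (n - 1 - i) (by omega)
  rw [show n - (n - 1 - i) = i + 1 by omega] at h
  rw [maskFrom_eq]
  split_ifs with hX <;> simp [hX, h]

/-! ## The knapsack problem with rank dependent weights -/

/-- Knapsack data sorted by decreasing value; `u` is the largest value of an item that fits. -/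
structure SortedKnapsack (n : ℕ) (s v : ℕ → ℝ) (C u : ℝ) : Prop where
  size_pos : ∀ i < n, 0 < s i
  value_pos : ∀ i < n, 0 < v i
  anti : ∀ i j, i ≤ j → j < n → v j ≤ v i
  value_le : ∀ i < n, s i ≤ C → v i ≤ u
  attained : ∃ i < n, s i ≤ C ∧ v i = u

/-- The sets of positions that fit into the knapsack. -/
structure Fits (n : ℕ) (s : ℕ → ℝ) (C : ℝ) (X : Finset ℕ) : Prop where
  subset : X ⊆ range n
  sum_le : ∑ i ∈ X, s i ≤ C

/-- The value `a_j v_i` in multiples of `M / D`, rounded down and truncated at `D`. -/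
noncomputable def roundedValue (D : ℕ) (M : ℝ) (a v : ℕ → ℝ) (j i : ℕ) : ℕ :=
  min D ⌊a j * v i * D / M⌋₊

theorem roundedValue_le (D : ℕ) (M : ℝ) (a v : ℕ → ℝ) (j i : ℕ) : roundedValue D M a v j i ≤ D :=
  min_le_left _ _

namespace SortedKnapsack

variable {n : ℕ} {s v : ℕ → ℝ} {C u : ℝ}

theorem fits_singleton (S : SortedKnapsack n s v C u) : ∃ i < n, Fits n s C {i} ∧ v i = u := by
  obtain ⟨i, hi, hs, hv⟩ := S.attained
  exact ⟨i, hi, ⟨by simpa using hi, by simpa using hs⟩, hv⟩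

theorem u_pos (S : SortedKnapsack n s v C u) : 0 < u := by
  obtain ⟨i, hi, -, rfl⟩ := S.attained
  exact S.value_pos i hi

theorem n_pos (S : SortedKnapsack n s v C u) : 0 < n := by
  obtain ⟨i, hi, -⟩ := S.attained
  omega

theorem size_le_of_mem (S : SortedKnapsack n s v C u) {X : Finset ℕ} (hX : Fits n s C X) {i : ℕ}
    (hi : i ∈ X) : s i ≤ C :=
  (single_le_sum (fun j hj => (S.size_pos j (mem_range.1 (hX.subset hj))).le) hi).trans hX.sum_le

/-- A set that is optimal for the rounded values is almost optimal. -/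
theorem rounding_loss (S : SortedKnapsack n s v C u) {N : ℕ} (hN : 0 < N) {a : ℕ → ℝ}
    (ha0 : 0 < a 0) (ha : ∀ j < n, 0 ≤ a j ∧ a j ≤ a 0) {X : Finset ℕ} (hX : Fits n s C X)
    (hopt : ∀ Y, Fits n s C Y → rankSum (roundedValue (n * N) (a 0 * u) a v) Y ≤
      rankSum (roundedValue (n * N) (a 0 * u) a v) X) :
    ∀ Y, Fits n s C Y → (1 - 1 / N) * rankSum (fun j i => a j * v i) Y ≤
      rankSum (fun j i => a j * v i) X := by
  set D := n * N
  set M := a 0 * u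
  have hn := S.n_pos
  have hM : 0 < M := mul_pos ha0 S.u_pos
  have hDpos : 0 < D := Nat.mul_pos hn hN
  have hD : (0 : ℝ) < D := by exact_mod_cast hDpos
  have hNr : (0 : ℝ) < N := by exact_mod_cast hN
  have hnr : (0 : ℝ) < n := by exact_mod_cast hn
  have aux : ∀ Y, Fits n s C Y → ∀ i ∈ Y,
      (roundedValue D M a v (rankIn Y i) i : ℝ) * (M / D) ≤ a (rankIn Y i) * v i ∧
      a (rankIn Y i) * v i ≤ (roundedValue D M a v (rankIn Y i) i : ℝ) * (M / D) + M / D := by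
    intro Y hY i hi
    have hin := mem_range.1 (hY.subset hi)
    have hr : rankIn Y i < n :=
      (rankIn_lt_card hi).trans_le (card_le_of_subset_range hY.subset)
    have hx0 : 0 ≤ a (rankIn Y i) * v i := mul_nonneg (ha _ hr).1 (S.value_pos i hin).le
    have hxM : a (rankIn Y i) * v i ≤ M :=
      mul_le_mul (ha _ hr).2 (S.value_le i hin (S.size_le_of_mem hY hi)) (S.value_pos i hin).le
        ha0.le
    generalize hx : a (rankIn Y i) * v i = x at *
    -- An item of a set that fits has weighted value at most `M`, so the truncation in
    -- `roundedValue` is harmless here.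
    have hfl : ⌊x * D / M⌋₊ ≤ D := by
      refine Nat.floor_le_of_le ?_
      rw [div_le_iff₀ hM, mul_comm (D : ℝ)]
      gcongr
    have hq : roundedValue D M a v (rankIn Y i) i = ⌊x * D / M⌋₊ := by
      rw [roundedValue, hx, min_eq_right hfl]
    have hpos : 0 ≤ x * D / M := by positivity
    have h1 := Nat.floor_le hpos
    have h2 := (Nat.lt_floor_add_one (x * D / M)).le
    have hxe : x = x * D / M * (M / D) := by field_simp
    have hMD : 0 < M / D := by positivity
    rw [hq]
    constructor
    · calc _ ≤ x * D / M * (M / D) := by gcongr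
        _ = x := hxe.symm
    · calc x = x * D / M * (M / D) := hxe
        _ ≤ (⌊x * D / M⌋₊ + 1) * (M / D) := by gcongr
        _ = _ := by ring
  have hlow : ∀ Y, Fits n s C Y → ((rankSum (roundedValue D M a v) Y : ℕ) : ℝ) * (M / D) ≤
      rankSum (fun j i => a j * v i) Y := by
    intro Y hY
    rw [rankSum, rankSum, Nat.cast_sum, sum_mul]
    exact sum_le_sum fun i hi => (aux Y hY i hi).1
  have hhigh : ∀ Y, Fits n s C Y → rankSum (fun j i => a j * v i) Y ≤
      ((rankSum (roundedValue D M a v) Y : ℕ) : ℝ) * (M / D) + M / N := by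
    intro Y hY
    calc rankSum (fun j i => a j * v i) Y ≤
          ∑ i ∈ Y, ((roundedValue D M a v (rankIn Y i) i : ℝ) * (M / D) + M / D) :=
          sum_le_sum fun i hi => (aux Y hY i hi).2
      _ = ((rankSum (roundedValue D M a v) Y : ℕ) : ℝ) * (M / D) + #Y * (M / D) := by
          rw [rankSum, Nat.cast_sum, sum_mul, sum_add_distrib, sum_const, nsmul_eq_mul]
      _ ≤ ((rankSum (roundedValue D M a v) Y : ℕ) : ℝ) * (M / D) + n * (M / D) := by
          have : (#Y : ℝ) ≤ n := by exact_mod_cast card_le_of_subset_range hY.subset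
          gcongr
      _ = _ := by
          have : (D : ℝ) = n * N := by simp [D]
          rw [this]; field_simp
  have hle : ∀ Y, Fits n s C Y → rankSum (fun j i => a j * v i) Y - M / N ≤
      rankSum (fun j i => a j * v i) X := by
    intro Y hY
    have h1 : ((rankSum (roundedValue D M a v) Y : ℕ) : ℝ) ≤
        (rankSum (roundedValue D M a v) X : ℕ) := by
      exact_mod_cast hopt Y hY
    have h2 : ((rankSum (roundedValue D M a v) Y : ℕ) : ℝ) * (M / D) ≤
        (rankSum (roundedValue D M a v) X : ℕ) * (M / D) := by gcongr
    linarith [hlow X hX, hhigh Y hY]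
  -- The most valuable item that fits has objective value `M` on its own. This turns the additive
  -- loss `M / N` into a relative one.
  obtain ⟨i, -, hi, hvi⟩ := S.fits_singleton
  have hsing := hle _ hi
  have hval : rankSum (fun j i => a j * v i) {i} = M := by
    simp [rankSum, rankIn, filter_singleton, M, hvi]
  rw [hval] at hsing
  intro Y hY
  have hYle := hle Y hY
  set F := rankSum (fun j i => a j * v i) Y
  have hN1 : (1 : ℝ) / N ≤ 1 := by
    rw [div_le_one hNr]; exact_mod_cast hN
  have e1 : M / N = M * (1 / N) := by ring
  -- If `M ≤ F`, then the loss `M / N` is at most `F / N`; otherwise the comparison with the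
  -- singleton suffices.
  rcases le_total M F with h | h
  · have := mul_le_mul_of_nonneg_right h (by positivity : (0 : ℝ) ≤ 1 / N)
    rw [e1] at hYle
    linarith
  · have := mul_le_mul_of_nonneg_left h (by linarith : (0 : ℝ) ≤ 1 - 1 / N)
    rw [e1] at hsing
    linarith

end SortedKnapsack

/-- A correct entry of the dynamic programming table, after the items in front of `i`: `τ` is the
smallest size of a set of `j` such items with rounded value `r` (and `C + 1` if there is none that
fits), and such a set is encoded by `m`. -/
structure CellCorrect (n : ℕ) (s : ℕ → ℝ) (C : ℝ) (q : ℕ → ℕ → ℕ) (i j r : ℕ) (τ : ℝ) (m : ℕ) :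
    Prop where
  sound : τ = C + 1 ∨ ∃ X ⊆ range i, #X = j ∧ rankSum q X = r ∧ τ = ∑ l ∈ X, s l ∧
    m = maskFrom n X 0 ∧ τ ≤ C
  complete : ∀ X ⊆ range i, #X = j → rankSum q X = r → ∑ l ∈ X, s l ≤ C → τ ≤ ∑ l ∈ X, s l

namespace CellCorrect

variable {n : ℕ} {s : ℕ → ℝ} {C : ℝ} {q : ℕ → ℕ → ℕ} {i j r : ℕ} {τ τ' : ℝ} {m m' : ℕ}

theorem zero (hC : 0 ≤ C) : CellCorrect n s C q 0 0 0 0 0 :=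
  ⟨.inr ⟨∅, by simp [rankSum, maskFrom, hC]⟩, fun X hX => by
    obtain rfl : X = ∅ := by simpa using hX
    simp⟩

/-- The mask is arbitrary, so masks left over from an earlier run need not be erased. -/
theorem absent (h : j ≠ 0 ∨ r ≠ 0) : CellCorrect n s C q 0 j r (C + 1) m :=
  ⟨.inl rfl, fun X hX hj hr => by
    obtain rfl : X = ∅ := by simpa using hX
    simp [rankSum] at hj hr
    omega⟩

/-- A set that contains the last item `i` is nonempty and has rounded value at least `q (j - 1) i`,
so the item cannot contribute to this entry. -/
theorem succ_of_lt (h : CellCorrect n s C q i j r τ m) (hq : j = 0 ∨ r < q (j - 1) i) :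
    CellCorrect n s C q (i + 1) j r τ m := by
  refine ⟨h.sound.imp_right ?_, fun X hX hj hr => ?_⟩
  · rintro ⟨X, hX, hrest⟩
    exact ⟨X, hX.trans (range_subset_range.2 (by omega)), hrest⟩
  · obtain hX | ⟨Y, hY, rfl⟩ := subset_range_succ hX
    · exact h.complete X hX hj hr
    · rw [rankSum_insert q hY] at hr
      rw [card_insert_of_notMem (notMem_of_subset_range hY)] at hj
      obtain hq | hq := hq
      · omega
      · rw [← hj, Nat.add_sub_cancel] at hq
        omega

/-- The transition of the dynamic program, if the entry is not improved. -/
theorem succ_keep (hs : 0 < s i) (h : CellCorrect n s C q i j r τ m)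
    (h' : CellCorrect n s C q i (j + 1) (r + q j i) τ' m')
    (hle : τ + s i ≤ C → τ' ≤ τ + s i) :
    CellCorrect n s C q (i + 1) (j + 1) (r + q j i) τ' m' := by
  refine ⟨h'.sound.imp_right ?_, fun X hX hj hr hC => ?_⟩
  · rintro ⟨X, hX, hrest⟩
    exact ⟨X, hX.trans (range_subset_range.2 (by omega)), hrest⟩
  · obtain hX | ⟨Y, hY, rfl⟩ := subset_range_succ hX
    · exact h'.complete X hX hj hr hC
    · rw [rankSum_insert q hY] at hr
      rw [card_insert_of_notMem (notMem_of_subset_range hY), add_left_inj] at hj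
      rw [sum_insert (notMem_of_subset_range hY), add_comm] at hC ⊢
      rw [hj, add_left_inj] at hr
      have := h.complete Y hY hj hr (by linarith)
      exact (hle (by linarith)).trans (by linarith)

/-- The transition of the dynamic program, if the entry is improved. -/
theorem succ_improve (hs : 0 < s i) (h : CellCorrect n s C q i j r τ m)
    (h' : CellCorrect n s C q i (j + 1) (r + q j i) τ' m')
    (hC : τ + s i ≤ C) (hle : τ + s i ≤ τ') :
    CellCorrect n s C q (i + 1) (j + 1) (r + q j i) (τ + s i) (m + 2 ^ (n - 1 - i)) := by
  refine ⟨.inr ?_, fun X hX hj hr hCX => ?_⟩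
  -- The marker `C + 1` would violate `hC`, since sizes are positive; the entry that is extended
  -- belongs to an actual set.
  · obtain rfl | ⟨X, hX, rfl, rfl, rfl, rfl, -⟩ := h.sound
    · linarith
    · have hi := notMem_of_subset_range hX
      refine ⟨insert i X, ?_, card_insert_of_notMem hi, rankSum_insert q hX, ?_,
        (maskFrom_zero_insert n hi).symm, hC⟩
      · exact insert_subset (by simp) (hX.trans (range_subset_range.2 (by omega)))
      · rw [sum_insert hi, add_comm]
  · obtain hX | ⟨Y, hY, rfl⟩ := subset_range_succ hX
    · exact hle.trans (h'.complete X hX hj hr hCX)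
    · rw [rankSum_insert q hY] at hr
      rw [card_insert_of_notMem (notMem_of_subset_range hY), add_left_inj] at hj
      rw [sum_insert (notMem_of_subset_range hY), add_comm] at hCX ⊢
      rw [hj, add_left_inj] at hr
      have := h.complete Y hY hj hr (by linarith)
      linarith

end CellCorrect

/-! ## Multiplicative weights -/

/-- It suffices that `(1 - x) * (1 + x + 2 * x ^ 2) = 1 + x ^ 2 * (1 - 2 * x)` is at least one,
because `1 + y ≤ exp y`. -/
theorem exp_neg_le_one_sub {x : ℝ} (h0 : 0 ≤ x) (h1 : x ≤ 1 / 2) :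
    Real.exp (-(x + 2 * x ^ 2)) ≤ 1 - x := by
  have hx : 0 < 1 - x := by linarith
  rw [Real.exp_neg, inv_le_comm₀ (Real.exp_pos _) hx]
  have h2 := Real.add_one_le_exp (x + 2 * x ^ 2)
  refine le_trans ?_ h2
  rw [inv_le_iff_one_le_mul₀ hx]
  nlinarith [mul_nonneg h0 h0, mul_nonneg (mul_nonneg h0 h0) (by linarith : 0 ≤ 1 - 2 * x)]

/-- Each weight is bounded below by an exponential in its own accumulated gain, and by `hg` the sum
of all weights is bounded above by an exponential in `T * g`. A single weight is at most the sum, so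
the exponents can be compared. -/
theorem multiplicativeWeights {n N T : ℕ} (hN : 2 ≤ N) {u W : ℕ → ℕ → ℝ} {g : ℝ}
    (hu : ∀ t < T, ∀ k < n, 0 ≤ u t k ∧ u t k ≤ 1) (h0 : ∀ k < n, W 0 k = 1)
    (hW : ∀ t < T, ∀ k < n, W (t + 1) k = W t k * (1 - u t k / N))
    (hg : ∀ t < T, g * ∑ k ∈ range n, W t k ≤ ∑ k ∈ range n, W t k * u t k) :
    ∀ k < n, T * g - N * n ≤ (1 + 2 / N) * ∑ t ∈ range T, u t k := by
  have hNr : (2 : ℝ) ≤ N := by exact_mod_cast hN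
  have hNp : (0 : ℝ) < N := by linarith
  have hlow : ∀ k < n, ∀ t ≤ T,
      Real.exp (-((1 + 2 / N) / N * ∑ t ∈ range t, u t k)) ≤ W t k := by
    intro k hk t
    induction t with
    | zero => intro _; simp [h0 k hk]
    | succ t ih =>
      intro ht
      obtain ⟨hu0, hu1⟩ := hu t (by omega) k hk
      have hx0 : 0 ≤ u t k / N := by positivity
      have hx1 : u t k / N ≤ 1 / 2 := by
        rw [div_le_div_iff₀ hNp two_pos]; linarith
      rw [hW t (by omega) k hk, sum_range_succ, mul_add, neg_add, Real.exp_add]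
      refine mul_le_mul (ih (by omega)) ?_ (Real.exp_pos _).le
        ((Real.exp_pos _).le.trans (ih (by omega)))
      refine le_trans (Real.exp_le_exp.2 (neg_le_neg ?_)) (exp_neg_le_one_sub hx0 hx1)
      have : (1 + 2 / N) / N * u t k - (u t k / N + 2 * (u t k / N) ^ 2) =
          2 * u t k * (1 - u t k) / N ^ 2 := by field_simp; ring
      have h2 : 0 ≤ 2 * u t k * (1 - u t k) / (N : ℝ) ^ 2 :=
        div_nonneg (mul_nonneg (by linarith) (by linarith)) (by positivity)
      linarith
  have hpos : ∀ t ≤ T, 0 ≤ ∑ k ∈ range n, W t k := fun t ht =>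
    sum_nonneg fun k hk => (Real.exp_pos _).le.trans (hlow k (mem_range.1 hk) t ht)
  have hhigh : ∀ t ≤ T, ∑ k ∈ range n, W t k ≤ n * Real.exp (-(t * g / N)) := by
    intro t
    induction t with
    | zero => intro _; simp [sum_congr rfl fun k hk => h0 k (mem_range.1 hk)]
    | succ t ih =>
      intro ht
      have e1 : ∑ k ∈ range n, W (t + 1) k =
          ∑ k ∈ range n, W t k - (∑ k ∈ range n, W t k * u t k) / N := by
        rw [sum_div, ← sum_sub_distrib]
        refine sum_congr rfl fun k hk => ?_
        rw [hW t (by omega) k (mem_range.1 hk)]; ring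
      have e2 := div_le_div_of_nonneg_right (hg t (by omega)) hNp.le
      have e3 : 1 - g / N ≤ Real.exp (-(g / N)) := by linarith [Real.add_one_le_exp (-(g / N))]
      calc ∑ k ∈ range n, W (t + 1) k ≤ (∑ k ∈ range n, W t k) * (1 - g / N) := by
            rw [e1]
            have : g * (∑ k ∈ range n, W t k) / N = (∑ k ∈ range n, W t k) * (g / N) := by ring
            linarith
        _ ≤ (∑ k ∈ range n, W t k) * Real.exp (-(g / N)) := by
            have := hpos t (by omega)
            gcongr
        _ ≤ n * Real.exp (-(t * g / N)) * Real.exp (-(g / N)) := by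
            have := ih (by omega)
            gcongr
        _ = _ := by
            rw [mul_assoc, ← Real.exp_add]
            congr 2
            push_cast; ring
  intro k hk
  have h1 : Real.exp (-((1 + 2 / N) / N * ∑ t ∈ range T, u t k)) ≤
      Real.exp (n + -(T * g / N)) := by
    calc _ ≤ W T k := hlow k hk T le_rfl
      _ ≤ ∑ k ∈ range n, W T k :=
        single_le_sum (f := fun k => W T k)
          (fun k hk => (Real.exp_pos _).le.trans (hlow k (mem_range.1 hk) T le_rfl))
          (mem_range.2 hk)
      _ ≤ n * Real.exp (-(T * g / N)) := hhigh T le_rfl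
      -- The crude bound `n ≤ exp n` makes the additive error `N * n` instead of `N * log n`, at the
      -- price of more rounds.
      _ ≤ Real.exp n * Real.exp (-(T * g / N)) := by
        have : (n : ℝ) ≤ Real.exp n := by linarith [Real.add_one_le_exp (n : ℝ)]
        gcongr
      _ = _ := (Real.exp_add _ _).symm
  have h2 := mul_le_mul_of_nonneg_right (Real.exp_le_exp.1 h1) hNp.le
  have e1 : -((1 + 2 / N) / N * ∑ t ∈ range T, u t k) * N =
      -((1 + 2 / N) * ∑ t ∈ range T, u t k) := by field_simp
  have e2 : (n + -(T * g / N)) * (N : ℝ) = n * N - T * g := by field_simp; ring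
  rw [e1, e2] at h2
  linarith

/-- The guarantee of the multiplicative weights method with approximate best responses `X t` and
approximate normalizations `B k`. -/
theorem SortedKnapsack.average_guarantee {n : ℕ} {s v : ℕ → ℝ} {C u : ℝ}
    (S : SortedKnapsack n s v C u) {N T : ℕ} (hN : 5 ≤ N) (hT : T = 2 * ((n * N) * (n * N)))
    {opt B : ℕ → ℝ} {W : ℕ → ℕ → ℝ} {X : ℕ → Finset ℕ}
    (hopt : ∀ k < n, ∀ Y, Fits n s C Y → firstSum v (k + 1) Y ≤ opt k)
    (hatt : ∀ k < n, ∃ Y, Fits n s C Y ∧ firstSum v (k + 1) Y = opt k)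
    (hBlow : ∀ k < n, (1 - 1 / N) * opt k ≤ B k) (hBhigh : ∀ k < n, B k ≤ opt k)
    (hoptpos : ∀ k < n, 0 < opt k)
    (hX : ∀ t < T, Fits n s C (X t)) (hW0 : ∀ k < n, W 0 k = 1)
    (hW : ∀ t < T, ∀ k < n,
      W (t + 1) k = W t k * (1 - firstSum v (k + 1) (X t) / (2 * N * B k)))
    (hbest : ∀ t < T, (∀ k < n, 0 < W t k) → ∀ Y, Fits n s C Y →
      (1 - 1 / N) * ∑ k ∈ range n, W t k / B k * firstSum v (k + 1) Y ≤
        ∑ k ∈ range n, W t k / B k * firstSum v (k + 1) (X t))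
    {γ : ℝ} (hγ : ∀ c : ℕ → ℝ, (∀ k < n, 0 ≤ c k) → ∃ Y, Fits n s C Y ∧
      γ * ∑ k ∈ range n, c k ≤ ∑ k ∈ range n, c k * (firstSum v (k + 1) Y / opt k)) :
    ∀ k < n, (1 - 5 / N) * γ ≤ (∑ t ∈ range T, firstSum v (k + 1) (X t)) / T / opt k := by
  have hn := S.n_pos
  have hnr : (0 : ℝ) < n := by exact_mod_cast hn
  have hNr : (5 : ℝ) ≤ N := by exact_mod_cast hN
  have hNp : (0 : ℝ) < N := by linarith
  have hη : (1 : ℝ) / N ≤ 1 / 5 := one_div_le_one_div_of_le (by norm_num) hNr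
  have hη0 : (0 : ℝ) < 1 / N := by positivity
  -- it suffices to consider `γ ≥ 1 / n`
  wlog hγn : 1 / (n : ℝ) ≤ γ generalizing γ with H
  · intro k hk
    have h5 : (0 : ℝ) ≤ 1 - 5 / N := by
      have : (5 : ℝ) / N = 5 * (1 / N) := by ring
      linarith
    refine (mul_le_mul_of_nonneg_left (not_le.1 hγn).le h5).trans ?_
    refine H (γ := 1 / n) ?_ le_rfl k hk
    intro c hc
    -- An optimal answer to the cardinality of largest weight alone already guarantees `1 / n`.
    obtain ⟨k₀, hk₀, hmax⟩ := exists_max_image (range n) c ⟨0, mem_range.2 hn⟩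
    obtain ⟨Y, hY, hYopt⟩ := hatt k₀ (mem_range.1 hk₀)
    refine ⟨Y, hY, ?_⟩
    have hsum : ∑ k ∈ range n, c k ≤ n * c k₀ := by
      simpa using sum_le_card_nsmul (range n) c (c k₀) hmax
    calc 1 / (n : ℝ) * ∑ k ∈ range n, c k ≤ 1 / n * (n * c k₀) := by gcongr
      _ = c k₀ * (firstSum v (k₀ + 1) Y / opt k₀) := by
        rw [hYopt, div_self (hoptpos k₀ (mem_range.1 hk₀)).ne']; field_simp
      _ ≤ _ := single_le_sum (f := fun k => c k * (firstSum v (k + 1) Y / opt k))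
        (fun k hk => mul_nonneg (hc k (mem_range.1 hk)) (div_nonneg
          (firstSum_nonneg (fun i hi => (S.value_pos i (mem_range.1 (hY.subset hi))).le) _)
          (hoptpos k (mem_range.1 hk)).le)) hk₀
  have hfs : ∀ {Y}, Fits n s C Y → ∀ k, 0 ≤ firstSum v k Y := fun hY k =>
    firstSum_nonneg (fun i hi => (S.value_pos i (mem_range.1 (hY.subset hi))).le) k
  have hBpos : ∀ k < n, 0 < B k := fun k hk =>
    (mul_pos (by linarith) (hoptpos k hk)).trans_le (hBlow k hk)
  -- The factor `2` keeps the gains below one although `B k` may be smaller than `opt k`: one has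
  -- `opt k ≤ 2 * B k`.
  have hu : ∀ t < T, ∀ k < n, 0 ≤ firstSum v (k + 1) (X t) / (2 * B k) ∧
      firstSum v (k + 1) (X t) / (2 * B k) ≤ 1 := by
    intro t ht k hk
    refine ⟨div_nonneg (hfs (hX t ht) _) (by linarith [hBpos k hk]), ?_⟩
    rw [div_le_one (by linarith [hBpos k hk])]
    nlinarith [hopt k hk _ (hX t ht), hBlow k hk, hoptpos k hk]
  have hWpos : ∀ t ≤ T, ∀ k < n, 0 < W t k := by
    intro t
    induction t with
    | zero => intro _ k hk; rw [hW0 k hk]; exact one_pos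
    | succ t ih =>
      intro ht k hk
      rw [hW t (by omega) k hk]
      refine mul_pos (ih (by omega) k hk) ?_
      have h1 := (hu t (by omega) k hk).2
      have h2 : firstSum v (k + 1) (X t) / (2 * N * B k) =
          firstSum v (k + 1) (X t) / (2 * B k) * (1 / N) := by
        have := hBpos k hk
        field_simp
      rw [h2]
      have := mul_le_mul_of_nonneg_right h1 hη0.le
      linarith
  have hmw := multiplicativeWeights (n := n) (N := N) (T := T) (by omega)
    (u := fun t k => firstSum v (k + 1) (X t) / (2 * B k)) (W := W)
    (g := (1 - 1 / N) * γ / 2) hu hW0 (by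
      intro t ht k hk
      rw [hW t ht k hk]
      have := hBpos k hk
      congr 2
      field_simp) (by
      intro t ht
      have hWt := hWpos t ht.le
      obtain ⟨Y, hY, hYγ⟩ := hγ (W t) fun k hk => (hWt k hk).le
      have hb := hbest t ht hWt Y hY
      have h1 : ∑ k ∈ range n, W t k * (firstSum v (k + 1) Y / opt k) ≤
          ∑ k ∈ range n, W t k / B k * firstSum v (k + 1) Y := by
        refine sum_le_sum fun k hk => ?_
        have hk := mem_range.1 hk
        have h2 : firstSum v (k + 1) Y / opt k ≤ firstSum v (k + 1) Y / B k :=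
          div_le_div_of_nonneg_left (hfs hY _) (hBpos k hk) (hBhigh k hk)
        calc _ ≤ W t k * (firstSum v (k + 1) Y / B k) :=
              mul_le_mul_of_nonneg_left h2 (hWt k hk).le
          _ = _ := by ring
      have h3 : ∑ k ∈ range n, W t k * (firstSum v (k + 1) (X t) / (2 * B k)) =
          (∑ k ∈ range n, W t k / B k * firstSum v (k + 1) (X t)) / 2 := by
        rw [sum_div]
        refine sum_congr rfl fun k hk => ?_
        have := hBpos k (mem_range.1 hk)
        field_simp
      have h4 := mul_le_mul_of_nonneg_left (hYγ.trans h1) (by linarith : (0 : ℝ) ≤ 1 - 1 / N)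
      simp only [h3]
      linarith)
  intro k hk
  have hTr : (T : ℝ) = 2 * ((n * N) * (n * N)) := by rw [hT]; push_cast; ring
  have hTpos : (0 : ℝ) < T := by rw [hTr]; positivity
  have h := hmw k hk
  rw [← sum_div] at h
  set A := ∑ t ∈ range T, firstSum v (k + 1) (X t)
  have hA : 0 ≤ A := sum_nonneg fun t ht => hfs (hX t (mem_range.1 ht)) _
  have hop := hoptpos k hk
  rw [div_div, le_div_iff₀ (by positivity)]
  set η : ℝ := 1 / N with hηdef
  -- This determines the number of rounds: for `γ = 1 / n` and `T = 2 * (n * N) ^ 2` both sides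
  -- agree.
  have hNn : (N : ℝ) * n ≤ T * (η * γ / 2) := by
    have : (N : ℝ) * n = T * (η * (1 / n) / 2) := by rw [hTr, hηdef]; field_simp
    rw [this]
    gcongr
  have e5 : (5 : ℝ) / N = 5 * η := by rw [hηdef]; ring
  have e2 : (2 : ℝ) / N = 2 * η := by rw [hηdef]; ring
  rw [e2] at h
  rw [e5]
  have hAB : A / (2 * B k) * (2 * ((1 - η) * opt k)) ≤ A := by
    calc A / (2 * B k) * (2 * ((1 - η) * opt k)) ≤ A / (2 * B k) * (2 * B k) := by
          have := hBlow k hk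
          have := hBpos k hk
          gcongr
      _ = A := by have := hBpos k hk; field_simp
  have hU : (1 - 5 * η) * γ * T ≤ A / (2 * B k) * (2 * (1 - η)) := by
    set U := A / (2 * B k)
    have hγT : 0 ≤ γ * T := mul_nonneg (le_trans (by positivity) hγn) hTpos.le
    have h1 : γ * T / 2 * (1 - 2 * η) ≤ (1 + 2 * η) * U := by nlinarith
    -- Here the constant `5` arises: `(1 + 2 * η) * (1 - 5 * η) ≤ (1 - η) * (1 - 2 * η)`, the two
    -- sides agreeing to first order. One factor `1 - η` comes from the normalizations, the other
    -- losses from the oracle and the regret.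
    have h2 : (1 + 2 * η) * ((1 - 5 * η) * γ * T) ≤ (1 + 2 * η) * (U * (2 * (1 - η))) := by
      have h3 := mul_le_mul_of_nonneg_left h1 (by linarith : 0 ≤ 2 * (1 - η))
      have h4 : 0 ≤ γ * T * η ^ 2 := by positivity
      nlinarith
    exact le_of_mul_le_mul_left h2 (by linarith)
  calc (1 - 5 * η) * γ * (T * opt k) = (1 - 5 * η) * γ * T * opt k := by ring
    _ ≤ A / (2 * B k) * (2 * (1 - η)) * opt k := by gcongr
    _ = A / (2 * B k) * (2 * ((1 - η) * opt k)) := by ring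
    _ ≤ A := hAB

/-! ## The dynamic programming table -/

theorem rankSum_le {q : ℕ → ℕ → ℕ} {D : ℕ} (hq : ∀ j i, q j i ≤ D) (X : Finset ℕ) :
    rankSum q X ≤ #X * D :=
  sum_le_card_nsmul X _ D fun _ _ => hq _ _

/-- The contents of the dynamic programming table are correct, where `f j r` items have been taken
into account in the entry `(j, r)`, and so is the record of the best entry. -/
structure TableCorrect (n D : ℕ) (s : ℕ → ℝ) (C : ℝ) (q f : ℕ → ℕ → ℕ) (tab : ℕ → ℝ)
    (mask : ℕ → ℕ) (bestVal best : ℕ) : Prop where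
  cell : ∀ j ≤ n, ∀ r ≤ n * D, CellCorrect n s C q (f j r) j r (tab (j * (n * D + 1) + r))
    (mask (j * (n * D + 1) + r))
  best_sound : ∃ X, Fits n s C X ∧ rankSum q X = bestVal ∧ best = maskFrom n X 0
  best_complete : ∀ j ≤ n, ∀ r ≤ n * D, tab (j * (n * D + 1) + r) ≤ C → r ≤ bestVal

theorem address_injective {D j r j' r' : ℕ} (hr : r ≤ D) (hr' : r' ≤ D)
    (h : j * (D + 1) + r = j' * (D + 1) + r') : j = j' ∧ r = r' := by
  have h1 : (j * (D + 1) + r) / (D + 1) = j := by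
    rw [mul_comm, Nat.mul_add_div (by omega), Nat.div_eq_of_lt (by omega), add_zero]
  have h2 : (j' * (D + 1) + r') / (D + 1) = j' := by
    rw [mul_comm, Nat.mul_add_div (by omega), Nat.div_eq_of_lt (by omega), add_zero]
  obtain rfl : j = j' := by rw [← h1, h, h2]
  exact ⟨rfl, by omega⟩

namespace TableCorrect

variable {n D : ℕ} {s : ℕ → ℝ} {C : ℝ} {q f f' : ℕ → ℕ → ℕ} {tab : ℕ → ℝ} {mask : ℕ → ℕ}
  {bestVal best : ℕ}

theorem congr (h : TableCorrect n D s C q f tab mask bestVal best)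
    (hf : ∀ j ≤ n, ∀ r ≤ n * D, f j r = f' j r) :
    TableCorrect n D s C q f' tab mask bestVal best :=
  ⟨fun j hj r hr => hf j hj r hr ▸ h.cell j hj r hr, h.best_sound, h.best_complete⟩

theorem init (hC : 0 ≤ C) (h0 : tab 0 = 0) (hm : mask 0 = 0)
    (htab : ∀ m < (n + 1) * (n * D + 1), m ≠ 0 → tab m = C + 1) :
    TableCorrect n D s C q (fun _ _ => 0) tab mask 0 0 := by
  have key : ∀ j ≤ n, ∀ r ≤ n * D, j ≠ 0 ∨ r ≠ 0 → tab (j * (n * D + 1) + r) = C + 1 := by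
    intro j hj r hr h
    refine htab _ ?_ ?_
    · calc j * (n * D + 1) + r < j * (n * D + 1) + (n * D + 1) := by omega
        _ = (j + 1) * (n * D + 1) := by ring
        _ ≤ _ := Nat.mul_le_mul_right _ (by omega)
    · intro e
      obtain ⟨rfl, rfl⟩ : j = 0 ∧ r = 0 := by simpa using e
      simp at h
  refine ⟨fun j hj r hr => ?_, ⟨∅, ⟨by simp, by simpa using hC⟩, rfl, by simp [maskFrom]⟩,
    fun j hj r hr hle => ?_⟩
  · by_cases h : j = 0 ∧ r = 0
    · obtain ⟨rfl, rfl⟩ := h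
      simpa [h0, hm] using CellCorrect.zero hC
    · rw [key j hj r hr (by omega)]
      exact .absent (by omega)
  · by_contra h
    rw [key j hj r hr (by omega)] at hle
    linarith

/-- Entries of small rounded value are not affected by a further item. -/
theorem skip_small {i jj : ℕ}
    (h : TableCorrect n D s C q (fun j _ => if jj + 1 < j then i + 1 else i)
    tab mask bestVal best) :
    TableCorrect n D s C q
      (fun j r => if jj + 1 < j ∨ j = jj + 1 ∧ r < 0 + q jj i then i + 1 else i)
      tab mask bestVal best := by
  refine ⟨fun j hj r hr => ?_, h.best_sound, h.best_complete⟩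
  have := h.cell j hj r hr
  by_cases h1 : jj + 1 < j
  · simpa [h1] using this
  · by_cases h2 : j = jj + 1 ∧ r < 0 + q jj i
    · rw [if_pos (.inr h2)]
      rw [if_neg h1] at this
      obtain ⟨rfl, h2⟩ := h2
      exact this.succ_of_lt (.inr (by simpa using h2))
    · rw [if_neg (by tauto)]
      simpa [h1] using this

variable {i jj r : ℕ}

/-- The layers are treated from the top down. When item `i` is added to the entry `(jj, r)`, neither
this entry nor its target in layer `jj + 1` has taken `i` into account, so one table can be
overwritten in place. -/
theorem step_keep (hs : 0 < s i) (hjj : jj < n) (hr : r ≤ n * D)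
    (h : TableCorrect n D s C q
      (fun j r' => if jj + 1 < j ∨ j = jj + 1 ∧ r' < r + q jj i then i + 1 else i)
      tab mask bestVal best)
    (hle : tab (jj * (n * D + 1) + r) + s i ≤ C → r + q jj i ≤ n * D →
      tab ((jj + 1) * (n * D + 1) + (r + q jj i)) ≤ tab (jj * (n * D + 1) + r) + s i) :
    TableCorrect n D s C q
      (fun j r' => if jj + 1 < j ∨ j = jj + 1 ∧ r' < r + 1 + q jj i then i + 1 else i)
      tab mask bestVal best := by
  refine ⟨fun j hj r' hr' => ?_, h.best_sound, h.best_complete⟩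
  by_cases hc : j = jj + 1 ∧ r' = r + q jj i
  · obtain ⟨rfl, rfl⟩ := hc
    have h1 := h.cell jj hjj.le r hr
    have h2 := h.cell (jj + 1) hj _ hr'
    simp only [show ¬ (jj + 1 < jj ∨ jj = jj + 1 ∧ r < r + q jj i) by omega,
      lt_irrefl, and_false, or_false, if_false] at h1 h2
    rw [if_pos (.inr ⟨rfl, by omega⟩)]
    exact h1.succ_keep hs h2 fun hC => hle hC hr'
  · have h1 := h.cell j hj r' hr'
    rwa [if_congr (show _ ↔ jj + 1 < j ∨ j = jj + 1 ∧ r' < r + q jj i by omega) rfl rfl]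

/-- A set of `jj` items has rounded value at most `jj * D`, so the target lies inside the table
whenever the extended set fits. The program therefore needs no range test. -/
theorem target_le (hq : ∀ j i, q j i ≤ D) (hs : 0 < s i) (hjj : jj < n) (hr : r ≤ n * D)
    (h : TableCorrect n D s C q
      (fun j r' => if jj + 1 < j ∨ j = jj + 1 ∧ r' < r + q jj i then i + 1 else i)
      tab mask bestVal best) (hC : tab (jj * (n * D + 1) + r) + s i ≤ C) :
    r + q jj i ≤ n * D := by
  have h1 := h.cell jj hjj.le r hr
  simp only [show ¬ (jj + 1 < jj ∨ jj = jj + 1 ∧ r < r + q jj i) by omega, if_false] at h1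
  obtain h2 | ⟨X, -, hXj, hXr, -⟩ := h1.sound
  · linarith
  · have h2 := rankSum_le hq X
    rw [hXj, hXr] at h2
    calc r + q jj i ≤ jj * D + D := Nat.add_le_add h2 (hq _ _)
      _ = (jj + 1) * D := by ring
      _ ≤ n * D := Nat.mul_le_mul_right _ hjj

theorem improved_cell (hq : ∀ j i, q j i ≤ D) (hs : 0 < s i) (hjj : jj < n) (hr : r ≤ n * D)
    (h : TableCorrect n D s C q
      (fun j r' => if jj + 1 < j ∨ j = jj + 1 ∧ r' < r + q jj i then i + 1 else i)
      tab mask bestVal best)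
    (hC : tab (jj * (n * D + 1) + r) + s i ≤ C)
    (hle : tab (jj * (n * D + 1) + r) + s i ≤ tab ((jj + 1) * (n * D + 1) + (r + q jj i))) :
    CellCorrect n s C q (i + 1) (jj + 1) (r + q jj i) (tab (jj * (n * D + 1) + r) + s i)
      (mask (jj * (n * D + 1) + r) + 2 ^ (n - 1 - i)) := by
  have hr' := h.target_le hq hs hjj hr hC
  have h1 := h.cell jj hjj.le r hr
  have h2 := h.cell (jj + 1) hjj _ hr'
  simp only [show ¬ (jj + 1 < jj ∨ jj = jj + 1 ∧ r < r + q jj i) by omega,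
    lt_irrefl, and_false, or_false, if_false] at h1 h2
  exact h1.succ_improve hs h2 hC hle

/-- The record of the best entry keeps its own copy of the mask, so it stays valid when the table
entry is improved later. -/
theorem step_improve (hq : ∀ j i, q j i ≤ D) (hs : 0 < s i) (hjj : jj < n) (hr : r ≤ n * D)
    (hi : i < n)
    (h : TableCorrect n D s C q
      (fun j r' => if jj + 1 < j ∨ j = jj + 1 ∧ r' < r + q jj i then i + 1 else i)
      tab mask bestVal best)
    (hC : tab (jj * (n * D + 1) + r) + s i ≤ C)
    (hle : tab (jj * (n * D + 1) + r) + s i ≤ tab ((jj + 1) * (n * D + 1) + (r + q jj i)))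
    {bestVal' best' : ℕ}
    (hbest : bestVal ≤ r + q jj i ∧ bestVal' = r + q jj i ∧
        best' = mask (jj * (n * D + 1) + r) + 2 ^ (n - 1 - i) ∨
      r + q jj i ≤ bestVal ∧ bestVal' = bestVal ∧ best' = best) :
    TableCorrect n D s C q
      (fun j r' => if jj + 1 < j ∨ j = jj + 1 ∧ r' < r + 1 + q jj i then i + 1 else i)
      (Function.update tab ((jj + 1) * (n * D + 1) + (r + q jj i))
        (tab (jj * (n * D + 1) + r) + s i))
      (Function.update mask ((jj + 1) * (n * D + 1) + (r + q jj i))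
        (mask (jj * (n * D + 1) + r) + 2 ^ (n - 1 - i))) bestVal' best' := by
  have hr' := h.target_le hq hs hjj hr hC
  have hnew := h.improved_cell hq hs hjj hr hC hle
  refine ⟨fun j hj r' hr'' => ?_, ?_, fun j hj r' hr'' hle' => ?_⟩
  · by_cases hc : j = jj + 1 ∧ r' = r + q jj i
    · obtain ⟨rfl, rfl⟩ := hc
      rw [Function.update_self, Function.update_self, if_pos (.inr ⟨rfl, by omega⟩)]
      exact hnew
    · have hne : j * (n * D + 1) + r' ≠ (jj + 1) * (n * D + 1) + (r + q jj i) :=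
        fun e => hc (address_injective hr'' hr' e)
      have h1 := h.cell j hj r' hr''
      rw [Function.update_of_ne hne, Function.update_of_ne hne]
      rwa [if_congr (show _ ↔ jj + 1 < j ∨ j = jj + 1 ∧ r' < r + q jj i by omega) rfl rfl]
  · obtain ⟨-, rfl, rfl⟩ | ⟨-, rfl, rfl⟩ := hbest
    · obtain h1 | ⟨X, hX, -, hXr, hXs, hXm, hXC⟩ := hnew.sound
      · linarith
      · exact ⟨X, ⟨hX.trans (range_subset_range.2 hi), hXs ▸ hXC⟩, hXr, hXm⟩
    · exact h.best_sound
  · have hbv : bestVal ≤ bestVal' ∧ r + q jj i ≤ bestVal' := by omega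
    by_cases hc : j = jj + 1 ∧ r' = r + q jj i
    · omega
    · have hne : j * (n * D + 1) + r' ≠ (jj + 1) * (n * D + 1) + (r + q jj i) :=
        fun e => hc (address_injective hr'' hr' e)
      rw [Function.update_of_ne hne] at hle'
      exact (h.best_complete j hj r' hr'' hle').trans hbv.1

/-- When all layers have been treated, the item has been taken into account everywhere. -/
theorem finish_item (h : TableCorrect n D s C q (fun j _ => if 0 < j then i + 1 else i)
    tab mask bestVal best) :
    TableCorrect n D s C q (fun _ _ => i + 1) tab mask bestVal best := by
  refine ⟨fun j hj r hr => ?_, h.best_sound, h.best_complete⟩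
  have h1 := h.cell j hj r hr
  rcases Nat.eq_zero_or_pos j with rfl | hj
  · exact CellCorrect.succ_of_lt h1 (.inl rfl)
  · rwa [if_pos hj] at h1

/-- The entry that belongs to the cardinality and rounded value of a set `Y` that fits is at most
the size of `Y`, hence at most `C`, and so its rounded value is dominated by the record. -/
theorem optimal (hq : ∀ j i, q j i ≤ D)
    (h : TableCorrect n D s C q (fun _ _ => n) tab mask bestVal best) :
    ∃ X, Fits n s C X ∧ best = maskFrom n X 0 ∧
      ∀ Y, Fits n s C Y → rankSum q Y ≤ rankSum q X := by
  obtain ⟨X, hX, hXr, hXm⟩ := h.best_sound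
  refine ⟨X, hX, hXm, fun Y hY => ?_⟩
  have hcard := card_le_of_subset_range hY.subset
  have hr : rankSum q Y ≤ n * D := (rankSum_le hq Y).trans (Nat.mul_le_mul_right _ hcard)
  rw [hXr]
  exact h.best_complete _ hcard _ hr
    (((h.cell _ hcard _ hr).complete Y hY.subset rfl rfl hY.sum_le).trans hY.sum_le)

end TableCorrect

/-! ### Lengths of sums, products and table entries -/

theorem LengthModel.zero {w : ℝ → ℕ} {Λ : ℕ → ℝ → Prop} (L : LengthModel w Λ) (a : ℕ) :
    Λ a 0 := by
  simpa using L.natCast (Nat.zero_le (2 ^ a))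

theorem LengthModel.one {w : ℝ → ℕ} {Λ : ℕ → ℝ → Prop} (L : LengthModel w Λ) (a : ℕ) :
    Λ a 1 := by
  simpa using L.natCast (Nat.one_le_two_pow (n := a))

theorem LengthModel.nat {w : ℝ → ℕ} {Λ : ℕ → ℝ → Prop} (L : LengthModel w Λ) (m : ℕ) :
    Λ m (m : ℝ) :=
  L.natCast Nat.lt_two_pow_self.le

theorem LengthModel.sum {w : ℝ → ℕ} {Λ : ℕ → ℝ → Prop} (L : LengthModel w Λ) {ι : Type*}
    {X : Finset ι} {f : ι → ℝ} {b n : ℕ} (hf : ∀ i ∈ X, Λ b (f i)) (hX : #X ≤ n) :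
    Λ (n * (b + 1)) (∑ i ∈ X, f i) := by
  classical
  refine L.mono (a := #X * (b + 1)) ?_ (Nat.mul_le_mul_right _ hX)
  clear hX
  induction X using Finset.induction_on with
  | empty => simpa using L.zero _
  | insert i X hi ih =>
    rw [sum_insert hi, card_insert_of_notMem hi]
    exact L.mono (L.add (hf i (by simp)) (ih fun j hj => hf j (by simp [hj])))
      (le_of_eq (by ring))

theorem LengthModel.prod {w : ℝ → ℕ} {Λ : ℕ → ℝ → Prop} (L : LengthModel w Λ) {f : ℕ → ℝ}
    {b : ℕ} (m : ℕ) (hf : ∀ i < m, Λ b (f i)) : Λ (m * b) (∏ i ∈ range m, f i) := by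
  induction m with
  | zero => simpa using L.one _
  | succ m ih =>
    rw [prod_range_succ]
    exact L.mono (L.mul (ih fun i hi => hf i (by omega)) (hf m (by omega))) (le_of_eq (by ring))

/-- The length of a table entry is bounded through its meaning, a sum of at most `n` sizes, and not
by following the additions that produced it. -/
theorem CellCorrect.length {w : ℝ → ℕ} {Λ : ℕ → ℝ → Prop} (L : LengthModel w Λ) {n : ℕ}
    {s : ℕ → ℝ} {C : ℝ} {q : ℕ → ℕ → ℕ} {i j r : ℕ} {τ : ℝ} {m b : ℕ}
    (h : CellCorrect n s C q i j r τ m) (hi : i ≤ n) (hs : ∀ l < n, Λ b (s l)) (hτ : τ ≤ C) :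
    Λ (n * (b + 1)) τ ∧ m < 2 ^ n := by
  obtain h1 | ⟨X, hX, -, -, rfl, rfl, -⟩ := h.sound
  · linarith
  · have hXn := hX.trans (range_subset_range.2 hi)
    refine ⟨L.sum (fun l hl => hs l (mem_range.1 (hXn hl))) (card_le_of_subset_range hXn), ?_⟩
    simpa using maskFrom_lt hXn n le_rfl

/-! ## The program -/

instance : Add IdxExpr := ⟨.add⟩
instance : Sub IdxExpr := ⟨.sub⟩
instance : Mul IdxExpr := ⟨.mul⟩
instance : Add NumExpr := ⟨.add⟩
instance : Sub NumExpr := ⟨.sub⟩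
instance : Mul NumExpr := ⟨.mul⟩
instance : Div NumExpr := ⟨.div⟩

/-- The cell `a[0]`. -/
def IdxExpr.var (a : ℕ) : IdxExpr := .cell a (.const 0)

/-- The cell `a[0]`. -/
def NumExpr.var (a : ℕ) : NumExpr := .cell a (.const 0)

/-- A natural number constant. -/
def NumExpr.const (c : ℕ) : NumExpr := .ofIdx (.const c)

section Eval

variable (μ : Memory)

@[simp] theorem IdxExpr.eval_const (c : ℕ) : (IdxExpr.const c).eval μ = c := rfl
@[simp] theorem IdxExpr.eval_var (a : ℕ) : (IdxExpr.var a).eval μ = μ.idx a 0 := rfl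
@[simp] theorem IdxExpr.eval_cell (a : ℕ) (i : IdxExpr) :
    (IdxExpr.cell a i).eval μ = μ.idx a (i.eval μ) := rfl
@[simp] theorem IdxExpr.eval_add (x y : IdxExpr) : (x + y).eval μ = x.eval μ + y.eval μ := rfl
@[simp] theorem IdxExpr.eval_sub (x y : IdxExpr) : (x - y).eval μ = x.eval μ - y.eval μ := rfl
@[simp] theorem IdxExpr.eval_mul (x y : IdxExpr) : (x * y).eval μ = x.eval μ * y.eval μ := rfl
@[simp] theorem NumExpr.eval_const (c : ℕ) : (NumExpr.const c).eval μ = c := rfl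
@[simp] theorem NumExpr.eval_var (a : ℕ) : (NumExpr.var a).eval μ = μ.num a 0 := rfl
@[simp] theorem NumExpr.eval_ofIdx (i : IdxExpr) : (NumExpr.ofIdx i).eval μ = i.eval μ := rfl
@[simp] theorem NumExpr.eval_cell (a : ℕ) (i : IdxExpr) :
    (NumExpr.cell a i).eval μ = μ.num a (i.eval μ) := rfl
@[simp] theorem NumExpr.eval_add (x y : NumExpr) : (x + y).eval μ = x.eval μ + y.eval μ := rfl
@[simp] theorem NumExpr.eval_sub (x y : NumExpr) : (x - y).eval μ = x.eval μ - y.eval μ := rfl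
@[simp] theorem NumExpr.eval_mul (x y : NumExpr) : (x * y).eval μ = x.eval μ * y.eval μ := rfl
@[simp] theorem NumExpr.eval_div (x y : NumExpr) : (x / y).eval μ = x.eval μ / y.eval μ := rfl
@[simp] theorem Test.holds_idxLE (x y : IdxExpr) :
    (Test.idxLE x y).Holds μ ↔ x.eval μ ≤ y.eval μ := Iff.rfl
@[simp] theorem Test.holds_numLE (x y : NumExpr) :
    (Test.numLE x y).Holds μ ↔ x.eval μ ≤ y.eval μ := Iff.rfl

end Eval

attribute [simp] Memory.setIdx_idx_of_ne Memory.setIdx_num Memory.setNum_num_of_ne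
  Memory.setNum_idx

@[simp] theorem Memory.setIdx_idx_self (μ : Memory) (a i x : ℕ) :
    (μ.setIdx a i x).idx a = Function.update (μ.idx a) i x := by
  funext j; simp [Memory.setIdx_idx, Function.update_apply]

@[simp] theorem Memory.setNum_num_self (μ : Memory) (a i : ℕ) (x : ℝ) :
    (μ.setNum a i x).num a = Function.update (μ.num a) i x := by
  funext j; simp [Memory.setNum_num, Function.update_apply]

local infixr:60 " ;; " => Program.seq

-- Index arrays: number of items, length of the output, output, `N`, `D = n N`, `W = n D + 1`,
-- loop counters, rank, sorted order, powers of two, rounded value, masks of the table entries, best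
-- rounded value, mask of the best set, number of decoded items.
local notation "iLen" => (1 : ℕ)
local notation "iOut" => (2 : ℕ)
local notation "iAcc" => (3 : ℕ)
local notation "iD" => (4 : ℕ)
local notation "iW" => (5 : ℕ)
local notation "cE" => (6 : ℕ)
local notation "cF" => (7 : ℕ)
local notation "iRank" => (8 : ℕ)
local notation "iOrd" => (9 : ℕ)
local notation "iPow" => (10 : ℕ)
local notation "cK" => (11 : ℕ)
local notation "cT" => (12 : ℕ)
local notation "cM" => (13 : ℕ)
local notation "cI" => (14 : ℕ)
local notation "cJ" => (15 : ℕ)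
local notation "cL" => (16 : ℕ)
local notation "cR" => (17 : ℕ)
local notation "cG" => (18 : ℕ)
local notation "iQ" => (19 : ℕ)
local notation "iMask" => (20 : ℕ)
local notation "iBestVal" => (21 : ℕ)
local notation "iBest" => (22 : ℕ)
local notation "iCnt" => (23 : ℕ)
-- Number arrays: probabilities, sorted sizes and values, largest value, objective, normalizations,
-- weights, sizes of the table entries, truncated values of the set found, accumulator, scale.
local notation "rProb" => (4 : ℕ)
local notation "rSize" => (5 : ℕ)
local notation "rVal" => (6 : ℕ)
local notation "rMax" => (7 : ℕ)
local notation "rObj" => (8 : ℕ)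
local notation "rNorm" => (9 : ℕ)
local notation "rWt" => (10 : ℕ)
local notation "rTab" => (11 : ℕ)
local notation "rFirst" => (12 : ℕ)
local notation "rSum" => (13 : ℕ)
local notation "rScale" => (14 : ℕ)

namespace Program

open IdxExpr (var const cell)

/-- Compute the accuracy `N` (at least `5`, with `N ε > 5`), `D`, `W` and the number of rounds. -/
def chooseAccuracy : Program :=
  .assignIdx iAcc (const 0) (const 5) ;;
  .while (.numLE (.ofIdx (var iAcc) * .var 3) (.const 5))
    (.assignIdx iAcc (const 0) (var iAcc + const 1)) ;;
  .assignIdx iD (const 0) (var 0 * var iAcc) ;;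
  .assignIdx iW (const 0) (var 0 * var iD + const 1) ;;
  .assignIdx iLen (const 0) (const 2 * (var iD * var iD))

/-- Find the largest value of an item that fits into the knapsack. -/
def findMax : Program :=
  .for cE (var 0) (.ite (.numLE (.cell 0 (var cE)) (.var 2))
    (.ite (.numLE (.var rMax) (.cell 1 (var cE)))
      (.assignNum rMax (const 0) (.cell 1 (var cE))) .skip) .skip)

/-- Count the items in front of the current item in the sorted order. -/
def computeRank : Program :=
  .assignIdx iRank (const 0) (const 0) ;;
  .for cF (var 0) (.ite (.idxLE (var cF + const 1) (var cE))
    (.ite (.numLE (.cell 1 (var cE)) (.cell 1 (var cF)))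
      (.assignIdx iRank (const 0) (var iRank + const 1)) .skip)
    (.ite (.numLE (.cell 1 (var cF)) (.cell 1 (var cE)))
      .skip (.assignIdx iRank (const 0) (var iRank + const 1))))

/-- Sort the items by decreasing value. -/
def sortItems : Program :=
  .for cE (var 0) (
    computeRank ;;
    .assignIdx iOrd (var iRank) (var cE) ;;
    .assignNum rSize (var iRank) (.cell 0 (var cE)) ;;
    .assignNum rVal (var iRank) (.cell 1 (var cE)))

/-- Tabulate the powers of two. -/
def powers : Program :=
  .assignIdx iPow (const 0) (const 1) ;;
  .for cE (var 0) (.assignIdx iPow (var cE + const 1) (cell iPow (var cE) + cell iPow (var cE)))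

/-- Initialize the dynamic programming table. -/
def resetTable : Program :=
  .assignNum rScale (const 0) (.var rObj * .var rMax) ;;
  .for cM ((var 0 + const 1) * var iW) (.assignNum rTab (var cM) (.var 2 + .const 1)) ;;
  .assignNum rTab (const 0) (.const 0) ;;
  .assignIdx iMask (const 0) (const 0) ;;
  .assignIdx iBestVal (const 0) (const 0) ;;
  .assignIdx iBest (const 0) (const 0)

/-- The rounded value of the current item in the current layer of the table. -/
def roundValue : Program :=
  .assignIdx iQ (const 0) (const 0) ;;
  .for cL (var iD) (.ite
    (.numLE (.ofIdx (var cL + const 1) * .var rScale)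
      (.cell rObj (var 0 - const 1 - var cJ) * .cell rVal (var cI) * .ofIdx (var iD)))
    (.assignIdx iQ (const 0) (var cL + const 1)) .skip)

/-- The address of the current table entry. -/
def source : IdxExpr := (var 0 - const 1 - var cJ) * var iW + var cR

/-- The address of the table entry that is reached by adding the current item. -/
def target : IdxExpr := (var 0 - const 1 - var cJ + const 1) * var iW + (var cR + var iQ)

/-- Add the current item to the set in the current table entry. -/
def updateCell : Program :=
  .ite (.numLE (.cell rTab source + .cell rSize (var cI)) (.var 2))
    (.ite (.numLE (.cell rTab source + .cell rSize (var cI)) (.cell rTab target))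
      (.assignIdx iMask target (cell iMask source + cell iPow (var 0 - const 1 - var cI)) ;;
        .assignNum rTab target (.cell rTab source + .cell rSize (var cI)) ;;
        .ite (.idxLE (var iBestVal) (var cR + var iQ))
          (.assignIdx iBestVal (const 0) (var cR + var iQ) ;;
            .assignIdx iBest (const 0) (cell iMask target))
          .skip)
      .skip)
    .skip

/-- Fill the dynamic programming table. -/
def fillTable : Program :=
  .for cI (var 0) (.for cJ (var 0) (roundValue ;; .for cR (var iW) updateCell))

/-- Write the set with the binary code `iBest` to the current row of the output, and compute its
truncated values. -/
def decode : Program :=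
  .for cG (var 0) (.assignNum rFirst (var cG) (.const 0)) ;;
  .assignIdx iCnt (const 0) (const 0) ;;
  .for cI (var 0) (.ite (.idxLE (cell iPow (var 0 - const 1 - var cI)) (var iBest))
    (.assignIdx iBest (const 0) (var iBest - cell iPow (var 0 - const 1 - var cI)) ;;
      .assignIdx iOut (var cT * var 0 + cell iOrd (var cI)) (const 1) ;;
      .for cG (var 0) (.ite (.idxLE (var iCnt) (var cG))
        (.assignNum rFirst (var cG) (.cell rFirst (var cG) + .cell rVal (var cI))) .skip) ;;
      .assignIdx iCnt (const 0) (var iCnt + const 1))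
    (.assignIdx iOut (var cT * var 0 + cell iOrd (var cI)) (const 0)))

/-- Approximately solve the knapsack problem with rank dependent weights `rObj`. -/
def oracle : Program := resetTable ;; fillTable ;; decode

/-- Approximate the optimal truncated values, and initialize the weights. -/
def normalize : Program :=
  .for cK (var 0) (
    .for cE (var 0) (.ite (.idxLE (var cE) (var cK))
      (.assignNum rObj (var cE) (.const 1)) (.assignNum rObj (var cE) (.const 0))) ;;
    oracle ;;
    .assignNum rNorm (var cK) (.cell rFirst (var cK)) ;;
    .assignNum rWt (var cK) (.const 1))

/-- The objective for the current weights. -/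
def setObjective : Program :=
  .assignNum rSum (const 0) (.const 0) ;;
  .for cE (var 0) (
    .assignNum rSum (const 0) (.var rSum + .cell rWt (var 0 - const 1 - var cE) /
      .cell rNorm (var 0 - const 1 - var cE)) ;;
    .assignNum rObj (var 0 - const 1 - var cE) (.var rSum))

/-- Decrease the weights according to the truncated values of the last set. -/
def updateWeights : Program :=
  .for cE (var 0) (.assignNum rWt (var cE) (.cell rWt (var cE) *
    (.const 1 - .cell rFirst (var cE) / (.const 2 * .ofIdx (var iAcc) * .cell rNorm (var cE)))))

/-- The rounds of the multiplicative weights method. -/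
def rounds : Program :=
  .for cT (var iLen) (
    setObjective ;; oracle ;; updateWeights ;;
    .assignNum rProb (var cT) (.const 1 / .ofIdx (var iLen)))

/-- The approximation scheme for the maximum cardinality robustness problem for knapsack. -/
def robustKnapsack : Program :=
  chooseAccuracy ;; findMax ;; sortItems ;; powers ;; normalize ;; rounds

end Program

/-! ## Correctness of the knapsack oracle -/

theorem Run.seq_mono {w : ℝ → ℕ} {Λ : ℕ → ℝ → Prop} {h : ℕ} {μ : Memory} {Q : Memory → Prop}
    {P P' : Program} {R : Memory → Prop} (hr : Run w Λ h P μ R)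
    (hq : ∀ ν, Good Λ h ν → Frame P μ ν → R ν → Run w Λ h P' ν Q) :
    Run w Λ h (.seq P P') μ Q :=
  .seq (hr.mono fun ν _ _ hν hg hf => hq ν hg hf hν)

theorem le_two_pow {m h : ℕ} (hm : m ≤ h) : m ≤ 2 ^ h := hm.trans Nat.lt_two_pow_self.le

/-- Sorted knapsack data, an accuracy and bounds on the lengths of all numbers involved: `b` bounds
the lengths of the data, `h` the lengths of all numbers that occur and of all loops. -/
structure Setting (w : ℝ → ℕ) (Λ : ℕ → ℝ → Prop) (b h n N : ℕ) (o : ℕ → ℕ) (s v : ℕ → ℝ)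
    (C u : ℝ) : Prop where
  model : LengthModel w Λ
  sorted : SortedKnapsack n s v C u
  five_le : 5 ≤ N
  ord_lt : ∀ i < n, o i < n
  ord_inj : ∀ i < n, ∀ j < n, o i = o j → i = j
  size_length : ∀ i < n, Λ b (s i)
  value_length : ∀ i < n, Λ b (v i)
  cap_length : Λ b C
  max_length : Λ b u
  items_le : n + 1 ≤ h
  accuracy_le : N ≤ h
  table_le : (n + 1) * (n * (n * N) + 1) ≤ h
  sum_le : (n + 1) * (b + 1) + 1 ≤ h
  rounds_le : 2 * ((n * N) * (n * N)) ≤ h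
  weights_le : n * (2 * ((n * N) * (n * N)) * (2 * (n * (b + 1)) + N + 2) + n * (b + 1) + 1) + b ≤ h

/-- The memory holds the sorted data. -/
structure Prepared (n N : ℕ) (o : ℕ → ℕ) (s v : ℕ → ℝ) (C u : ℝ) (μ : Memory) : Prop where
  items : μ.idx 0 0 = n
  accuracy : μ.idx iAcc 0 = N
  den : μ.idx iD 0 = n * N
  width : μ.idx iW 0 = n * (n * N) + 1
  len : μ.idx iLen 0 = 2 * ((n * N) * (n * N))
  pow : ∀ l ≤ n, μ.idx iPow l = 2 ^ l
  ord : ∀ i < n, μ.idx iOrd i = o i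
  size : ∀ i < n, μ.num rSize i = s i
  value : ∀ i < n, μ.num rVal i = v i
  cap : μ.num 2 0 = C
  max : μ.num rMax 0 = u

/-- The program does not change the sorted data. -/
def Program.keepsData (P : Program) : Bool :=
  [0, iAcc, iD, iW, iLen, iPow, iOrd].all (fun a => !P.writesIdx a) &&
    [2, rSize, rVal, rMax].all (fun a => !P.writesNum a)

theorem Prepared.frame {n N : ℕ} {o : ℕ → ℕ} {s v : ℕ → ℝ} {C u : ℝ} {μ ν : Memory}
    {P : Program} (hc : Prepared n N o s v C u μ) (hf : Frame P μ ν) (hP : P.keepsData = true) :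
    Prepared n N o s v C u ν := by
  simp only [Program.keepsData, List.all_cons, List.all_nil, Bool.and_true, Bool.and_eq_true,
    Bool.not_eq_true'] at hP
  obtain ⟨⟨h0, h1, h2, h3, h4, h5, h6⟩, k0, k1, k2, k3⟩ := hP
  constructor <;> simp only [hf.idx _ h0, hf.idx _ h1, hf.idx _ h2, hf.idx _ h3, hf.idx _ h4,
    hf.idx _ h5, hf.idx _ h6, hf.num _ k0, hf.num _ k1, hf.num _ k2, hf.num _ k3]
  exacts [hc.items, hc.accuracy, hc.den, hc.width, hc.len, hc.pow, hc.ord, hc.size, hc.value,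
    hc.cap, hc.max]

namespace Setting

variable {w : ℝ → ℕ} {Λ : ℕ → ℝ → Prop} {b h n N : ℕ} {o : ℕ → ℕ} {s v : ℕ → ℝ} {C u : ℝ}
  {μ : Memory}

theorem width_le (E : Setting w Λ b h n N o s v C u) : n * (n * N) + 1 ≤ h := by
  have := E.table_le
  nlinarith [Nat.zero_le (n * (n * (n * N) + 1))]

theorem den_le (E : Setting w Λ b h n N o s v C u) : n * N ≤ h := by
  have := E.width_le
  have := E.sorted.n_pos
  nlinarith [Nat.zero_le (n * N)]

theorem cap_pos (E : Setting w Λ b h n N o s v C u) : 0 < C := by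
  obtain ⟨i, hi, hs, -⟩ := E.sorted.attained
  exact (E.sorted.size_pos i hi).trans_le hs

theorem sum_length (E : Setting w Λ b h n N o s v C u) {x : ℝ} (hx : Λ (n * (b + 1)) x) :
    Λ h x :=
  E.model.mono hx (by have := E.sum_le; nlinarith)

theorem run_resetTable (E : Setting w Λ b h n N o s v C u) (hμ : Good Λ h μ)
    (hc : Prepared n N o s v C u μ) (hM : Λ h (μ.num rObj 0 * u)) (q : ℕ → ℕ → ℕ) :
    Run w Λ h Program.resetTable μ fun ν => ν.num rScale 0 = μ.num rObj 0 * u ∧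
      TableCorrect n (n * N) s C q (fun _ _ => 0) (ν.num rTab) (ν.idx iMask) (ν.idx iBestVal 0)
        (ν.idx iBest 0) := by
  have L := E.model
  refine .seq_mono (R := fun ν => ν.num rScale 0 = μ.num rObj 0 * u)
    (.assignNum L hμ (by simpa [hc.max] using hM) fun _ => by simp [hc.max]) fun ν hν hf hsc => ?_
  replace hc := hc.frame hf rfl
  refine .seq_mono (Run.for L (fun m ρ => ∀ x < m, ρ.num rTab x = C + 1)
    ((n + 1) * (n * (n * N) + 1)) E.table_le hν rfl ?_ ?_ ?_ fun _ _ _ _ hi => hi) ?_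
  · intro ρ hf
    simp [hf.idx 0 rfl, hf.idx iW rfl, hc.items, hc.width]
  · simp
  · intro m _ ρ hρ hf hm hi
    have hcap : ρ.num 2 0 = C := by rw [hf.num 2 rfl, hc.cap]
    refine .assignNum L hρ ?_ fun _ x hx => ?_
    · simp only [NumExpr.eval_add, NumExpr.eval_var, NumExpr.eval_const, hcap, Nat.cast_one]
      refine L.mono (L.add E.cap_length (L.one 0)) ?_
      have := E.sum_le
      nlinarith
    · simp only [NumExpr.eval_add, NumExpr.eval_var, NumExpr.eval_const, hcap, Nat.cast_one,
        IdxExpr.eval_var, hm, Memory.setIdx_num, Memory.setNum_num_self, Function.update_apply]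
      split_ifs with hxm
      · rfl
      · exact hi x (by omega)
  · intro ρ hρ hf' hi
    refine .seq (.assignNum L hρ (by simpa using L.zero h) fun hg _ _ =>
      .seq (.assignIdx hg (by simp) fun hg _ _ => .seq (.assignIdx hg (by simp) fun hg _ _ =>
        .assignIdx hg (by simp) fun hg => ?_)))
    refine ⟨by simp [hf'.num rScale rfl, hsc], ?_⟩
    simp only [IdxExpr.eval_const, NumExpr.eval_const, Memory.setIdx_num, Memory.setNum_num_self,
      Memory.setIdx_idx_self, Memory.setNum_idx, Function.update_self, ne_eq, Nat.reduceEqDiff,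
      not_false_eq_true, Memory.setIdx_idx_of_ne, Nat.cast_zero]
    refine TableCorrect.init E.cap_pos.le (by simp) (by simp) fun m hm hm0 => ?_
    rw [Function.update_of_ne hm0, hi m hm]

/-- The machine cannot round, so the floor is found by counting: the test in iteration `l` says that
the floor is at least `l + 1`. Ending the loop at `n * N` produces the truncation in `roundedValue`.
-/
theorem run_roundValue (E : Setting w Λ b h n N o s v C u) (hμ : Good Λ h μ)
    (hc : Prepared n N o s v C u μ) {a : ℕ → ℝ} (ha : ∀ j < n, μ.num rObj j = a j) (ha0 : 0 < a 0)
    (han : ∀ j < n, 0 ≤ a j) (hsc : μ.num rScale 0 = a 0 * u) {i : ℕ} (hi : μ.idx cI 0 = i)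
    (hin : i < n) :
    Run w Λ h Program.roundValue μ fun ν =>
      ν.idx iQ 0 = roundedValue (n * N) (a 0 * u) a v (n - 1 - μ.idx cJ 0) i := by
  have L := E.model
  have hn := E.sorted.n_pos
  set jj := n - 1 - μ.idx cJ 0 with hjj
  have hjn : jj < n := by omega
  have hM : 0 < a 0 * u := mul_pos ha0 E.sorted.u_pos
  have hx : 0 ≤ a jj * v i * (n * N : ℕ) / (a 0 * u) := by
    have := han jj hjn
    have := (E.sorted.value_pos i hin).le
    positivity
  refine .seq_mono (R := fun ν => ν.idx iQ 0 = 0) (.assignIdx hμ (by simp) fun _ => by simp)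
    fun ν hν hf hq => ?_
  refine Run.for L (fun l ρ => ρ.idx iQ 0 = min l ⌊a jj * v i * (n * N : ℕ) / (a 0 * u)⌋₊)
    (n * N) E.den_le hν rfl ?_ ?_ ?_ fun ρ _ _ _ hi => by rw [hi, roundedValue]
  · intro ρ hf'
    simp [hf'.idx iD rfl, hf.idx iD rfl, hc.den]
  · simp [hq]
  · intro l hl ρ hρ hf' hcl hinv
    have hc' := (hc.frame hf rfl).frame hf' rfl
    have hsc' : ρ.num rScale 0 = a 0 * u := by rw [hf'.num rScale rfl, hf.num rScale rfl, hsc]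
    have hobj : ρ.num rObj jj = a jj := by rw [hf'.num rObj rfl, hf.num rObj rfl, ha jj hjn]
    have hcj : n - 1 - ρ.idx cJ 0 = jj := by rw [hf'.idx cJ rfl, hf.idx cJ rfl]
    have hci : ρ.idx cI 0 = i := by rw [hf'.idx cI rfl, hf.idx cI rfl, hi]
    have hiff : ((l + 1 : ℕ) : ℝ) * (a 0 * u) ≤ a jj * v i * (n * N : ℕ) ↔
        l + 1 ≤ ⌊a jj * v i * (n * N : ℕ) / (a 0 * u)⌋₊ := by
      rw [Nat.le_floor_iff hx, le_div_iff₀ hM]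
    refine .ite L hρ (fun hb => .assignIdx hρ ?_ fun _ => ?_) (fun hb => .skip hρ ?_)
    · simp only [IdxExpr.eval_add, IdxExpr.eval_var, IdxExpr.eval_const, hcl]
      exact le_two_pow (by have := E.den_le; omega)
    · simp only [Test.holds_numLE, NumExpr.eval_mul, NumExpr.eval_ofIdx, IdxExpr.eval_add,
        IdxExpr.eval_var, IdxExpr.eval_const, NumExpr.eval_var, NumExpr.eval_cell, hcl, hsc',
        IdxExpr.eval_sub, hc'.items, hcj, hci, hobj, hc'.value i hin, hc'.den, hiff] at hb
      simp [hcl]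
      simpa using hb
    · simp only [Test.holds_numLE, NumExpr.eval_mul, NumExpr.eval_ofIdx, IdxExpr.eval_add,
        IdxExpr.eval_var, IdxExpr.eval_const, NumExpr.eval_var, NumExpr.eval_cell, hcl, hsc',
        IdxExpr.eval_sub, hc'.items, hcj, hci, hobj, hc'.value i hin, hc'.den, hiff] at hb
      simp only [ne_eq, Nat.reduceEqDiff, not_false_eq_true, Memory.setIdx_idx_of_ne, hinv]
      omega

theorem run_updateCell (E : Setting w Λ b h n N o s v C u) (hμ : Good Λ h μ)
    (hc : Prepared n N o s v C u μ) {q : ℕ → ℕ → ℕ} (hq : ∀ j i, q j i ≤ n * N) {i jj r : ℕ}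
    (hi : μ.idx cI 0 = i) (hin : i < n) (hj : n - 1 - μ.idx cJ 0 = jj) (hjn : jj < n)
    (hr : μ.idx cR 0 = r) (hrn : r ≤ n * (n * N)) (hqi : μ.idx iQ 0 = q jj i)
    (ht : TableCorrect n (n * N) s C q
      (fun j r' => if jj + 1 < j ∨ j = jj + 1 ∧ r' < r + q jj i then i + 1 else i)
      (μ.num rTab) (μ.idx iMask) (μ.idx iBestVal 0) (μ.idx iBest 0)) :
    Run w Λ h Program.updateCell μ fun ν => TableCorrect n (n * N) s C q
      (fun j r' => if jj + 1 < j ∨ j = jj + 1 ∧ r' < r + 1 + q jj i then i + 1 else i)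
      (ν.num rTab) (ν.idx iMask) (ν.idx iBestVal 0) (ν.idx iBest 0) := by
  have L := E.model
  have hs := E.sorted.size_pos i hin
  have esrc : ∀ ν, Frame Program.updateCell μ ν → Program.source.eval ν =
      jj * (n * (n * N) + 1) + r := fun ν hf => by
    simp [Program.source, hf.idx 0 rfl, hf.idx cJ rfl, hf.idx iW rfl, hf.idx cR rfl, hc.items, hj,
      hc.width, hr]
  have etgt : ∀ ν, Frame Program.updateCell μ ν → Program.target.eval ν =
      (jj + 1) * (n * (n * N) + 1) + (r + q jj i) := fun ν hf => by
    simp [Program.target, hf.idx 0 rfl, hf.idx cJ rfl, hf.idx iW rfl, hf.idx cR rfl, hc.items, hj,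
      hc.width, hr, hf.idx iQ rfl, hqi]
  have es := esrc μ (Frame.refl _ _)
  have et := etgt μ (Frame.refl _ _)
  set S := jj * (n * (n * N) + 1) + r with hS
  set T := (jj + 1) * (n * (n * N) + 1) + (r + q jj i) with hT
  have hST : S ≠ T := by rw [hS, hT, add_mul]; omega
  have hsz := hc.size i hin
  have hpow : μ.idx iPow (n - 1 - i) = 2 ^ (n - 1 - i) := hc.pow _ (by omega)
  refine .ite L hμ (fun h1 => .ite L hμ (fun h2 => ?_) fun h2 => .skip hμ ?_) fun h1 => .skip hμ ?_
  · simp only [Test.holds_numLE, NumExpr.eval_add, NumExpr.eval_cell, es, et, IdxExpr.eval_var, hi,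
      hsz, NumExpr.eval_var, hc.cap] at h1 h2
    have hnew := ht.improved_cell hq hs hjn hrn h1 h2
    -- Because the improved entry describes a set that fits, the new size and mask are short enough
    -- to be stored.
    obtain ⟨hlen, hmask⟩ := hnew.length L (b := b) hin E.size_length h1
    have hmask' : μ.idx iMask S + 2 ^ (n - 1 - i) ≤ 2 ^ h :=
      hmask.le.trans (Nat.pow_le_pow_right (by omega) (by have := E.items_le; omega))
    refine .seq_mono (R := fun ν => ν = μ.setIdx iMask T (μ.idx iMask S + 2 ^ (n - 1 - i)))
      (.assignIdx hμ (by simpa [es, hi, hc.items, hpow] using hmask')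
        fun _ => by simp [es, et, hi, hc.items, hpow]) fun ν hν hf hνe => ?_
    have hf1 : Frame Program.updateCell μ ν := hf.mono
      (by simp +contextual [Program.updateCell, Program.writesIdx])
      (by simp +contextual [Program.updateCell, Program.writesNum])
    have e1 : NumExpr.eval ν (.cell rTab Program.source + .cell rSize (.var cI)) =
        μ.num rTab S + s i := by
      rw [NumExpr.eval_add, NumExpr.eval_cell, NumExpr.eval_cell, esrc ν hf1, IdxExpr.eval_var,
        hf1.idx cI rfl, hi, hf.num rTab rfl, hf1.num rSize rfl, hsz]
    refine .seq_mono (R := fun ρ => ρ = ν.setNum rTab T (μ.num rTab S + s i))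
      (.assignNum L hν (by rw [e1]; exact E.sum_length hlen)
        fun _ => by rw [etgt ν hf1, e1]) fun ρ hρ hf' hρe => ?_
    have htab : ρ.num rTab = Function.update (μ.num rTab) T (μ.num rTab S + s i) := by
      simp [hρe, hνe]
    have hmsk : ρ.idx iMask = Function.update (μ.idx iMask) T
        (μ.idx iMask S + 2 ^ (n - 1 - i)) := by
      simp [hρe, hνe]
    have hbv : ρ.idx iBestVal 0 = μ.idx iBestVal 0 := by simp [hρe, hνe]
    have hbm : ρ.idx iBest 0 = μ.idx iBest 0 := by simp [hρe, hνe]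
    have hf2 : Frame Program.updateCell μ ρ := hf1.trans (hf'.mono
      (by simp +contextual [Program.updateCell, Program.writesIdx])
      (by simp +contextual [Program.updateCell, Program.writesNum]))
    have hrq : ρ.idx cR 0 + ρ.idx iQ 0 = r + q jj i := by
      rw [hf2.idx cR rfl, hf2.idx iQ rfl, hr, hqi]
    refine .ite L hρ (fun h3 => .seq_mono (R := fun σ => σ = ρ.setIdx iBestVal 0 (r + q jj i))
        (.assignIdx hρ ?_ fun _ => by simp [hrq]) fun σ hσ hf'' hσe =>
        .assignIdx hσ ?_ fun _ => ?_) fun h3 => .skip hρ ?_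
    · simp only [IdxExpr.eval_add, IdxExpr.eval_var, hrq]
      exact le_two_pow ((ht.target_le hq hs hjn hrn h1).trans (by have := E.width_le; omega))
    · exact hσ.idx _ _
    · have et' : Program.target.eval σ = T := etgt σ (hf2.trans (hf''.mono
        (by simp +contextual [Program.updateCell, Program.writesIdx])
        (by simp +contextual [Program.updateCell, Program.writesNum])))
      simp only [Test.holds_idxLE, IdxExpr.eval_add, IdxExpr.eval_var, hrq, hbv] at h3
      simp only [IdxExpr.eval_cell, et']
      simp only [hσe, ne_eq, Nat.reduceEqDiff, not_false_eq_true,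
        Memory.setIdx_idx_of_ne, Memory.setIdx_idx_self, Memory.setIdx_num, IdxExpr.eval_const,
        Function.update_self, htab, hmsk]
      exact ht.step_improve hq hs hjn hrn hin h1 h2 (.inl ⟨h3, rfl, rfl⟩)
    · simp only [Test.holds_idxLE, IdxExpr.eval_add, IdxExpr.eval_var, hrq, hbv] at h3
      rw [htab, hmsk]
      exact ht.step_improve hq hs hjn hrn hin h1 h2 (.inr ⟨by omega, hbv, hbm⟩)
  · simp only [Test.holds_numLE, NumExpr.eval_add, NumExpr.eval_cell, es, et, IdxExpr.eval_var, hi,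
      hsz] at h2
    exact ht.step_keep hs hjn hrn fun _ _ => (not_le.1 h2).le
  · simp only [Test.holds_numLE, NumExpr.eval_add, NumExpr.eval_cell, es, IdxExpr.eval_var, hi,
      hsz, NumExpr.eval_var, hc.cap] at h1
    exact ht.step_keep hs hjn hrn fun hC _ => absurd hC h1

/-- The three nested invariants differ only in how many items each entry has taken into account: `i`
everywhere, then `i + 1` in the upper layers, then `i + 1` also in an initial part of the current
target layer. -/
theorem run_fillTable (E : Setting w Λ b h n N o s v C u) (hμ : Good Λ h μ)
    (hc : Prepared n N o s v C u μ) {a : ℕ → ℝ} (ha : ∀ j < n, μ.num rObj j = a j) (ha0 : 0 < a 0)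
    (han : ∀ j < n, 0 ≤ a j) (hsc : μ.num rScale 0 = a 0 * u)
    (ht : TableCorrect n (n * N) s C (roundedValue (n * N) (a 0 * u) a v) (fun _ _ => 0)
      (μ.num rTab) (μ.idx iMask) (μ.idx iBestVal 0) (μ.idx iBest 0)) :
    Run w Λ h Program.fillTable μ fun ν => TableCorrect n (n * N) s C
      (roundedValue (n * N) (a 0 * u) a v) (fun _ _ => n)
      (ν.num rTab) (ν.idx iMask) (ν.idx iBestVal 0) (ν.idx iBest 0) := by
  have L := E.model
  have hn := E.sorted.n_pos
  have hnh : n ≤ h := by have := E.items_le; omega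
  set q := roundedValue (n * N) (a 0 * u) a v with hqdef
  have hq : ∀ j i, q j i ≤ n * N := roundedValue_le _ _ _ _
  refine Run.for L (fun i ν => TableCorrect n (n * N) s C q (fun _ _ => i)
      (ν.num rTab) (ν.idx iMask) (ν.idx iBestVal 0) (ν.idx iBest 0)) n hnh hμ rfl
    (fun ν hf => by simp [hf.idx 0 rfl, hc.items]) (by simpa using ht) ?_ fun _ _ _ _ hi => hi
  intro i hi ν hν hf hci hinv
  have hc1 := hc.frame hf rfl
  refine Run.for L (fun j ρ => TableCorrect n (n * N) s C q (fun j' _ => if n - j < j' then i + 1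
      else i) (ρ.num rTab) (ρ.idx iMask) (ρ.idx iBestVal 0) (ρ.idx iBest 0)) n hnh hν rfl
    (fun ρ hf => by simp [hf.idx 0 rfl, hc1.items]) ?_ ?_ ?_
  · simp only [ne_eq, Nat.reduceEqDiff, not_false_eq_true, Memory.setIdx_idx_of_ne,
      Memory.setIdx_num]
    exact hinv.congr fun j hj r _ => (if_neg (by omega)).symm
  · intro j hj ρ hρ hf' hcj hinv'
    have hc2 := hc1.frame hf' rfl
    have hjj : n - 1 - ρ.idx cJ 0 = n - 1 - j := by rw [hcj]
    have hci' : ρ.idx cI 0 = i := by rw [hf'.idx cI rfl, hci]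
    refine .seq_mono (E.run_roundValue hρ hc2 (a := a) (fun j hj => by
      rw [hf'.num rObj rfl, hf.num rObj rfl, ha j hj]) ha0 han
      (by rw [hf'.num rScale rfl, hf.num rScale rfl, hsc]) hci' hi) fun σ hσ hf'' hσq => ?_
    rw [hjj] at hσq
    set jj := n - 1 - j with hjjdef
    have hc3 := hc2.frame hf'' rfl
    have ht0 : TableCorrect n (n * N) s C q (fun j' _ => if jj + 1 < j' then i + 1 else i)
        (σ.num rTab) (σ.idx iMask) (σ.idx iBestVal 0) (σ.idx iBest 0) := by
      rw [hf''.num rTab rfl, hf''.idx iMask rfl, hf''.idx iBestVal rfl, hf''.idx iBest rfl]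
      exact hinv'.congr fun j' _ r _ => if_congr (by omega) rfl rfl
    refine Run.for L (fun r τ => TableCorrect n (n * N) s C q
      (fun j' r' => if jj + 1 < j' ∨ j' = jj + 1 ∧ r' < r + q jj i then i + 1 else i)
      (τ.num rTab) (τ.idx iMask) (τ.idx iBestVal 0) (τ.idx iBest 0)) (n * (n * N) + 1)
      E.width_le hσ rfl (fun τ hf => by simp [hf.idx iW rfl, hc3.width]) ?_ ?_ ?_
    · simpa using ht0.skip_small
    · intro r hr τ hτ hfτ hcr hinv''
      have hc4 := hc3.frame hfτ rfl
      refine (E.run_updateCell hτ hc4 hq (i := i) (jj := jj) (r := r) ?_ hi ?_ (by omega) hcr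
        (by omega) ?_ hinv'').mono fun κ _ _ hκ => ?_
      · rw [hfτ.idx cI rfl, hf''.idx cI rfl, hci']
      · rw [hfτ.idx cJ rfl, hf''.idx cJ rfl, hjj]
      · rw [hfτ.idx iQ rfl, hσq]
      · simpa using hκ
    · intro τ _ _ _ hinv''
      simp only [ne_eq, Nat.reduceEqDiff, not_false_eq_true, Memory.setIdx_idx_of_ne,
        Memory.setIdx_num]
      exact hinv''.congr fun j' hj' r hr => if_congr (by omega) rfl rfl
  · intro ρ _ _ _ hinv'
    simp only [ne_eq, Nat.reduceEqDiff, not_false_eq_true, Memory.setIdx_idx_of_ne,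
      Memory.setIdx_num]
    refine TableCorrect.finish_item (hinv'.congr fun j' _ r _ => if_congr (by omega) rfl rfl)

end Setting

/-! ### Decoding the best set, and the complete oracle -/

theorem filter_lt_subset_range (X : Finset ℕ) (i : ℕ) : {j ∈ X | j < i} ⊆ range i :=
  fun _ hj => mem_range.2 (mem_filter.1 hj).2

theorem filter_lt_succ (X : Finset ℕ) (i : ℕ) :
    {j ∈ X | j < i + 1} = if i ∈ X then insert i {j ∈ X | j < i} else {j ∈ X | j < i} := by
  split_ifs with hi
  · ext j
    simp only [mem_filter, mem_insert]
    constructor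
    · rintro ⟨h1, h2⟩
      by_cases h : j = i
      · exact .inl h
      · exact .inr ⟨h1, by omega⟩
    · rintro (rfl | ⟨h1, h2⟩)
      · exact ⟨hi, by omega⟩
      · exact ⟨h1, by omega⟩
  · refine filter_congr fun j hj => ?_
    have : j ≠ i := fun e => hi (e ▸ hj)
    omega

theorem LengthModel.firstSum {w : ℝ → ℕ} {Λ : ℕ → ℝ → Prop} (L : LengthModel w Λ) {n b : ℕ}
    {v : ℕ → ℝ} (hv : ∀ i < n, Λ b (v i)) (k : ℕ) {X : Finset ℕ} (hX : X ⊆ range n) :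
    Λ (n * (b + 1)) (firstSum v k X) := by
  rw [firstSum_eq_sum_filter]
  exact L.sum (fun i hi => hv i (mem_range.1 (hX (mem_of_mem_filter i hi))))
    ((card_le_card (filter_subset _ _)).trans (card_le_of_subset_range hX))

namespace Setting

variable {w : ℝ → ℕ} {Λ : ℕ → ℝ → Prop} {b h n N : ℕ} {o : ℕ → ℕ} {s v : ℕ → ℝ} {C u : ℝ}
  {μ : Memory}

/-- The digits are read in sorted order, so `iCnt` is the rank of the current item, and its value
belongs to the truncated sums `k + 1` with `iCnt ≤ k`. Zeros are written for absent items as well,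
since the current row may contain remains of an earlier call; the earlier rows survive. -/
theorem run_decode (E : Setting w Λ b h n N o s v C u) (hμ : Good Λ h μ)
    (hc : Prepared n N o s v C u μ) {X : Finset ℕ} (hX : X ⊆ range n)
    (hbest : μ.idx iBest 0 = maskFrom n X 0) {t : ℕ} (ht : μ.idx cT 0 = t) :
    Run w Λ h Program.decode μ fun ν =>
      (∀ k < n, ν.num rFirst k = firstSum v (k + 1) X) ∧
      (∀ i < n, ν.idx iOut (t * n + o i) = if i ∈ X then 1 else 0) ∧
      ∀ x < t * n, ν.idx iOut x = μ.idx iOut x := by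
  have L := E.model
  have hnh : n ≤ h := by have := E.items_le; omega
  refine .seq_mono (Run.for L (fun g ρ => ∀ k < g, ρ.num rFirst k = 0) n hnh hμ rfl
    (fun ν hf => by simp [hf.idx 0 rfl, hc.items]) (by simp) ?_ fun _ _ _ _ hi => hi) ?_
  · intro g _ ν hν hf hcg hinv
    refine .assignNum L hν (by simpa using L.zero h) fun _ k hk => ?_
    simp only [Memory.setIdx_num, IdxExpr.eval_var, hcg, NumExpr.eval_const, Nat.cast_zero,
      Memory.setNum_num_self, Function.update_apply]
    split_ifs with hkg
    · rfl
    · exact hinv k (by omega)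
  intro ν₀ hν₀ hf₀ h0
  refine .seq_mono (R := fun ρ => ρ.idx iCnt 0 = 0) (.assignIdx hν₀ (by simp) fun _ => by simp)
    fun ν₁ hν₁ hf₁ hcnt => ?_
  have hc1 := (hc.frame hf₀ rfl).frame hf₁ rfl
  refine Run.for L (fun i ρ => ρ.idx iBest 0 = maskFrom n X i ∧
    ρ.idx iCnt 0 = #{j ∈ X | j < i} ∧
    (∀ k < n, ρ.num rFirst k = firstSum v (k + 1) {j ∈ X | j < i}) ∧
    (∀ j < i, ρ.idx iOut (t * n + o j) = if j ∈ X then 1 else 0) ∧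
    ∀ x < t * n, ρ.idx iOut x = μ.idx iOut x) n hnh hν₁ rfl
    (fun ν hf => by simp [hf.idx 0 rfl, hc1.items]) ?_ ?_ ?_
  · refine ⟨?_, ?_, fun k hk => ?_, fun j hj => by omega, fun x _ => ?_⟩
    · simp [hf₁.idx iBest rfl, hf₀.idx iBest rfl, hbest]
    · simp [hcnt]
    · simp [hf₁.num rFirst rfl, h0 k hk, firstSum, rankSum]
    · simp [hf₁.idx iOut rfl, hf₀.idx iOut rfl]
  · rintro i hi ν hν hf hci ⟨hb, hcn, hfi, hout, hold⟩
    have hc2 := hc1.frame hf rfl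
    have htν : ν.idx cT 0 = t := by rw [hf.idx cT rfl, hf₁.idx cT rfl, hf₀.idx cT rfl, ht]
    have hpow : ν.idx iPow (n - 1 - i) = 2 ^ (n - 1 - i) := hc2.pow _ (by omega)
    have hord := hc2.ord i hi
    have hmem : (Test.idxLE (.cell iPow (.var 0 - .const 1 - .var cI)) (.var iBest)).Holds ν ↔
        i ∈ X := by
      simp [hc2.items, hci, hpow, hb, mem_iff_le_maskFrom hX hi]
    have hinj : ∀ j < i, t * n + o j ≠ t * n + o i := fun j hj e => by
      have := E.ord_inj j (by omega) i hi (by omega)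
      omega
    refine .ite L hν (fun hX' => ?_) fun hX' => ?_
    · rw [hmem] at hX'
      refine .seq_mono (R := fun ρ => ρ.idx iBest 0 = maskFrom n X (i + 1)) (.assignIdx hν ?_
        fun _ => ?_) fun ρ hρ hfρ hbρ => ?_
      · exact (Nat.sub_le _ _).trans (hν.idx _ _)
      · have := maskFrom_eq n X i
        rw [if_pos hX'] at this
        simp [hb, hc2.items, hci, hpow, this]
      refine .seq_mono (R := fun σ => (∀ j < i + 1, σ.idx iOut (t * n + o j) =
          if j ∈ X then 1 else 0) ∧ ∀ x < t * n, σ.idx iOut x = μ.idx iOut x)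
        (.assignIdx hρ (by simpa using Nat.one_le_two_pow) fun _ => ?_)
        fun σ hσ hfσ ⟨houtσ, holdσ⟩ => ?_
      · have e1 : (ρ.idx cT 0 * ρ.idx 0 0 + ρ.idx iOrd (ρ.idx cI 0)) = t * n + o i := by
          rw [hfρ.idx cT rfl, hfρ.idx 0 rfl, hfρ.idx iOrd rfl, hfρ.idx cI rfl, hci, hord, htν,
            hc2.items]
        simp only [IdxExpr.eval_add, IdxExpr.eval_mul, IdxExpr.eval_var, IdxExpr.eval_cell, e1,
          IdxExpr.eval_const, Memory.setIdx_idx_self, Function.update_apply, hfρ.idx iOut rfl]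
        refine ⟨fun j hj => ?_, fun x hx => ?_⟩
        · rcases Nat.lt_succ_iff_lt_or_eq.1 hj with hj | rfl
          · rw [if_neg (hinj j hj), hout j hj]
          · rw [if_pos rfl, if_pos hX']
        · rw [if_neg (by omega), hold x hx]
      have hc3 := (hc2.frame hfρ rfl).frame hfσ rfl
      have hciσ : σ.idx cI 0 = i := by rw [hfσ.idx cI rfl, hfρ.idx cI rfl, hci]
      have hcnσ : σ.idx iCnt 0 = #{j ∈ X | j < i} := by
        rw [hfσ.idx iCnt rfl, hfρ.idx iCnt rfl, hcn]
      have hfsucc : ∀ k, firstSum v (k + 1) {j ∈ X | j < i + 1} =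
          firstSum v (k + 1) {j ∈ X | j < i} + if #{j ∈ X | j < i} < k + 1 then v i else 0 := by
        intro k
        rw [filter_lt_succ, if_pos hX', firstSum_insert _ _ (filter_lt_subset_range X i)]
      refine .seq_mono (Run.for L (fun g τ => ∀ k < n, τ.num rFirst k =
        if k < g then firstSum v (k + 1) {j ∈ X | j < i + 1}
        else firstSum v (k + 1) {j ∈ X | j < i}) n hnh hσ rfl
        (fun ν hf => by simp [hf.idx 0 rfl, hc3.items]) ?_ ?_ fun _ _ _ _ hi => hi) ?_
      · intro k hk
        simp [hfσ.num rFirst rfl, hfρ.num rFirst rfl, hfi k hk]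
      · intro g hg τ hτ hfτ hcg hinv
        have hiff : (Test.idxLE (.var iCnt) (.var cG)).Holds τ ↔ #{j ∈ X | j < i} < g + 1 := by
          simp [hcg, hfτ.idx iCnt rfl, hcnσ]
        have hval : τ.num rVal i = v i := (hc3.frame hfτ rfl).value i hi
        have hciτ : τ.idx cI 0 = i := by rw [hfτ.idx cI rfl, hciσ]
        refine .ite L hτ (fun hlt => ?_) fun hlt => .skip hτ fun k hk => ?_
        · rw [hiff] at hlt
          have hnew : NumExpr.eval τ (.cell rFirst (.var cG) + .cell rVal (.var cI)) =
              firstSum v (g + 1) {j ∈ X | j < i + 1} := by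
            rw [hfsucc, if_pos hlt]
            simp [hcg, hciτ, hval, hinv g hg]
          refine .assignNum L hτ ?_ fun _ k hk => ?_
          · rw [hnew]
            exact E.sum_length (L.firstSum E.value_length _ ((filter_subset _ _).trans hX))
          · rw [hnew]
            simp only [Memory.setIdx_num, IdxExpr.eval_var, hcg, Memory.setNum_num_self,
              Function.update_apply]
            by_cases hkg : k = g
            · simp [hkg]
            · rw [if_neg hkg, hinv k hk, if_congr (show k < g ↔ k < g + 1 by omega) rfl rfl]
        · rw [hiff] at hlt
          rw [Memory.setIdx_num, hinv k hk]
          by_cases hkg : k = g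
          · rw [hkg, if_neg (by omega), if_pos (by omega), hfsucc, if_neg hlt, add_zero]
          · rw [if_congr (show k < g ↔ k < g + 1 by omega) rfl rfl]
      intro τ hτ hfτ hinv
      refine .assignIdx hτ ?_ fun _ => ⟨?_, ?_, fun k hk => ?_, fun j hj => ?_, fun x hx => ?_⟩
      · simp only [IdxExpr.eval_add, IdxExpr.eval_var, IdxExpr.eval_const, hfτ.idx iCnt rfl, hcnσ]
        have := card_le_of_subset_range (filter_lt_subset_range X i)
        exact le_two_pow (by have := E.items_le; omega)
      · simp [hfτ.idx iBest rfl, hfσ.idx iBest rfl, hbρ]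
      · simp only [ne_eq, Nat.reduceEqDiff, not_false_eq_true, Memory.setIdx_idx_of_ne,
          Memory.setIdx_idx_self, IdxExpr.eval_const, Function.update_self, IdxExpr.eval_add,
          IdxExpr.eval_var, hfτ.idx iCnt rfl, hcnσ]
        rw [filter_lt_succ, if_pos hX', card_insert_of_notMem (by simp)]
      · simp [hinv k hk, hk]
      · simpa [hfτ.idx iOut rfl] using houtσ j hj
      · simpa [hfτ.idx iOut rfl] using holdσ x hx
    · rw [hmem] at hX'
      have e1 : (ν.idx cT 0 * ν.idx 0 0 + ν.idx iOrd (ν.idx cI 0)) = t * n + o i := by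
        rw [hci, hord, htν, hc2.items]
      refine .assignIdx hν (by simp) fun _ => ⟨?_, ?_, fun k hk => ?_, fun j hj => ?_,
        fun x hx => ?_⟩
      · have := maskFrom_eq n X i
        rw [if_neg hX', zero_add] at this
        simp [hb, this]
      · rw [filter_lt_succ, if_neg hX']
        simp [hcn]
      · rw [filter_lt_succ, if_neg hX']
        simp [hfi k hk]
      · simp only [ne_eq, Nat.reduceEqDiff, not_false_eq_true, Memory.setIdx_idx_of_ne,
          IdxExpr.eval_add, IdxExpr.eval_mul, IdxExpr.eval_var, IdxExpr.eval_cell, e1,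
          IdxExpr.eval_const, Memory.setIdx_idx_self, Function.update_apply]
        rcases Nat.lt_succ_iff_lt_or_eq.1 hj with hj | rfl
        · rw [if_neg (hinj j hj), hout j hj]
        · rw [if_pos rfl, if_neg hX']
      · simp only [ne_eq, Nat.reduceEqDiff, not_false_eq_true, Memory.setIdx_idx_of_ne,
          IdxExpr.eval_add, IdxExpr.eval_mul, IdxExpr.eval_var, IdxExpr.eval_cell, e1,
          IdxExpr.eval_const, Memory.setIdx_idx_self, Function.update_apply]
        rw [if_neg (by omega), hold x hx]
  · rintro ν - - - ⟨-, -, hfi, hout, hold⟩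
    have hXn : {j ∈ X | j < n} = X := filter_true_of_mem fun j hj => mem_range.1 (hX hj)
    rw [hXn] at hfi
    exact ⟨hfi, hout, hold⟩

/-- The oracle finds a `(1 - 1 / N)`-approximate solution of the knapsack problem with rank
dependent weights. -/
theorem run_oracle (E : Setting w Λ b h n N o s v C u) (hμ : Good Λ h μ)
    (hc : Prepared n N o s v C u μ) {a : ℕ → ℝ} (ha : ∀ j < n, μ.num rObj j = a j) (ha0 : 0 < a 0)
    (han : ∀ j < n, 0 ≤ a j ∧ a j ≤ a 0) (hM : Λ h (a 0 * u)) {t : ℕ} (ht : μ.idx cT 0 = t) :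
    Run w Λ h Program.oracle μ fun ν => ∃ X, Fits n s C X ∧
      (∀ Y, Fits n s C Y → (1 - 1 / N) * rankSum (fun j i => a j * v i) Y ≤
        rankSum (fun j i => a j * v i) X) ∧
      (∀ k < n, ν.num rFirst k = firstSum v (k + 1) X) ∧
      (∀ i < n, ν.idx iOut (t * n + o i) = if i ∈ X then 1 else 0) ∧
      ∀ x < t * n, ν.idx iOut x = μ.idx iOut x := by
  have hn := E.sorted.n_pos
  rw [← ha 0 hn] at hM
  refine .seq_mono (E.run_resetTable hμ hc hM (roundedValue (n * N) (a 0 * u) a v))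
    fun ν₁ hν₁ hf₁ ⟨hsc, htab⟩ => ?_
  rw [ha 0 hn] at hsc
  have hc1 := hc.frame hf₁ rfl
  refine .seq_mono (E.run_fillTable hν₁ hc1 (a := a)
    (fun j hj => by rw [hf₁.num rObj rfl, ha j hj]) ha0 (fun j hj => (han j hj).1) hsc htab)
    fun ν₂ hν₂ hf₂ htab' => ?_
  obtain ⟨X, hX, hbest, hopt⟩ := htab'.optimal (roundedValue_le _ _ _ _)
  refine (E.run_decode hν₂ (hc1.frame hf₂ rfl) hX.subset hbest (t := t)
    (by rw [hf₂.idx cT rfl, hf₁.idx cT rfl, ht])).mono fun ν₃ _ _ ⟨h1, h2, h3⟩ => ?_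
  refine ⟨X, hX, E.sorted.rounding_loss (by have := E.five_le; omega) ha0 han hX hopt, h1, h2,
    fun x hx => ?_⟩
  rw [h3 x hx, hf₂.idx iOut rfl, hf₁.idx iOut rfl]

/-- For the weights `a_j = 1` if `j ≤ k` and `0` otherwise, the objective of the oracle is the
truncated value at `k + 1`. -/
theorem run_normalize (E : Setting w Λ b h n N o s v C u) (hμ : Good Λ h μ)
    (hc : Prepared n N o s v C u μ) :
    Run w Λ h Program.normalize μ fun ν => ∀ k < n, ν.num rWt k = 1 ∧
      ∃ X, Fits n s C X ∧ ν.num rNorm k = firstSum v (k + 1) X ∧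
        ∀ Y, Fits n s C Y → (1 - 1 / N) * firstSum v (k + 1) Y ≤ firstSum v (k + 1) X := by
  have L := E.model
  have hn := E.sorted.n_pos
  have hnh : n ≤ h := by have := E.items_le; omega
  refine Run.for L (fun m ν => ∀ k < m, ν.num rWt k = 1 ∧
      ∃ X, Fits n s C X ∧ ν.num rNorm k = firstSum v (k + 1) X ∧
        ∀ Y, Fits n s C Y → (1 - 1 / N) * firstSum v (k + 1) Y ≤ firstSum v (k + 1) X)
    n hnh hμ rfl (fun ν hf => by simp [hf.idx 0 rfl, hc.items]) (by simp) ?_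
    fun _ _ _ _ hi => hi
  intro k hk ν hν hf hck hinv
  have hc1 := hc.frame hf rfl
  set a : ℕ → ℝ := fun j => if j ≤ k then 1 else 0 with hadef
  refine .seq_mono (Run.for L (fun e ρ => ∀ j < e, ρ.num rObj j = a j) n hnh hν rfl
    (fun ν hf => by simp [hf.idx 0 rfl, hc1.items]) (by simp) ?_ fun _ _ _ _ hi => hi) ?_
  · intro e he ρ hρ hfρ hce hi
    have hckρ : ρ.idx cK 0 = k := by rw [hfρ.idx cK rfl, hck]
    refine .ite L hρ (fun hle => .assignNum L hρ (by simpa using L.one h) fun _ j hj => ?_)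
      fun hle => .assignNum L hρ (by simpa using L.zero h) fun _ j hj => ?_
    all_goals
      simp only [Test.holds_idxLE, IdxExpr.eval_var, hce, hckρ] at hle
      simp only [Memory.setIdx_num, IdxExpr.eval_var, hce, NumExpr.eval_const,
        Memory.setNum_num_self, Function.update_apply]
      split_ifs with hje
      · simp [hadef, hje, hle]
      · exact hi j (by omega)
  · intro ρ hρ hfρ hobj
    have hc2 := hc1.frame hfρ rfl
    have ha0 : a 0 = 1 := by simp [hadef]
    have hfirst : ∀ X, rankSum (fun j i => a j * v i) X = firstSum v (k + 1) X := by
      intro X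
      refine sum_congr rfl fun i _ => ?_
      simp only [hadef, Nat.lt_succ_iff, ite_mul, one_mul, zero_mul]
    refine .seq_mono (E.run_oracle hρ hc2 hobj (by rw [ha0]; exact one_pos) (fun j _ => ?_) ?_ rfl)
      fun σ hσ hfσ ⟨X, hX, hbest, hfs, _, _⟩ => ?_
    · rw [ha0]
      simp only [hadef]
      split_ifs <;> simp
    · rw [ha0, one_mul]
      exact L.mono E.max_length (by have := E.sum_le; nlinarith)
    · simp only [hfirst] at hbest
      have hckσ : σ.idx cK 0 = k := by rw [hfσ.idx cK rfl, hfρ.idx cK rfl, hck]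
      refine .seq (.assignNum L hσ (hσ.num _ _) fun hg _ _ =>
        .assignNum L hg (by simpa using L.one h) fun _ j hj => ?_)
      have e1 : σ.num rWt = ν.num rWt := by rw [hfσ.num rWt rfl, hfρ.num rWt rfl]
      have e2 : σ.num rNorm = ν.num rNorm := by rw [hfσ.num rNorm rfl, hfρ.num rNorm rfl]
      simp only [ne_eq, Nat.reduceEqDiff, not_false_eq_true, Memory.setIdx_num,
        Memory.setNum_num_of_ne, Memory.setNum_num_self, Memory.setNum_idx, IdxExpr.eval_var, hckσ,
        NumExpr.eval_const, NumExpr.eval_cell, Nat.cast_one, Function.update_apply, e1, e2]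
      by_cases hjk : j = k
      · subst hjk
        simp only [if_true, hfs j hk, true_and]
        exact ⟨X, hX, rfl, hbest⟩
      · simp only [if_neg hjk]
        exact hinv j (by omega)

end Setting

/-! ### The rounds of the multiplicative weights method -/

/-- The weights of the multiplicative weights method after `t` rounds. -/
noncomputable def weightAfter (v : ℕ → ℝ) (N : ℕ) (B : ℕ → ℝ) (X : ℕ → Finset ℕ) (t k : ℕ) : ℝ :=
  ∏ τ ∈ range t, (1 - firstSum v (k + 1) (X τ) / (2 * N * B k))

theorem weightAfter_congr {v : ℕ → ℝ} {N : ℕ} {B : ℕ → ℝ} {X X' : ℕ → Finset ℕ} {t : ℕ}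
    (h : ∀ τ < t, X τ = X' τ) (k : ℕ) : weightAfter v N B X t k = weightAfter v N B X' t k :=
  prod_congr rfl fun τ hτ => by rw [h τ (mem_range.1 hτ)]

theorem weightAfter_succ (v : ℕ → ℝ) (N : ℕ) (B : ℕ → ℝ) (X : ℕ → Finset ℕ) (t k : ℕ) :
    weightAfter v N B X (t + 1) k =
      weightAfter v N B X t k * (1 - firstSum v (k + 1) (X t) / (2 * N * B k)) :=
  prod_range_succ _ _

/-- A truncated value may exceed the approximate optimum `B k`, but at most by the factor `N / (N -
1)`, which is far below the `2 * N` in the update rule. -/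
theorem weightAfter_pos {n N : ℕ} {s v : ℕ → ℝ} {C : ℝ} {B : ℕ → ℝ} {X : ℕ → Finset ℕ} {t k : ℕ}
    (hN : 5 ≤ N) (hBk : 0 < B k)
    (hB : ∀ Y, Fits n s C Y → (1 - 1 / N) * firstSum v (k + 1) Y ≤ B k)
    (hX : ∀ τ < t, Fits n s C (X τ)) : 0 < weightAfter v N B X t k := by
  have hNr : (5 : ℝ) ≤ N := by exact_mod_cast hN
  have hη : (1 : ℝ) / N ≤ 1 / 5 := one_div_le_one_div_of_le (by norm_num) hNr
  refine prod_pos fun τ hτ => ?_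
  have h1 := hB _ (hX τ (mem_range.1 hτ))
  rw [sub_pos, div_lt_one (by positivity)]
  have h2 : 0 < (2 * N - 2) * B k := mul_pos (by linarith) hBk
  rcases le_or_gt (firstSum v (k + 1) (X τ)) 0 with h | h
  · exact h.trans_lt (by positivity)
  · nlinarith

namespace Setting

variable {w : ℝ → ℕ} {Λ : ℕ → ℝ → Prop} {b h n N : ℕ} {o : ℕ → ℕ} {s v : ℕ → ℝ} {C u : ℝ}
  {μ : Memory}

/-- The tail sums are accumulated from the last cardinality downwards, which needs only one running
sum. -/
theorem run_setObjective (E : Setting w Λ b h n N o s v C u) (hμ : Good Λ h μ)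
    (hc : Prepared n N o s v C u μ) {x : ℕ → ℝ}
    (hx : ∀ k < n, μ.num rWt k / μ.num rNorm k = x k) {l : ℕ} (hl : ∀ k < n, Λ l (x k))
    (hlh : n * (l + 1) ≤ h) :
    Run w Λ h Program.setObjective μ fun ν => ∀ j < n, ν.num rObj j = ∑ k ∈ Ico j n, x k := by
  have L := E.model
  have hnh : n ≤ h := by have := E.items_le; omega
  refine .seq_mono (R := fun ν => ν.num rSum 0 = 0)
    (.assignNum L hμ (by simpa using L.zero h) fun _ => by simp) fun ν hν hf hsum => ?_
  have hc1 := hc.frame hf rfl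
  refine Run.for L (fun e ρ => ρ.num rSum 0 = ∑ k ∈ Ico (n - e) n, x k ∧
    ∀ j, n - e ≤ j → j < n → ρ.num rObj j = ∑ k ∈ Ico j n, x k) n hnh hν rfl
    (fun ν hf => by simp [hf.idx 0 rfl, hc1.items]) ?_ ?_ ?_
  · refine ⟨by simp [hsum], fun j hj hj' => by omega⟩
  · rintro e he ρ hρ hfρ hce ⟨hs, hobj⟩
    have hc2 := hc1.frame hfρ rfl
    have hidx : n - 1 - e < n := by omega
    have hstep : ∑ k ∈ Ico (n - e) n, x k + x (n - 1 - e) = ∑ k ∈ Ico (n - (e + 1)) n, x k := by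
      rw [sum_eq_sum_Ico_succ_bot (by omega : n - (e + 1) < n), add_comm,
        show n - 1 - e = n - (e + 1) by omega, show n - (e + 1) + 1 = n - e by omega]
    have hnew : NumExpr.eval ρ (.var rSum + .cell rWt (.var 0 - .const 1 - .var cE) /
        .cell rNorm (.var 0 - .const 1 - .var cE)) = ∑ k ∈ Ico (n - (e + 1)) n, x k := by
      simp only [NumExpr.eval_add, NumExpr.eval_var, NumExpr.eval_div, NumExpr.eval_cell,
        IdxExpr.eval_sub, IdxExpr.eval_var, IdxExpr.eval_const, hc2.items, hce, hs]
      rw [hfρ.num rWt rfl, hfρ.num rNorm rfl, hf.num rWt rfl, hf.num rNorm rfl, hx _ hidx, hstep]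
    refine .seq_mono (R := fun σ => σ.num rSum 0 = ∑ k ∈ Ico (n - (e + 1)) n, x k)
      (.assignNum L hρ ?_ fun _ => by rw [hnew]; simp) fun σ hσ hfσ hsσ => ?_
    · rw [hnew]
      refine L.mono (L.sum (fun k hk => hl k (mem_Ico.1 hk).2) ?_) hlh
      rw [Nat.card_Ico]; omega
    · have hc3 := hc2.frame hfσ rfl
      refine .assignNum L hσ (hσ.num _ _) fun _ => ⟨by simp [hsσ], fun j hj hjn => ?_⟩
      simp only [Memory.setIdx_num, Memory.setNum_num_self, IdxExpr.eval_sub, IdxExpr.eval_var,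
        IdxExpr.eval_const, hc3.items, hfσ.idx cE rfl, hce, NumExpr.eval_var, hsσ,
        Function.update_apply, hfσ.num rObj rfl]
      split_ifs with hje
      · rw [hje, show n - 1 - e = n - (e + 1) by omega]
      · exact hobj j (by omega) hjn
  · rintro ρ - - - ⟨-, hobj⟩ j hj
    exact hobj j (by omega) hj

theorem run_updateWeights (E : Setting w Λ b h n N o s v C u) (hμ : Good Λ h μ)
    (hc : Prepared n N o s v C u μ) {x : ℕ → ℝ}
    (hx : ∀ k < n, μ.num rWt k * (1 - μ.num rFirst k / (2 * N * μ.num rNorm k)) = x k)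
    (hl : ∀ k < n, Λ h (x k)) :
    Run w Λ h Program.updateWeights μ fun ν => ∀ k < n, ν.num rWt k = x k := by
  have L := E.model
  have hnh : n ≤ h := by have := E.items_le; omega
  refine Run.for L (fun e ρ => ∀ k < n, ρ.num rWt k = if k < e then x k else μ.num rWt k) n hnh hμ
    rfl (fun ν hf => by simp [hf.idx 0 rfl, hc.items]) (by simp) ?_ ?_
  · intro e he ρ hρ hf hce hi
    have hc1 := hc.frame hf rfl
    have hnew : NumExpr.eval ρ (.cell rWt (.var cE) * (.const 1 - .cell rFirst (.var cE) /
        (.const 2 * .ofIdx (.var iAcc) * .cell rNorm (.var cE)))) = x e := by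
      simp only [NumExpr.eval_mul, NumExpr.eval_cell, IdxExpr.eval_var, hce, NumExpr.eval_sub,
        NumExpr.eval_const, NumExpr.eval_div, NumExpr.eval_ofIdx, hc1.accuracy, hi e he,
        hf.num rFirst rfl, hf.num rNorm rfl, lt_irrefl, if_false, Nat.cast_one, Nat.cast_ofNat]
      exact hx e he
    refine .assignNum L hρ (by rw [hnew]; exact hl e he) fun _ k hk => ?_
    rw [hnew]
    simp only [Memory.setIdx_num, IdxExpr.eval_var, hce, Memory.setNum_num_self,
      Function.update_apply]
    by_cases hke : k = e
    · simp [hke]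
    · rw [if_neg hke, hi k hk, if_congr (show k < e ↔ k < e + 1 by omega) rfl rfl]
  · intro ρ _ _ _ hi k hk
    rw [hi k hk, if_pos hk]

/-- All lengths come from the closed form `weightAfter`: a weight is a product of at most `T`
factors of length `lf`, so exact arithmetic on the weights stays polynomial. The largest number is
the scale `a 0 * u`, where `a 0` is a sum of `n` quotients of weights and normalizations;
`weights_le` is the bound on its length. -/
theorem run_rounds (E : Setting w Λ b h n N o s v C u) (hμ : Good Λ h μ)
    (hc : Prepared n N o s v C u μ) {B : ℕ → ℝ} (hnorm : ∀ k < n, μ.num rNorm k = B k)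
    (hwt : ∀ k < n, μ.num rWt k = 1) (hBpos : ∀ k < n, 0 < B k)
    (hBlen : ∀ k < n, Λ (n * (b + 1)) (B k))
    (hB : ∀ k < n, ∀ Y, Fits n s C Y → (1 - 1 / N) * firstSum v (k + 1) Y ≤ B k) :
    Run w Λ h Program.rounds μ fun ν => ∃ X : ℕ → Finset ℕ,
      ∀ t < 2 * ((n * N) * (n * N)), Fits n s C (X t) ∧
        (∀ Y, Fits n s C Y →
          (1 - 1 / N) * ∑ k ∈ range n, weightAfter v N B X t k / B k * firstSum v (k + 1) Y ≤
            ∑ k ∈ range n, weightAfter v N B X t k / B k * firstSum v (k + 1) (X t)) ∧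
        (∀ i < n, ν.idx iOut (t * n + o i) = if i ∈ X t then 1 else 0) ∧
        ν.num rProb t = 1 / (2 * ((n * N) * (n * N)) : ℕ) := by
  have L := E.model
  have hn := E.sorted.n_pos
  have hweights := E.weights_le
  set T := 2 * ((n * N) * (n * N)) with hT
  set lf := 2 * (n * (b + 1)) + N + 2 with hlf
  have hfactor : ∀ k < n, ∀ Y, Fits n s C Y →
      Λ lf (1 - firstSum v (k + 1) Y / (2 * N * B k)) := fun k hk Y hY => by
    have h2 : Λ 1 (2 : ℝ) := by simpa using L.natCast (a := 1) (m := 2) (by norm_num)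
    refine L.mono (L.sub (L.one 0) (L.div (L.firstSum E.value_length (k + 1) hY.subset)
      (L.mul (L.mul h2 (L.nat N)) (hBlen k hk)))) ?_
    rw [hlf]; omega
  have hwlen : ∀ (X : ℕ → Finset ℕ) (t k : ℕ), (∀ τ < t, Fits n s C (X τ)) → t ≤ T → k < n →
      Λ (T * lf) (weightAfter v N B X t k) := fun X t k hX ht hk =>
    L.mono (L.prod t fun τ hτ => hfactor k hk _ (hX τ hτ)) (Nat.mul_le_mul_right _ ht)
  have hwh : T * lf ≤ h := by
    have : T * lf ≤ n * (T * lf + n * (b + 1) + 1) := by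
      calc T * lf ≤ 1 * (T * lf + n * (b + 1) + 1) := by omega
        _ ≤ _ := Nat.mul_le_mul_right _ hn
    omega
  refine Run.for L (fun t ν => ∃ X : ℕ → Finset ℕ,
      (∀ k < n, ν.num rWt k = weightAfter v N B X t k) ∧
      ∀ τ < t, Fits n s C (X τ) ∧
        (∀ Y, Fits n s C Y →
          (1 - 1 / N) * ∑ k ∈ range n, weightAfter v N B X τ k / B k * firstSum v (k + 1) Y ≤
            ∑ k ∈ range n, weightAfter v N B X τ k / B k * firstSum v (k + 1) (X τ)) ∧
        (∀ i < n, ν.idx iOut (τ * n + o i) = if i ∈ X τ then 1 else 0) ∧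
        ν.num rProb τ = 1 / (T : ℕ)) T E.rounds_le hμ rfl
    (fun ν hf => by simp [hf.idx iLen rfl, hc.len, hT]) ?_ ?_ fun ν _ _ _ ⟨X, _, hX⟩ => ⟨X, hX⟩
  · exact ⟨fun _ => ∅, fun k hk => by simp [hwt k hk, weightAfter], fun τ hτ => by omega⟩
  rintro t ht ν hν hf hct ⟨X, hW, hX⟩
  have hc1 := hc.frame hf rfl
  have hXf : ∀ τ < t, Fits n s C (X τ) := fun τ hτ => (hX τ hτ).1
  have hWpos : ∀ k < n, 0 < weightAfter v N B X t k := fun k hk =>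
    weightAfter_pos E.five_le (hBpos k hk) (hB k hk) hXf
  set x : ℕ → ℝ := fun k => weightAfter v N B X t k / B k with hxdef
  have hxpos : ∀ k < n, 0 < x k := fun k hk => div_pos (hWpos k hk) (hBpos k hk)
  have hnormν : ∀ k < n, ν.num rNorm k = B k := fun k hk => by rw [hf.num rNorm rfl, hnorm k hk]
  have hxlen : ∀ k < n, Λ (T * lf + n * (b + 1)) (x k) := fun k hk =>
    L.div (hwlen X t k hXf ht.le hk) (hBlen k hk)
  refine .seq_mono (E.run_setObjective hν hc1 (x := x)
    (fun k hk => by rw [hW k hk, hnormν k hk]) hxlen (by omega)) fun ρ hρ hfρ hobj => ?_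
  have hc2 := hc1.frame hfρ rfl
  refine .seq_mono (E.run_oracle hρ hc2 hobj ?_ (fun j hj => ⟨?_, ?_⟩) ?_ (t := t)
    (by rw [hfρ.idx cT rfl, hct])) ?_
  · exact sum_pos (fun k hk => hxpos k (mem_Ico.1 hk).2) ⟨0, by simpa using hn⟩
  · exact sum_nonneg fun k hk => (hxpos k (mem_Ico.1 hk).2).le
  · exact sum_le_sum_of_subset_of_nonneg (Ico_subset_Ico_left (by omega))
      fun k hk _ => (hxpos k (mem_Ico.1 hk).2).le
  · exact L.mono (L.mul (L.sum (n := n) (fun k hk => hxlen k (mem_Ico.1 hk).2) (by simp))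
      E.max_length)
      (by omega)
  rintro σ hσ hfσ ⟨Z, hZ, hbest, hfirst, hout, hold⟩
  have hc3 := hc2.frame hfσ rfl
  have hsum : ∀ Y, Fits n s C Y → rankSum (fun j i => (∑ k ∈ Ico j n, x k) * v i) Y =
      ∑ k ∈ range n, x k * firstSum v (k + 1) Y := fun Y hY =>
    rankSum_eq_sum_firstSum (a := fun j => ∑ k ∈ Ico j n, x k) (fun j _ => by
      refine sum_congr ?_ fun _ _ => rfl
      ext k; simp; omega) hY.subset
  -- The weights up to round `t` depend only on the earlier sets, so recording `Z` as the set of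
  -- round `t` does not affect them.
  set X' : ℕ → Finset ℕ := Function.update X t Z with hX'
  have hXX' : ∀ τ < t, X τ = X' τ := fun τ hτ => by
    rw [hX', Function.update_of_ne (by omega)]
  have hXt : X' t = Z := by rw [hX', Function.update_self]
  have hX'f : ∀ τ < t + 1, Fits n s C (X' τ) := fun τ hτ => by
    rcases Nat.lt_succ_iff_lt_or_eq.1 hτ with hτ | rfl
    · rw [← hXX' τ hτ]; exact hXf τ hτ
    · rw [hXt]; exact hZ
  refine .seq_mono (E.run_updateWeights hσ hc3 (x := weightAfter v N B X' (t + 1))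
    (fun k hk => ?_) fun k hk => L.mono (hwlen X' (t + 1) k hX'f ht hk) hwh)
    fun κ hκ hfκ hwκ => ?_
  · rw [hfσ.num rWt rfl, hfρ.num rWt rfl, hW k hk, hfirst k hk, hfσ.num rNorm rfl,
      hfρ.num rNorm rfl, hnormν k hk, weightAfter_succ, hXt, weightAfter_congr hXX']
  · have hc4 := hc3.frame hfκ rfl
    have hctκ : κ.idx cT 0 = t := by
      rw [hfκ.idx cT rfl, hfσ.idx cT rfl, hfρ.idx cT rfl, hct]
    have hprob : NumExpr.eval κ (.const 1 / .ofIdx (.var iLen)) = 1 / (T : ℕ) := by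
      simp [hc4.len, ← hT]
    refine .assignNum L hκ ?_ fun _ => ⟨X', fun k hk => ?_, fun τ hτ => ⟨hX'f τ hτ, ?_, ?_, ?_⟩⟩
    · rw [hprob]
      refine L.mono (L.div (L.one 0) (L.nat T)) ?_
      have := E.rounds_le
      omega
    · simpa using hwκ k hk
    · intro Y hY
      rcases Nat.lt_succ_iff_lt_or_eq.1 hτ with hτ | rfl
      · have := (hX τ hτ).2.1 Y hY
        simp only [weightAfter_congr (fun τ' hτ' => hXX' τ' (lt_trans hτ' hτ)), hXX' τ hτ] at this
        exact this
      · have := hbest Y hY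
        rw [hsum Y hY, hsum Z hZ] at this
        simp only [hxdef, weightAfter_congr hXX'] at this
        rw [hXt]
        exact this
    · intro i hi
      simp only [Memory.setIdx_idx_of_ne, ne_eq, Nat.reduceEqDiff, not_false_eq_true,
        Memory.setNum_idx, hfκ.idx iOut rfl]
      rcases Nat.lt_succ_iff_lt_or_eq.1 hτ with hτ | rfl
      -- The rows of earlier rounds end before `t * n`, where the oracle leaves the output
      -- unchanged.
      · have h1 := E.ord_lt i hi
        have h2 : τ * n + o i < t * n := by
          calc τ * n + o i < τ * n + n := by omega
            _ = (τ + 1) * n := by ring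
            _ ≤ t * n := Nat.mul_le_mul_right _ hτ
        rw [hold _ h2, hfρ.idx iOut rfl, (hX τ hτ).2.2.1 i hi, hXX' τ hτ]
      · rw [hout i hi, hXt]
    · rw [hprob]
      simp only [Memory.setIdx_num, IdxExpr.eval_var, hctκ, Memory.setNum_num_self,
        Function.update_apply, hfκ.num rProb rfl, hfσ.num rProb rfl, hfρ.num rProb rfl]
      split_ifs with hτt
      · rfl
      · exact (hX τ (by omega)).2.2.2

end Setting

/-! ## Preprocessing -/

/-- `f` comes before `e` in the order by decreasing value and increasing index. -/
def Before (val : ℕ → ℝ) (f e : ℕ) : Prop := if f < e then val e ≤ val f else val e < val f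

theorem before_iff {val : ℕ → ℝ} {f e : ℕ} :
    Before val f e ↔ val e < val f ∨ val e = val f ∧ f < e := by
  unfold Before
  split_ifs with h
  · rw [le_iff_lt_or_eq]; simp [h]
  · simp [h]

open Classical in
/-- The position of `e` in the order by decreasing value and increasing index. -/
noncomputable def position (n : ℕ) (val : ℕ → ℝ) (e : ℕ) : ℕ := #{f ∈ range n | Before val f e}

theorem position_lt_of_before {n : ℕ} {val : ℕ → ℝ} {f e : ℕ} (hf : f < n)
    (h : Before val f e) : position n val f < position n val e := by
  classical
  refine card_lt_card ⟨fun g hg => ?_, fun hsub => ?_⟩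
  · simp only [mem_filter, before_iff] at hg ⊢
    rw [before_iff] at h
    refine ⟨hg.1, ?_⟩
    rcases hg.2 with h1 | ⟨h1, h2⟩ <;> rcases h with h3 | ⟨h3, h4⟩
    · exact .inl (h3.trans h1)
    · exact .inl (h3 ▸ h1)
    · exact .inl (h1 ▸ h3)
    · exact .inr ⟨h3.trans h1, h2.trans h4⟩
  · have := hsub (mem_filter.2 ⟨mem_range.2 hf, h⟩)
    simp [before_iff] at this

theorem position_lt {n : ℕ} {val : ℕ → ℝ} {e : ℕ} (he : e < n) : position n val e < n := by
  classical
  calc position n val e < #(range n) := card_lt_card ⟨filter_subset _ _, fun hsub => by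
        have := hsub (mem_range.2 he)
        simp [before_iff] at this⟩
    _ = n := card_range n

theorem position_injOn {n : ℕ} {val : ℕ → ℝ} {e f : ℕ} (he : e < n) (hf : f < n)
    (h : position n val e = position n val f) : e = f := by
  by_contra hne
  have : Before val e f ∨ Before val f e := by
    rw [before_iff, before_iff]
    rcases lt_trichotomy (val e) (val f) with h1 | h1 | h1
    · exact .inr (.inl h1)
    · rcases Nat.lt_or_gt_of_ne hne with h2 | h2
      · exact .inl (.inr ⟨h1.symm, h2⟩)
      · exact .inr (.inr ⟨h1, h2⟩)
    · exact .inl (.inl h1)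
  rcases this with h1 | h1
  · exact (position_lt_of_before he h1).ne h
  · exact (position_lt_of_before hf h1).ne h.symm

/-- There is a sorted order of the items. -/
theorem exists_sorted_order (n : ℕ) (val : ℕ → ℝ) :
    ∃ o : ℕ → ℕ, ∀ i < n, o i < n ∧ position n val (o i) = i := by
  have hsurj : ∀ i < n, ∃ e, e < n ∧ position n val e = i := by
    intro i hi
    have h := surj_on_of_inj_on_of_card_le (s := range n) (t := range n)
      (fun e _ => position n val e) (fun e he => mem_range.2 (position_lt (mem_range.1 he)))
      (fun e f he hf h => position_injOn (mem_range.1 he) (mem_range.1 hf) h) le_rfl i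
      (mem_range.2 hi)
    obtain ⟨e, he, hei⟩ := h
    exact ⟨e, mem_range.1 he, hei.symm⟩
  choose! o ho using hsurj
  exact ⟨o, ho⟩

section Preprocessing

variable {w : ℝ → ℕ} {Λ : ℕ → ℝ → Prop} {h n N : ℕ} {μ : Memory}

/-- As real numbers cannot be rounded, `N` is found by linear search; `m` is the number of
iterations, and `hle` and `hlt` make `m + 5` the first success. -/
theorem run_chooseAccuracy (L : LengthModel w Λ) (hμ : Good Λ h μ) {ε : ℝ} (hn : μ.idx 0 0 = n)
    (hε : μ.num 3 0 = ε) {m : ℕ} (hle : ∀ i < m, ((i + 5 : ℕ) : ℝ) * ε ≤ 5)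
    (hlt : 5 < ((m + 5 : ℕ) : ℝ) * ε) (hm : m + 5 ≤ h) (hD : n * (m + 5) ≤ h)
    (hW : n * (n * (m + 5)) + 1 ≤ h) (hT : 2 * ((n * (m + 5)) * (n * (m + 5))) ≤ h) :
    Run w Λ h Program.chooseAccuracy μ fun ν => ν.idx iAcc 0 = m + 5 ∧
      ν.idx iD 0 = n * (m + 5) ∧ ν.idx iW 0 = n * (n * (m + 5)) + 1 ∧
      ν.idx iLen 0 = 2 * ((n * (m + 5)) * (n * (m + 5))) := by
  refine .seq_mono (R := fun ν => ν.idx iAcc 0 = 5) (.assignIdx hμ (le_two_pow (by simp; omega))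
    fun _ => by simp) fun ν hν hf h5 => ?_
  refine .seq_mono (R := fun ν => ν.idx iAcc 0 = m + 5) (Run.while_ L
    (fun i ρ => ρ.idx iAcc 0 = i + 5) m (by omega) hν (by simp [h5]) ?_ ?_)
    fun ρ hρ hf' hN => ?_
  · intro i hi ρ hρ hf' hinv
    have hε' : ρ.num 3 0 = ε := by rw [hf'.num 3 rfl, hf.num 3 rfl, hε]
    refine ⟨?_, .assignIdx hρ (le_two_pow ?_) fun _ => ?_⟩
    · simpa [hinv, hε'] using hle i hi
    · simp [hinv]; omega
    · simp [hinv, add_right_comm]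
  · intro ρ hρ hf' hinv
    have hε' : ρ.num 3 0 = ε := by rw [hf'.num 3 rfl, hf.num 3 rfl, hε]
    exact ⟨by simpa [hinv, hε'] using hlt, hinv⟩
  · have hnρ : ρ.idx 0 0 = n := by rw [hf'.idx 0 rfl, hf.idx 0 rfl, hn]
    refine .seq_mono (R := fun σ => σ.idx iD 0 = n * (m + 5)) (.assignIdx hρ
      (le_two_pow (by simpa [hnρ, hN] using hD)) fun _ => by simp [hnρ, hN]) fun σ hσ hf₁ hDσ => ?_
    refine .seq_mono (R := fun τ => τ.idx iW 0 = n * (n * (m + 5)) + 1) (.assignIdx hσ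
      (le_two_pow (by simpa [hf₁.idx 0 rfl, hnρ, hDσ] using hW))
      fun _ => by simp [hf₁.idx 0 rfl, hnρ, hDσ]) fun τ hτ hf₂ hWτ => ?_
    have hDτ : τ.idx iD 0 = n * (m + 5) := by rw [hf₂.idx iD rfl, hDσ]
    have hNτ : τ.idx iAcc 0 = m + 5 := by rw [hf₂.idx iAcc rfl, hf₁.idx iAcc rfl, hN]
    exact .assignIdx hτ (le_two_pow (by simpa [hDτ] using hT))
      fun _ => by simp [hDτ, hNτ, hWτ]

/-- The cell for the maximum initially holds zero, which is smaller than every value, so it is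
replaced by the first item that fits. -/
theorem run_findMax (L : LengthModel w Λ) (hμ : Good Λ h μ) (hn : μ.idx 0 0 = n) (hnh : n ≤ h)
    {size val : ℕ → ℝ} {C u : ℝ} (hsize : ∀ e < n, μ.num 0 e = size e)
    (hval : ∀ e < n, μ.num 1 e = val e) (hC : μ.num 2 0 = C) (h0 : μ.num rMax 0 = 0)
    (hpos : ∀ e < n, 0 < val e) (hu : ∀ e < n, size e ≤ C → val e ≤ u)
    (hatt : ∃ e < n, size e ≤ C ∧ val e = u) :
    Run w Λ h Program.findMax μ fun ν => ν.num rMax 0 = u := by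
  refine Run.for L (fun i ρ => (∀ e < i, size e ≤ C → val e ≤ ρ.num rMax 0) ∧
    (ρ.num rMax 0 = 0 ∨ ∃ e < n, size e ≤ C ∧ val e = ρ.num rMax 0)) n hnh hμ rfl
    (fun ν hf => by simp [hf.idx 0 rfl, hn]) ?_ ?_ ?_
  · exact ⟨fun e he => by omega, .inl (by simpa using h0)⟩
  · rintro i hi ρ hρ hf hci ⟨hle, hor⟩
    have hs : ρ.num 0 i = size i := by rw [hf.num 0 rfl, hsize i hi]
    have hv : ρ.num 1 i = val i := by rw [hf.num 1 rfl, hval i hi]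
    have hC' : ρ.num 2 0 = C := by rw [hf.num 2 rfl, hC]
    refine .ite L hρ (fun h1 => .ite L hρ (fun h2 => .assignNum L hρ (hρ.num _ _) fun _ => ?_)
      fun h2 => .skip hρ ?_) fun h1 => .skip hρ ?_
    · simp only [Test.holds_numLE, NumExpr.eval_cell, IdxExpr.eval_var, hci, hs, NumExpr.eval_var,
        hC', hv] at h1 h2
      simp only [Memory.setIdx_num, NumExpr.eval_cell, IdxExpr.eval_var, hci, hv,
        IdxExpr.eval_const, Memory.setNum_num_self, Function.update_self]
      refine ⟨fun e he hes => ?_, .inr ⟨i, hi, h1, rfl⟩⟩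
      rcases Nat.lt_succ_iff_lt_or_eq.1 he with he | rfl
      · exact (hle e he hes).trans h2
      · exact le_rfl
    · simp only [Test.holds_numLE, NumExpr.eval_cell, IdxExpr.eval_var, hci, NumExpr.eval_var,
        hv] at h2
      refine ⟨fun e he hes => ?_, hor⟩
      rcases Nat.lt_succ_iff_lt_or_eq.1 he with he | rfl
      · exact hle e he hes
      · exact (not_le.1 h2).le
    · simp only [Test.holds_numLE, NumExpr.eval_cell, IdxExpr.eval_var, hci, hs, NumExpr.eval_var,
        hC'] at h1
      refine ⟨fun e he hes => ?_, hor⟩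
      rcases Nat.lt_succ_iff_lt_or_eq.1 he with he | rfl
      · exact hle e he hes
      · exact absurd hes h1
  · rintro ν - - - ⟨hle, hor⟩
    obtain ⟨e, he, hes, rfl⟩ := hatt
    have h1 := hle e he hes
    rcases hor with h2 | ⟨f, hf, hfs, hfv⟩
    · have := hpos e he
      linarith
    · exact le_antisymm (hfv ▸ hu f hf hfs) h1

theorem run_computeRank (L : LengthModel w Λ) (hμ : Good Λ h μ) (hn : μ.idx 0 0 = n)
    (hnh : n ≤ h) {val : ℕ → ℝ} (hval : ∀ e < n, μ.num 1 e = val e) {e : ℕ}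
    (he : μ.idx cE 0 = e) (hen : e < n) :
    Run w Λ h Program.computeRank μ fun ν => ν.idx iRank 0 = position n val e := by
  classical
  refine .seq_mono (R := fun ν => ν.idx iRank 0 = 0) (.assignIdx hμ (by simp) fun _ => by simp)
    fun ν hν hf h0 => ?_
  refine Run.for L (fun i ρ => ρ.idx iRank 0 = #{f ∈ range i | Before val f e}) n hnh hν rfl
    (fun ν hf' => by simp [hf'.idx 0 rfl, hf.idx 0 rfl, hn]) (by simp [h0]) ?_
    fun ρ _ _ _ hi => by rw [hi, position]
  intro i hi ρ hρ hf' hci hinv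
  have heρ : ρ.idx cE 0 = e := by rw [hf'.idx cE rfl, hf.idx cE rfl, he]
  have hv : ∀ f < n, ρ.num 1 f = val f := fun f hf'' => by
    rw [hf'.num 1 rfl, hf.num 1 rfl, hval f hf'']
  have hcard : #{f ∈ range (i + 1) | Before val f e} =
      #{f ∈ range i | Before val f e} + if Before val i e then 1 else 0 := by
    rw [range_add_one, filter_insert]
    split_ifs
    · rw [card_insert_of_notMem (by simp)]
    · simp
  have hsmall : #{f ∈ range i | Before val f e} ≤ i := by
    simpa using card_filter_le (range i) fun f => Before val f e
  have hinc : Before val i e → Run w Λ h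
      (.assignIdx iRank (.const 0) (.var iRank + .const 1)) ρ fun ρ =>
        (ρ.setIdx cF 0 (i + 1)).idx iRank 0 = #{f ∈ range (i + 1) | Before val f e} := fun hb => by
    refine .assignIdx hρ (le_two_pow ?_) fun _ => ?_
    · simp [hinv]; omega
    · rw [hcard, if_pos hb]; simp [hinv]
  have hskip : ¬ Before val i e → Run w Λ h .skip ρ fun ρ =>
        (ρ.setIdx cF 0 (i + 1)).idx iRank 0 = #{f ∈ range (i + 1) | Before val f e} := fun hb => by
    refine .skip hρ ?_
    rw [hcard, if_neg hb]; simp [hinv]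
  refine .ite L hρ (fun h1 => .ite L hρ (fun h2 => hinc ?_) fun h2 => hskip ?_)
    fun h1 => .ite L hρ (fun h2 => hskip ?_) fun h2 => hinc ?_
  all_goals
    simp only [Test.holds_idxLE, IdxExpr.eval_add, IdxExpr.eval_var, IdxExpr.eval_const, hci, heρ,
      Test.holds_numLE, NumExpr.eval_cell, hv _ hi, hv _ hen] at h1 h2
    unfold Before
  · rwa [if_pos (by omega)]
  · rwa [if_pos (by omega)]
  · rw [if_neg (by omega)]; exact not_lt.2 h2
  · rw [if_neg (by omega)]; exact not_le.1 h2

/-- Every item is written directly to its position, and positions are distinct even for equal values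
because ties are broken by the index. -/
theorem run_sortItems (L : LengthModel w Λ) (hμ : Good Λ h μ) (hn : μ.idx 0 0 = n) (hnh : n ≤ h)
    {size val : ℕ → ℝ} (hsize : ∀ e < n, μ.num 0 e = size e) (hval : ∀ e < n, μ.num 1 e = val e) :
    Run w Λ h Program.sortItems μ fun ν => ∀ e < n, ν.idx iOrd (position n val e) = e ∧
      ν.num rSize (position n val e) = size e ∧ ν.num rVal (position n val e) = val e := by
  refine Run.for L (fun i ν => ∀ e < i, ν.idx iOrd (position n val e) = e ∧
      ν.num rSize (position n val e) = size e ∧ ν.num rVal (position n val e) = val e) n hnh hμ rfl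
    (fun ν hf => by simp [hf.idx 0 rfl, hn]) (by simp) ?_ fun _ _ _ _ hi => hi
  intro i hi ρ hρ hf hci hinv
  have hv : ∀ f < n, ρ.num 1 f = val f := fun f hf'' => by rw [hf.num 1 rfl, hval f hf'']
  refine .seq_mono (run_computeRank L hρ (by rw [hf.idx 0 rfl, hn]) hnh hv hci hi)
    fun σ hσ hfσ hrk => ?_
  have hciσ : σ.idx cE 0 = i := by rw [hfσ.idx cE rfl, hci]
  have hsσ : σ.num 0 i = size i := by rw [hfσ.num 0 rfl, hf.num 0 rfl, hsize i hi]
  have hvσ : σ.num 1 i = val i := by rw [hfσ.num 1 rfl, hv i hi]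
  refine .seq (.assignIdx hσ (hσ.idx _ _) fun hg _ _ => .seq (.assignNum L hg (hg.num _ _)
    fun hg _ _ => .assignNum L hg (hg.num _ _) fun _ e he => ?_))
  simp only [ne_eq, Nat.reduceEqDiff, not_false_eq_true, Memory.setIdx_idx_of_ne,
    Memory.setNum_idx, Memory.setIdx_idx_self, IdxExpr.eval_var, hrk, hciσ, Memory.setIdx_num,
    Memory.setNum_num_of_ne, Memory.setNum_num_self, NumExpr.eval_cell, hsσ, hvσ,
    Function.update_apply, hfσ.idx iOrd rfl, hfσ.num rSize rfl, hfσ.num rVal rfl,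
    OfNat.one_ne_ofNat]
  rcases Nat.lt_succ_iff_lt_or_eq.1 he with he | rfl
  · have hne : position n val e ≠ position n val i := fun e' => by
      have := position_injOn (he.trans hi) hi e'
      omega
    simpa only [if_neg hne] using hinv e he
  · simp

theorem run_powers (L : LengthModel w Λ) (hμ : Good Λ h μ) (hn : μ.idx 0 0 = n)
    (hnh : n + 1 ≤ h) :
    Run w Λ h Program.powers μ fun ν => ∀ l ≤ n, ν.idx iPow l = 2 ^ l := by
  refine .seq_mono (R := fun ν => ν.idx iPow 0 = 1)
    (.assignIdx hμ (by simpa using Nat.one_le_two_pow) fun _ => by simp) fun ν hν hf h1 => ?_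
  refine Run.for L (fun i ν => ∀ l ≤ i, ν.idx iPow l = 2 ^ l) n (by omega) hν rfl
    (fun ν hf' => by simp [hf'.idx 0 rfl, hf.idx 0 rfl, hn]) ?_ ?_ fun _ _ _ _ hi => hi
  · intro l hl
    obtain rfl : l = 0 := by omega
    simp [h1]
  · intro i hi ρ hρ hf' hci hinv
    have hp := hinv i le_rfl
    refine .assignIdx hρ ?_ fun _ l hl => ?_
    · simp only [IdxExpr.eval_add, IdxExpr.eval_cell, IdxExpr.eval_var, hci, hp]
      calc 2 ^ i + 2 ^ i = 2 ^ (i + 1) := by ring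
        _ ≤ 2 ^ h := Nat.pow_le_pow_right (by omega) (by omega)
    · simp only [ne_eq, Nat.reduceEqDiff, not_false_eq_true, Memory.setIdx_idx_of_ne,
        IdxExpr.eval_add, IdxExpr.eval_var, hci, IdxExpr.eval_const, IdxExpr.eval_cell, hp,
        Memory.setIdx_idx_self, Function.update_apply]
      split_ifs with hli
      · rw [hli]; ring
      · exact hinv l (by omega)

end Preprocessing

/-- The whole program, started with the data of a knapsack instance. -/
theorem Setting.run_robustKnapsack {w : ℝ → ℕ} {Λ : ℕ → ℝ → Prop} {b h n m : ℕ} {o : ℕ → ℕ}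
    {size val : ℕ → ℝ} {C u ε : ℝ} {μ : Memory}
    (E : Setting w Λ b h n (m + 5) o (fun i => size (o i)) (fun i => val (o i)) C u)
    (hμ : Good Λ h μ) (hn : μ.idx 0 0 = n) (hsize : ∀ e < n, μ.num 0 e = size e)
    (hval : ∀ e < n, μ.num 1 e = val e) (hC : μ.num 2 0 = C) (hε : μ.num 3 0 = ε)
    (h0 : μ.num rMax 0 = 0) (hpos : ∀ e < n, 0 < val e)
    (ho : ∀ i < n, o i < n ∧ position n val (o i) = i)
    (hu : ∀ e < n, size e ≤ C → val e ≤ u) (hatt : ∃ e < n, size e ≤ C ∧ val e = u)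
    (hle : ∀ i < m, ((i + 5 : ℕ) : ℝ) * ε ≤ 5) (hlt : 5 < ((m + 5 : ℕ) : ℝ) * ε) :
    Run w Λ h Program.robustKnapsack μ fun ν =>
      ν.idx iLen 0 = 2 * ((n * (m + 5)) * (n * (m + 5))) ∧
      ∃ (B : ℕ → ℝ) (X : ℕ → Finset ℕ),
        (∀ k < n, 0 < B k ∧
          (∀ Y, Fits n (fun i => size (o i)) C Y →
            (1 - 1 / (m + 5 : ℕ)) * firstSum (fun i => val (o i)) (k + 1) Y ≤ B k) ∧
          ∃ Y, Fits n (fun i => size (o i)) C Y ∧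
            B k = firstSum (fun i => val (o i)) (k + 1) Y) ∧
        ∀ t < 2 * ((n * (m + 5)) * (n * (m + 5))), Fits n (fun i => size (o i)) C (X t) ∧
          (∀ Y, Fits n (fun i => size (o i)) C Y →
            (1 - 1 / (m + 5 : ℕ)) * ∑ k ∈ range n, weightAfter (fun i => val (o i)) (m + 5) B X t k
              / B k * firstSum (fun i => val (o i)) (k + 1) Y ≤
            ∑ k ∈ range n, weightAfter (fun i => val (o i)) (m + 5) B X t k / B k *
              firstSum (fun i => val (o i)) (k + 1) (X t)) ∧
          (∀ i < n, ν.idx iOut (t * n + o i) = if i ∈ X t then 1 else 0) ∧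
          ν.num rProb t = 1 / (2 * ((n * (m + 5)) * (n * (m + 5))) : ℕ) := by
  have L := E.model
  have hnh : n ≤ h := by have := E.items_le; omega
  have hn0 := E.sorted.n_pos
  refine .seq_mono (run_chooseAccuracy L hμ hn hε hle hlt E.accuracy_le E.den_le E.width_le
    E.rounds_le) fun ν₁ hν₁ f₁ ⟨hN₁, hD₁, hW₁, hT₁⟩ => ?_
  have hn₁ : ν₁.idx 0 0 = n := by rw [f₁.idx 0 rfl, hn]
  have hs₁ : ∀ e < n, ν₁.num 0 e = size e := fun e he => by rw [f₁.num 0 rfl, hsize e he]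
  have hv₁ : ∀ e < n, ν₁.num 1 e = val e := fun e he => by rw [f₁.num 1 rfl, hval e he]
  refine .seq_mono (run_findMax L hν₁ hn₁ hnh hs₁ hv₁ (by rw [f₁.num 2 rfl, hC])
    (by rw [f₁.num rMax rfl, h0]) hpos hu hatt) fun ν₂ hν₂ f₂ hmax => ?_
  have hn₂ : ν₂.idx 0 0 = n := by rw [f₂.idx 0 rfl, hn₁]
  refine .seq_mono (run_sortItems L hν₂ hn₂ hnh
    (fun e he => by rw [f₂.num 0 rfl, hs₁ e he]) (fun e he => by rw [f₂.num 1 rfl, hv₁ e he]))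
    fun ν₃ hν₃ f₃ hsort => ?_
  have hn₃ : ν₃.idx 0 0 = n := by rw [f₃.idx 0 rfl, hn₂]
  refine .seq_mono (run_powers L hν₃ hn₃ E.items_le) fun ν₄ hν₄ f₄ hpow => ?_
  have hc : Prepared n (m + 5) o (fun i => size (o i)) (fun i => val (o i)) C u ν₄ := by
    refine ⟨?_, ?_, ?_, ?_, ?_, hpow, fun i hi => ?_, fun i hi => ?_, fun i hi => ?_, ?_, ?_⟩
    · rw [f₄.idx 0 rfl, hn₃]
    · rw [f₄.idx iAcc rfl, f₃.idx iAcc rfl, f₂.idx iAcc rfl, hN₁]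
    · rw [f₄.idx iD rfl, f₃.idx iD rfl, f₂.idx iD rfl, hD₁]
    · rw [f₄.idx iW rfl, f₃.idx iW rfl, f₂.idx iW rfl, hW₁]
    · rw [f₄.idx iLen rfl, f₃.idx iLen rfl, f₂.idx iLen rfl, hT₁]
    · have := (hsort (o i) (ho i hi).1).1
      rwa [(ho i hi).2, ← f₄.idx iOrd rfl] at this
    · have := (hsort (o i) (ho i hi).1).2.1
      rwa [(ho i hi).2, ← f₄.num rSize rfl] at this
    · have := (hsort (o i) (ho i hi).1).2.2
      rwa [(ho i hi).2, ← f₄.num rVal rfl] at this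
    · rw [f₄.num 2 rfl, f₃.num 2 rfl, f₂.num 2 rfl, f₁.num 2 rfl, hC]
    · rw [f₄.num rMax rfl, f₃.num rMax rfl, hmax]
  refine .seq_mono (E.run_normalize hν₄ hc) fun ν₅ hν₅ f₅ hnorm => ?_
  have hc5 := hc.frame f₅ rfl
  have hη : (0 : ℝ) < 1 - 1 / (m + 5 : ℕ) := by
    rw [sub_pos, div_lt_one (by positivity)]
    exact_mod_cast (by omega : 1 < m + 5)
  have hBpos : ∀ k < n, 0 < ν₅.num rNorm k := by
    intro k hk
    obtain ⟨-, X, hX, hXB, hY⟩ := hnorm k hk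
    obtain ⟨i, hi, hfi, hvi⟩ := E.sorted.fits_singleton
    have h1 := hY _ hfi
    rw [firstSum_of_card_le (by simp), sum_singleton, hvi] at h1
    rw [hXB]
    exact (mul_pos hη E.sorted.u_pos).trans_le h1
  refine (E.run_rounds hν₅ hc5 (B := ν₅.num rNorm) (fun _ _ => rfl)
    (fun k hk => (hnorm k hk).1) hBpos (fun k hk => ?_) fun k hk Y hY => ?_).mono
    fun ν₆ hν₆ f₆ ⟨X, hX⟩ => ?_
  · obtain ⟨-, X, hX, hXB, -⟩ := hnorm k hk
    rw [hXB]
    exact L.firstSum E.value_length _ hX.subset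
  · obtain ⟨-, X, hX, hXB, hbest⟩ := hnorm k hk
    rw [hXB]
    exact hbest Y hY
  · refine ⟨(hc5.frame f₆ rfl).len, ν₅.num rNorm, X, fun k hk => ⟨hBpos k hk, ?_⟩, hX⟩
    obtain ⟨-, X, hX, hXB, hbest⟩ := hnorm k hk
    exact ⟨fun Y hY => hXB ▸ hbest Y hY, X, hX, hXB⟩

/-! ## From sorted positions back to the items of an instance -/

namespace Instance

variable (I : Instance)

/-- The sizes as a function on all natural numbers. -/
noncomputable def sizeFn (e : ℕ) : ℝ := if h : e < I.n then I.size ⟨e, h⟩ else 0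

/-- The values as a function on all natural numbers. -/
noncomputable def valueFn (e : ℕ) : ℝ := if h : e < I.n then I.value ⟨e, h⟩ else 0

@[simp] theorem sizeFn_coe (e : Fin I.n) : I.sizeFn e = I.size e := by simp [sizeFn]

@[simp] theorem valueFn_coe (e : Fin I.n) : I.valueFn e = I.value e := by simp [valueFn]

/-- The positions of the elements of a set of items in the sorted order. -/
noncomputable def positions (Y : Finset (Fin I.n)) : Finset ℕ :=
  Y.image fun e : Fin I.n => position I.n I.valueFn e

variable {I}

theorem position_inj {e f : Fin I.n} (h : position I.n I.valueFn e = position I.n I.valueFn f) :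
    e = f :=
  Fin.ext (position_injOn e.2 f.2 h)

theorem mem_positions {Y : Finset (Fin I.n)} {e : Fin I.n} :
    position I.n I.valueFn e ∈ I.positions Y ↔ e ∈ Y := by
  rw [positions, mem_image]
  exact ⟨fun ⟨f, hf, h⟩ => position_inj h ▸ hf, fun h => ⟨e, h, rfl⟩⟩

theorem positions_subset (Y : Finset (Fin I.n)) : I.positions Y ⊆ range I.n := fun i hi => by
  obtain ⟨e, -, rfl⟩ := mem_image.1 hi
  exact mem_range.2 (position_lt e.2)

theorem card_positions (Y : Finset (Fin I.n)) : #(I.positions Y) = #Y :=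
  card_image_of_injective _ fun _ _ h => position_inj h

/-- `o` lists the items in sorted order. -/
def Sorts (I : Instance) (o : ℕ → ℕ) : Prop :=
  ∀ i < I.n, o i < I.n ∧ position I.n I.valueFn (o i) = i

variable {o : ℕ → ℕ}

theorem Sorts.apply_position (ho : I.Sorts o) (e : Fin I.n) :
    o (position I.n I.valueFn e) = e :=
  have h := ho _ (position_lt (val := I.valueFn) e.2)
  position_injOn h.1 e.2 h.2

theorem Sorts.sum_positions (ho : I.Sorts o) (g : ℕ → ℝ) (Y : Finset (Fin I.n)) :
    ∑ i ∈ I.positions Y, g (o i) = ∑ e ∈ Y, g e := by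
  rw [positions, sum_image fun _ _ _ _ h => position_inj h]
  exact sum_congr rfl fun e _ => by rw [ho.apply_position]

theorem Sorts.injective (ho : I.Sorts o) : ∀ i < I.n, ∀ j < I.n, o i = o j → i = j := by
  intro i hi j hj h
  rw [← (ho i hi).2, h, (ho j hj).2]

theorem Sorts.sum_size (ho : I.Sorts o) (Y : Finset (Fin I.n)) :
    ∑ i ∈ I.positions Y, I.sizeFn (o i) = ∑ e ∈ Y, I.size e := by
  simp [ho.sum_positions]

theorem Sorts.sum_value (ho : I.Sorts o) (Y : Finset (Fin I.n)) :
    ∑ i ∈ I.positions Y, I.valueFn (o i) = ∑ e ∈ Y, I.value e := by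
  simp [ho.sum_positions]

theorem Sorts.fits_iff (ho : I.Sorts o) (Y : Finset (Fin I.n)) :
    Fits I.n (fun i => I.sizeFn (o i)) I.capacity (I.positions Y) ↔ Y ∈ I.feasible := by
  simp only [feasible, mem_filter, mem_univ, true_and, ← ho.sum_size]
  exact ⟨fun h => h.sum_le, fun h => ⟨positions_subset Y, h⟩⟩

/-- The items at the positions `X`. -/
noncomputable def itemsAt (I : Instance) (X : Finset ℕ) : Finset (Fin I.n) :=
  {e | position I.n I.valueFn e ∈ X}

theorem Sorts.positions_itemsAt (ho : I.Sorts o) {X : Finset ℕ} (hX : X ⊆ range I.n) :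
    I.positions (I.itemsAt X) = X := by
  ext i
  simp only [positions, mem_image, itemsAt, mem_filter, mem_univ, true_and]
  constructor
  · rintro ⟨e, he, rfl⟩
    exact he
  · intro hi
    obtain ⟨h1, h2⟩ := ho i (mem_range.1 (hX hi))
    exact ⟨⟨o i, h1⟩, by simpa only [h2] using hi, h2⟩

theorem valueFn_pos {e : ℕ} (he : e < I.n) : 0 < I.valueFn e := by
  simpa [valueFn, he] using I.value_pos ⟨e, he⟩

theorem sizeFn_pos {e : ℕ} (he : e < I.n) : 0 < I.sizeFn e := by
  simpa [sizeFn, he] using I.size_pos ⟨e, he⟩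

theorem Sorts.anti (ho : I.Sorts o) :
    ∀ i j, i ≤ j → j < I.n → I.valueFn (o j) ≤ I.valueFn (o i) := by
  intro i j hij hj
  by_contra! h
  have hi : i < I.n := by omega
  have := position_lt_of_before (ho j hj).1 (before_iff.2 (.inl h))
  rw [(ho i hi).2, (ho j hj).2] at this
  omega

theorem exists_max_value (I : Instance) : ∃ u, (∀ e < I.n, I.sizeFn e ≤ I.capacity →
    I.valueFn e ≤ u) ∧ ∃ e < I.n, I.sizeFn e ≤ I.capacity ∧ I.valueFn e = u := by
  classical
  obtain ⟨e₀, he₀⟩ := I.fits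
  obtain ⟨e, he, hmax⟩ := exists_max_image ({e | I.size e ≤ I.capacity} : Finset (Fin I.n))
    I.value ⟨e₀, by simpa using he₀⟩
  refine ⟨I.value e, fun f hf hs => ?_, e, e.2, by simpa using he, by simp⟩
  simpa [valueFn, hf] using hmax ⟨f, hf⟩ (by simpa [sizeFn, hf] using hs)

theorem Sorts.sortedKnapsack (ho : I.Sorts o) {u : ℝ}
    (hu : ∀ e < I.n, I.sizeFn e ≤ I.capacity → I.valueFn e ≤ u)
    (hatt : ∃ e < I.n, I.sizeFn e ≤ I.capacity ∧ I.valueFn e = u) :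
    SortedKnapsack I.n (fun i => I.sizeFn (o i)) (fun i => I.valueFn (o i)) I.capacity u where
  size_pos i hi := sizeFn_pos (ho i hi).1
  value_pos i hi := valueFn_pos (ho i hi).1
  anti := ho.anti
  value_le i hi := hu _ (ho i hi).1
  attained := by
    obtain ⟨e, he, hs, hv⟩ := hatt
    have := ho.apply_position ⟨e, he⟩
    exact ⟨position I.n I.valueFn e, position_lt he, by simpa [this] using hs,
      by simpa [this] using hv⟩

theorem Sorts.topValue_eq (ho : I.Sorts o) (k : ℕ) (Y : Finset (Fin I.n)) :
    I.topValue k Y = firstSum (fun i => I.valueFn (o i)) k (I.positions Y) := by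
  refine le_antisymm (sup'_le _ _ fun X' hX' => ?_) ?_
  · rw [mem_filter, mem_powerset] at hX'
    rw [← ho.sum_value]
    exact sum_le_firstSum (fun i hi => (valueFn_pos (ho i hi).1).le) ho.anti k (positions_subset Y)
      _ (image_subset_image hX'.1) (by rw [card_positions]; exact hX'.2)
  -- The elements of rank below `k` form an admissible subset that attains the sum.
  · set Z := {i ∈ I.positions Y | rankIn (I.positions Y) i < k} with hZ
    have hZr : Z ⊆ range I.n := (filter_subset _ _).trans (positions_subset Y)
    have hsub : I.itemsAt Z ⊆ Y := fun e he => by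
      rw [itemsAt, mem_filter] at he
      exact mem_positions.1 (mem_of_mem_filter _ he.2)
    have hcard : #(I.itemsAt Z) ≤ k := by
      rw [← card_positions, ho.positions_itemsAt hZr]
      exact card_filter_rankIn_le _ _
    rw [firstSum_eq_sum_filter, ← hZ, ← ho.positions_itemsAt hZr, ho.sum_value]
    exact le_sup' (fun X' => ∑ e ∈ X', I.value e) (mem_filter.2 ⟨mem_powerset.2 hsub, hcard⟩)

theorem Sorts.firstSum_le_opt (ho : I.Sorts o) (k : ℕ) {X : Finset ℕ}
    (hX : Fits I.n (fun i => I.sizeFn (o i)) I.capacity X) :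
    firstSum (fun i => I.valueFn (o i)) k X ≤ I.optTopValue k := by
  rw [← ho.positions_itemsAt hX.subset, ← ho.topValue_eq]
  refine le_sup' (fun Y => I.topValue k Y) ?_
  rwa [← ho.fits_iff, ho.positions_itemsAt hX.subset]

theorem Sorts.exists_firstSum_eq_opt (ho : I.Sorts o) (k : ℕ) :
    ∃ X, Fits I.n (fun i => I.sizeFn (o i)) I.capacity X ∧
      firstSum (fun i => I.valueFn (o i)) k X = I.optTopValue k := by
  obtain ⟨Y, hY, hYk⟩ := exists_mem_eq_sup' I.feasible_nonempty fun Y => I.topValue k Y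
  exact ⟨I.positions Y, (ho.fits_iff Y).2 hY, by rw [← ho.topValue_eq, optTopValue, hYk]⟩

/-- Against every weighting of the cardinality constraints there is a solution that does at least
as well as a given randomized solution. -/
theorem Sorts.exists_response (ho : I.Sorts o) {p : Finset (Fin I.n) → ℝ}
    (hp : p ∈ I.randomizedSolutions) (c : ℕ → ℝ) (hc : ∀ k < I.n, 0 ≤ c k) :
    ∃ X, Fits I.n (fun i => I.sizeFn (o i)) I.capacity X ∧
      I.robustness p * ∑ k ∈ range I.n, c k ≤ ∑ k ∈ range I.n,
        c k * (firstSum (fun i => I.valueFn (o i)) (k + 1) X / I.optTopValue (k + 1)) := by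
  obtain ⟨hp0, -, hp1⟩ := hp
  set F : Finset (Fin I.n) → ℝ := fun Y =>
    ∑ k ∈ range I.n, c k * (I.topValue (k + 1) Y / I.optTopValue (k + 1)) with hF
  obtain ⟨Y, hY, hmax⟩ := exists_max_image I.feasible F I.feasible_nonempty
  refine ⟨I.positions Y, (ho.fits_iff Y).2 hY, ?_⟩
  simp only [← ho.topValue_eq]
  calc I.robustness p * ∑ k ∈ range I.n, c k
      = ∑ k ∈ range I.n, c k * I.robustness p := by rw [mul_comm, sum_mul]
    _ ≤ ∑ k ∈ range I.n, c k *
        ((∑ Z ∈ I.feasible, p Z * I.topValue (k + 1) Z) / I.optTopValue (k + 1)) := by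
        refine sum_le_sum fun k hk => mul_le_mul_of_nonneg_left ?_ (hc k (mem_range.1 hk))
        exact inf'_le (fun k => (∑ X ∈ I.feasible, p X * I.topValue k X) / I.optTopValue k)
          (mem_Icc.2 ⟨by omega, mem_range.1 hk⟩)
    _ = ∑ Z ∈ I.feasible, p Z * F Z := by
        simp only [hF, sum_div, mul_sum]
        rw [sum_comm]
        exact sum_congr rfl fun Z _ => sum_congr rfl fun k _ => by ring
    -- The average under `p` is at most the maximum. Only this easy direction of minimax duality is
    -- needed.
    _ ≤ ∑ Z ∈ I.feasible, p Z * F Y :=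
        sum_le_sum fun Z hZ => mul_le_mul_of_nonneg_left (hmax Z hZ) (hp0 Z)
    _ = F Y := by rw [← sum_mul, hp1, one_mul]

end Instance

/-! ## The output -/

/-- Expectations are computed along the list, so a set that occurs several times needs no special
treatment. -/
theorem sum_outputDistribution_mul {n T : ℕ} {μ : Memory} {Y : ℕ → Finset (Fin n)}
    {A : Finset (Finset (Fin n))} (hlen : outputLength μ = T)
    (hset : ∀ t < T, outputSet n μ t = Y t) (hA : ∀ t < T, Y t ∈ A)
    (hprob : ∀ t < T, μ.num 4 t = 1 / T) (g : Finset (Fin n) → ℝ) :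
    ∑ X ∈ A, outputDistribution n μ X * g X = (∑ t ∈ range T, g (Y t)) / T := by
  simp only [outputDistribution, hlen, sum_mul]
  rw [sum_comm, sum_div]
  refine sum_congr rfl fun t ht => ?_
  have ht := mem_range.1 ht
  simp only [hset t ht, hprob t ht, ite_mul, zero_mul]
  rw [sum_ite_eq, if_pos (hA t ht)]
  ring

theorem outputDistribution_mem {I : Instance} {T : ℕ} {μ : Memory} {Y : ℕ → Finset (Fin I.n)}
    (hT : 0 < T) (hlen : outputLength μ = T) (hset : ∀ t < T, outputSet I.n μ t = Y t)
    (hA : ∀ t < T, Y t ∈ I.feasible) (hprob : ∀ t < T, μ.num 4 t = 1 / T) :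
    outputDistribution I.n μ ∈ I.randomizedSolutions := by
  refine ⟨fun X => sum_nonneg fun t ht => ?_, fun X hX => sum_eq_zero fun t ht => ?_, ?_⟩
  · rw [hlen] at ht
    rw [hprob t (mem_range.1 ht)]
    split_ifs <;> positivity
  · rw [hlen] at ht
    have ht := mem_range.1 ht
    rw [hset t ht, if_neg]
    rintro rfl
    exact hX (hA t ht)
  · have := sum_outputDistribution_mul hlen hset hA hprob fun _ => 1
    simp only [mul_one, sum_const, card_range, nsmul_eq_mul] at this
    rw [this, div_self]
    positivity

/-! ## Cost models -/

theorem lengthModel_unitCost : LengthModel unitCost fun _ _ => True where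
  mono := fun _ _ => trivial
  natCast := fun _ => trivial
  add := fun _ _ => trivial
  sub := fun _ _ => trivial
  mul := fun _ _ => trivial
  div := fun _ _ => trivial
  cost_le := fun _ => by rw [unitCost]; omega

/-- `x` is a fraction whose numerator and denominator are at most `2 ^ a`. -/
def RatLength (a : ℕ) (x : ℝ) : Prop :=
  ∃ (p : ℤ) (q : ℕ), q ≠ 0 ∧ p.natAbs ≤ 2 ^ a ∧ q ≤ 2 ^ a ∧ x = p / q

/-- The bit cost refers to the reduced fraction, whose numerator and denominator divide those of any
other representation. Since `RatLength` admits unreduced fractions, the schoolbook formulas give the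
bounds for the operations. -/
theorem bitCost_le {a : ℕ} {x : ℝ} (h : RatLength a x) : bitCost x ≤ 2 * a + 4 := by
  obtain ⟨p, q, hq, hp, hqa, rfl⟩ := h
  have hex : ∃ r : ℚ, (r : ℝ) = p / q := ⟨p / q, by push_cast; rfl⟩
  rw [bitCost, dif_pos hex]
  have hr : hex.choose = Rat.divInt p q := by
    have := hex.choose_spec
    rw [Rat.divInt_eq_div]
    exact_mod_cast this
  generalize hex.choose = r at hr
  have hden : r.den ≤ q := by
    have h1 := Rat.den_dvd p q
    rw [← hr] at h1
    exact Nat.le_of_dvd (Nat.pos_of_ne_zero hq) (by exact_mod_cast h1)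
  have hnum : r.num.natAbs ≤ p.natAbs := by
    have h1 := Rat.num_dvd p (b := q) (by exact_mod_cast hq)
    rw [← hr] at h1
    rcases eq_or_ne p 0 with rfl | hp0
    · simp [hr]
    · exact Nat.le_of_dvd (Int.natAbs_pos.2 hp0) (Int.natAbs_dvd_natAbs.2 h1)
  have size_le : ∀ m : ℕ, m ≤ 2 ^ a → m.size ≤ a + 1 := fun m hm =>
    Nat.size_le.2 (hm.trans_lt (Nat.pow_lt_pow_right (by omega) (by omega)))
  have h1 := size_le _ (hnum.trans hp)
  have h2 := size_le _ (hden.trans hqa)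
  rw [ratLength]
  omega

theorem ratLength_of_bitCost_le {b : ℕ} {x : ℝ} (hx : ∃ q : ℚ, (q : ℝ) = x) (hb : bitCost x ≤ b) :
    RatLength b x := by
  rw [bitCost, dif_pos hx, ratLength] at hb
  have hspec := hx.choose_spec
  generalize hx.choose = r at hb hspec
  have key : ∀ m : ℕ, m.size ≤ b → m ≤ 2 ^ b := fun m hm =>
    (Nat.lt_size_self m).le.trans (Nat.pow_le_pow_right (by omega) hm)
  refine ⟨r.num, r.den, r.den_nz, key _ (by omega), key _ (by omega), ?_⟩
  rw [← hspec]
  exact_mod_cast (Rat.num_div_den r).symm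

theorem lengthModel_bitCost : LengthModel bitCost RatLength where
  mono := by
    rintro a b x ⟨p, q, hq, hp, hqa, rfl⟩ hab
    have := Nat.pow_le_pow_right (n := 2) (by omega) hab
    exact ⟨p, q, hq, hp.trans this, hqa.trans this, rfl⟩
  natCast := by
    intro a m hm
    exact ⟨m, 1, one_ne_zero, by simpa using hm, Nat.one_le_two_pow, by simp⟩
  add := by
    rintro a b x y ⟨p, q, hq, hp, hqa, rfl⟩ ⟨p', q', hq', hp', hqa', rfl⟩
    have h1 := Nat.mul_le_mul hp hqa'
    have h2 := Nat.mul_le_mul hp' hqa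
    have h3 := Nat.mul_le_mul hqa hqa'
    refine ⟨p * q' + p' * q, q * q', mul_ne_zero hq hq', ?_, ?_, ?_⟩
    · refine (Int.natAbs_add_le _ _).trans ?_
      rw [Int.natAbs_mul, Int.natAbs_mul, Int.natAbs_natCast, Int.natAbs_natCast, pow_succ, pow_add]
      linarith
    · rw [pow_succ, pow_add]
      have := Nat.zero_le (2 ^ a * 2 ^ b)
      linarith
    · push_cast
      field_simp
  sub := by
    rintro a b x y ⟨p, q, hq, hp, hqa, rfl⟩ ⟨p', q', hq', hp', hqa', rfl⟩
    have h1 := Nat.mul_le_mul hp hqa'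
    have h2 := Nat.mul_le_mul hp' hqa
    have h3 := Nat.mul_le_mul hqa hqa'
    refine ⟨p * q' - p' * q, q * q', mul_ne_zero hq hq', ?_, ?_, ?_⟩
    · refine (Int.natAbs_sub_le _ _).trans ?_
      rw [Int.natAbs_mul, Int.natAbs_mul, Int.natAbs_natCast, Int.natAbs_natCast, pow_succ, pow_add]
      linarith
    · rw [pow_succ, pow_add]
      have := Nat.zero_le (2 ^ a * 2 ^ b)
      linarith
    · push_cast
      field_simp
  mul := by
    rintro a b x y ⟨p, q, hq, hp, hqa, rfl⟩ ⟨p', q', hq', hp', hqa', rfl⟩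
    refine ⟨p * p', q * q', mul_ne_zero hq hq', ?_, ?_, ?_⟩
    · rw [Int.natAbs_mul, pow_add]
      exact Nat.mul_le_mul hp hp'
    · rw [pow_add]
      exact Nat.mul_le_mul hqa hqa'
    · push_cast
      field_simp
  div := by
    rintro a b x y ⟨p, q, hq, hp, hqa, rfl⟩ ⟨p', q', hq', hp', hqa', rfl⟩
    rcases eq_or_ne p' 0 with rfl | h0
    -- A quotient with denominator zero is zero.
    · exact ⟨0, 1, one_ne_zero, by simp, Nat.one_le_two_pow, by simp⟩
    -- The new denominator has to be a natural number, so the sign of `p'` moves to the numerator.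
    refine ⟨p * q' * p'.sign, q * p'.natAbs, mul_ne_zero hq (Int.natAbs_ne_zero.2 h0), ?_, ?_, ?_⟩
    · rw [Int.natAbs_mul, Int.natAbs_mul, Int.natAbs_natCast, Int.natAbs_sign_of_ne_zero h0,
        mul_one, pow_add]
      exact Nat.mul_le_mul hp hqa'
    · rw [pow_add]
      exact Nat.mul_le_mul hqa hp'
    · have h2 : ((p'.natAbs : ℕ) : ℝ) ≠ 0 := by exact_mod_cast Int.natAbs_ne_zero.2 h0
      have h3 : (p' : ℝ) = p'.sign * (p'.natAbs : ℕ) := by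
        rw [← Int.cast_natCast p'.natAbs, ← Int.cast_mul, Int.sign_mul_natAbs]
      have h4 : (p'.sign : ℝ) * p'.sign = 1 := by
        have : p'.sign * p'.sign = 1 := by
          rcases Int.lt_or_gt_of_ne h0 with h | h
          · simp [Int.sign_eq_neg_one_of_neg h]
          · simp [Int.sign_eq_one_of_pos h]
        exact_mod_cast this
      have h5 : (p'.sign : ℝ) ≠ 0 := fun h => by simp [h] at h4
      have h6 : (q : ℝ) ≠ 0 := by exact_mod_cast hq
      simp only [Int.cast_mul, Nat.cast_mul, Int.cast_natCast]
      rw [div_div_div_eq, h3, div_eq_div_iff (mul_ne_zero h6 (mul_ne_zero h5 h2))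
        (mul_ne_zero h6 h2)]
      linear_combination (-((p : ℝ) * q' * q * (p'.natAbs : ℕ))) * h4
  cost_le := bitCost_le

/-! ## The approximation scheme -/

/-- A bound on the lengths of all numbers and loops in a run with `n` items, accuracy `N` and data
of length at most `b`. -/
def lengthBudget (n N b : ℕ) : ℕ :=
  (n + 1) + N + (n + 1) * (n * (n * N) + 1) + ((n + 1) * (b + 1) + 1) +
    2 * ((n * N) * (n * N)) +
    (n * (2 * ((n * N) * (n * N)) * (2 * (n * (b + 1)) + N + 2) + n * (b + 1) + 1) + b)

/-- The dominant term, from the lengths of the weights, has degree seven in `n + N + b + 1`;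
exponent and constant are chosen generously. -/
theorem lengthBudget_le (n N b : ℕ) : lengthBudget n N b ≤ 50 * (n + N + b + 1) ^ 8 := by
  set x := n + N + b + 1 with hx
  have hx1 : 1 ≤ x := by omega
  have hn : n ≤ x := by omega
  have hn1 : n + 1 ≤ x := by omega
  have hN : N ≤ x := by omega
  have hb : b + 1 ≤ x := by omega
  have hp : ∀ i ≤ 8, x ^ i ≤ x ^ 8 := fun i hi => Nat.pow_le_pow_right hx1 hi
  have h1 : n * (n * N) ≤ x * (x * x) := by gcongr
  have h2 : (n * N) * (n * N) ≤ (x * x) * (x * x) := by gcongr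
  have h3 : n * (b + 1) ≤ x * x := by gcongr
  have h4 : (n + 1) * (n * (n * N) + 1) ≤ x * (x * (x * x) + 1) := by gcongr
  have h5 : (n + 1) * (b + 1) ≤ x * x := by gcongr
  have h6 : n * (2 * ((n * N) * (n * N)) * (2 * (n * (b + 1)) + N + 2) + n * (b + 1) + 1) ≤
      x * (2 * ((x * x) * (x * x)) * (2 * (x * x) + x + 2) + x * x + 1) := by gcongr
  have e0 := hp 0 (by omega)
  have e1 := hp 1 (by omega)
  have e2 := hp 2 (by omega)
  have e3 := hp 3 (by omega)
  have e4 := hp 4 (by omega)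
  have e5 := hp 5 (by omega)
  have e6 := hp 6 (by omega)
  have e7 := hp 7 (by omega)
  rw [lengthBudget]
  ring_nf at *
  omega

namespace Instance

variable {I : Instance} {o : ℕ → ℕ}

theorem Sorts.opt_pos (ho : I.Sorts o) (k : ℕ) : 0 < I.optTopValue (k + 1) := by
  obtain ⟨u, hu, hatt⟩ := I.exists_max_value
  have S := ho.sortedKnapsack hu hatt
  obtain ⟨i, -, hi, hv⟩ := S.fits_singleton
  have h := ho.firstSum_le_opt (k + 1) hi
  rw [firstSum_of_card_le (by simp), sum_singleton, hv] at h
  exact S.u_pos.trans_le h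

/-- This allows the factor `1 - 5 / N` to be replaced by the smaller `1 - ε`, even if the latter is
negative. -/
theorem Sorts.robustness_nonneg (ho : I.Sorts o) {p : Finset (Fin I.n) → ℝ}
    (hp : p ∈ I.randomizedSolutions) : 0 ≤ I.robustness p := by
  refine le_inf' _ _ fun k hk => div_nonneg (sum_nonneg fun X hX => mul_nonneg (hp.1 X) ?_) ?_
  · rw [ho.topValue_eq]
    exact firstSum_nonneg (fun i hi =>
      (valueFn_pos (ho i (mem_range.1 (positions_subset X hi))).1).le) k
  · obtain ⟨k, rfl⟩ := Nat.exists_eq_add_of_le' (mem_Icc.1 hk).1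
    exact (ho.opt_pos k).le

end Instance

theorem initialMemory_good {w : ℝ → ℕ} {Λ : ℕ → ℝ → Prop} (L : LengthModel w Λ) {I : Instance}
    {ε : ℝ} {b h : ℕ} (hs : ∀ e, Λ b (I.size e)) (hv : ∀ e, Λ b (I.value e))
    (hC : Λ b I.capacity) (hε : Λ b ε) (hn : I.n ≤ h) (hb : b ≤ h) :
    Good Λ h (initialMemory I ε) := by
  refine ⟨fun a i => ?_, fun a i => L.mono (a := b) ?_ hb⟩
  · simp only [initialMemory]
    split_ifs
    exacts [le_two_pow hn, Nat.zero_le _]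
  · simp only [initialMemory]
    split_ifs
    exacts [hs _, L.zero b, hv _, L.zero b, hC, hε, L.zero b]

theorem exists_accuracy {ε : ℝ} (hε : 0 < ε) : ∃ m : ℕ,
    (∀ i < m, ((i + 5 : ℕ) : ℝ) * ε ≤ 5) ∧ 5 < ((m + 5 : ℕ) : ℝ) * ε ∧
      ((m + 5 : ℕ) : ℝ) ≤ 5 / ε + 5 := by
  classical
  have hex : ∃ m : ℕ, 5 < ((m + 5 : ℕ) : ℝ) * ε := by
    obtain ⟨m, hm⟩ := exists_nat_gt (5 / ε)
    refine ⟨m, ?_⟩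
    rw [div_lt_iff₀ hε] at hm
    push_cast
    nlinarith
  refine ⟨Nat.find hex, fun i hi => not_lt.1 (Nat.find_min hex hi), Nat.find_spec hex, ?_⟩
  rcases Nat.eq_zero_or_pos (Nat.find hex) with h | h
  · rw [h]
    have : 0 < 5 / ε := by positivity
    push_cast
    linarith
  · have h1 := not_lt.1 (Nat.find_min hex (Nat.sub_lt h one_pos))
    rw [← le_div_iff₀ hε] at h1
    have h2 : ((Nat.find hex + 5 : ℕ) : ℝ) = ((Nat.find hex - 1 + 5 : ℕ) : ℝ) + 1 := by
      have : Nat.find hex + 5 = (Nat.find hex - 1 + 5) + 1 := by omega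
      rw [this]
      push_cast
      ring
    rw [h2]
    linarith

/-- The correctness of the program, and its running time in terms of the length budget, in an
arbitrary cost model. -/
theorem exec_robustKnapsack (I : Instance) {ε : ℝ} (hε : 0 < ε) : ∃ N : ℕ,
    (N : ℝ) ≤ 5 / ε + 5 ∧ ∀ (w : ℝ → ℕ) (Λ : ℕ → ℝ → Prop), LengthModel w Λ → ∀ b : ℕ,
      (∀ e, Λ b (I.size e)) → (∀ e, Λ b (I.value e)) → Λ b I.capacity → Λ b ε →
      ∃ ν t, Exec w Program.robustKnapsack (initialMemory I ε) ν t ∧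
        t ≤ Program.robustKnapsack.stepBound (lengthBudget I.n N b) * (lengthBudget I.n N b + 1) ∧
        outputLength ν ≤ lengthBudget I.n N b ∧
        I.IsApproxSolution (1 - ε) (outputDistribution I.n ν) := by
  obtain ⟨m, hle, hlt, hm⟩ := exists_accuracy hε
  refine ⟨m + 5, hm, fun w Λ L b hs hv hC hεb => ?_⟩
  obtain ⟨o, ho⟩ := exists_sorted_order I.n I.valueFn
  replace ho : I.Sorts o := ho
  obtain ⟨u, hu, hatt⟩ := I.exists_max_value
  have S := ho.sortedKnapsack hu hatt
  set h := lengthBudget I.n (m + 5) b with hh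
  rw [lengthBudget] at hh
  have hsf : ∀ e < I.n, Λ b (I.sizeFn e) := fun e he => by
    simpa [Instance.sizeFn, he] using hs ⟨e, he⟩
  have hvf : ∀ e < I.n, Λ b (I.valueFn e) := fun e he => by
    simpa [Instance.valueFn, he] using hv ⟨e, he⟩
  have E : Setting w Λ b h I.n (m + 5) o (fun i => I.sizeFn (o i)) (fun i => I.valueFn (o i))
      I.capacity u := by
    -- `lengthBudget` is the sum of all quantities that `Setting` requires to be bounded by `h`, so
    -- each bound is immediate.
    refine ⟨L, S, by omega, fun i hi => (ho i hi).1, ho.injective, fun i hi => hsf _ (ho i hi).1,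
      fun i hi => hvf _ (ho i hi).1, hC, ?_, by omega, by omega, by omega, by omega, by omega,
      by omega⟩
    obtain ⟨e, he, -, rfl⟩ := hatt
    exact hvf e he
  obtain ⟨ν, t, hexec, ht, -, hlen, B, X, hB, hX⟩ := E.run_robustKnapsack (μ := initialMemory I ε)
    (ε := ε) (initialMemory_good L hs hv hC hεb (by omega) (by omega)) (by simp [initialMemory])
    (fun e he => by simp [initialMemory, Instance.sizeFn])
    (fun e he => by simp [initialMemory, Instance.valueFn]) (by simp [initialMemory])
    (by simp [initialMemory]) (by simp [initialMemory]) (fun e he => Instance.valueFn_pos he) ho hu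
    hatt hle hlt
  set T := 2 * ((I.n * (m + 5)) * (I.n * (m + 5))) with hT
  have hn := S.n_pos
  have hTpos : 0 < T := by positivity
  refine ⟨ν, t, hexec, ht, ?_, ?_⟩
  · rw [outputLength, hlen]; omega
  have hset : ∀ t < T, outputSet I.n ν t = I.itemsAt (X t) := by
    intro t ht
    ext e
    have := (hX t ht).2.2.1 _ (position_lt (val := I.valueFn) e.2)
    rw [ho.apply_position] at this
    simp [outputSet, Instance.itemsAt, this]
  have hpos : ∀ t < T, I.positions (I.itemsAt (X t)) = X t := fun t ht =>
    ho.positions_itemsAt (hX t ht).1.subset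
  have hfeas : ∀ t < T, I.itemsAt (X t) ∈ I.feasible := fun t ht => by
    rw [← ho.fits_iff, hpos t ht]
    exact (hX t ht).1
  have hprob : ∀ t < T, ν.num 4 t = 1 / T := fun t ht => (hX t ht).2.2.2
  refine ⟨outputDistribution_mem hTpos hlen hset hfeas hprob, fun p' hp' => ?_⟩
  have hguar := S.average_guarantee (N := m + 5) (T := T) (by omega) hT
    (opt := fun k => I.optTopValue (k + 1)) (B := B)
    (W := weightAfter (fun i => I.valueFn (o i)) (m + 5) B X) (X := X)
    (fun k _ Y hY => ho.firstSum_le_opt (k + 1) hY)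
    (fun k _ => ho.exists_firstSum_eq_opt (k + 1))
    (fun k hk => by
      obtain ⟨Y, hY, hYopt⟩ := ho.exists_firstSum_eq_opt (k + 1)
      rw [← hYopt]
      exact (hB k hk).2.1 Y hY)
    (fun k hk => by
      obtain ⟨Y, hY, hYB⟩ := (hB k hk).2.2
      rw [hYB]
      exact ho.firstSum_le_opt (k + 1) hY)
    (fun k _ => ho.opt_pos k) (fun t ht => (hX t ht).1) (fun k _ => by simp [weightAfter])
    (fun t _ k _ => weightAfter_succ _ _ _ _ _ _) (fun t ht _ => (hX t ht).2.1)
    (γ := I.robustness p') (fun c hc => ho.exists_response hp' c hc)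
  refine le_inf' _ _ fun k hk => ?_
  rw [sum_outputDistribution_mul hlen hset hfeas hprob (I.topValue k)]
  obtain ⟨k, rfl⟩ := Nat.exists_eq_add_of_le' (mem_Icc.1 hk).1
  have hk' : k < I.n := (mem_Icc.1 hk).2
  have hsum : ∑ t ∈ range T, I.topValue (k + 1) (I.itemsAt (X t)) =
      ∑ t ∈ range T, firstSum (fun i => I.valueFn (o i)) (k + 1) (X t) :=
    sum_congr rfl fun t ht => by rw [ho.topValue_eq, hpos t (mem_range.1 ht)]
  rw [hsum]
  refine le_trans (mul_le_mul_of_nonneg_right ?_ (ho.robustness_nonneg hp')) (hguar k hk')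
  have : (5 : ℝ) / (m + 5 : ℕ) ≤ ε := by
    rw [div_le_iff₀ (by positivity), mul_comm]
    exact hlt.le
  linarith

theorem bitCost_le_inputLength (I : Instance) (ε : ℝ) :
    (∀ e, bitCost (I.size e) ≤ inputLength I ε) ∧ (∀ e, bitCost (I.value e) ≤ inputLength I ε) ∧
      bitCost I.capacity ≤ inputLength I ε ∧ bitCost ε ≤ inputLength I ε := by
  have h : ∀ e, bitCost (I.size e) + bitCost (I.value e) ≤
      ∑ e, (bitCost (I.size e) + bitCost (I.value e)) := fun e =>
    single_le_sum (f := fun e => bitCost (I.size e) + bitCost (I.value e))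
      (fun _ _ => Nat.zero_le _) (mem_univ e)
  unfold inputLength
  exact ⟨fun e => by have := h e; omega, fun e => by have := h e; omega, by omega, by omega⟩

theorem items_le_inputLength (I : Instance) (ε : ℝ) : I.n ≤ inputLength I ε := by
  have hpos : ∀ x, 1 ≤ bitCost x := fun x => by
    rw [bitCost]
    split_ifs
    · rw [ratLength]; omega
    · exact le_rfl
  calc I.n = ∑ _e : Fin I.n, 1 := by simp
    _ ≤ ∑ e, (bitCost (I.size e) + bitCost (I.value e)) :=
      sum_le_sum fun e _ => (hpos _).trans (Nat.le_add_right _ _)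
    _ ≤ inputLength I ε := by unfold inputLength; omega

theorem isFPTAS_robustKnapsack : IsFPTAS Program.robustKnapsack := by
  obtain ⟨c, d, hcd⟩ := Program.robustKnapsack.stepBound_le
  set A : ℕ := (c + 1) * (51 * 7 ^ 8) ^ (d + 1) with hA
  -- the budget is polynomial in any `y` that dominates the parameters
  have key : ∀ (n N b : ℕ) (y : ℝ), 0 ≤ y → (n + N + b + 1 : ℝ) ≤ 7 * y →
      ((c * (lengthBudget n N b + 1) ^ d * (lengthBudget n N b + 1) : ℕ) : ℝ) ≤
        A * y ^ (8 * (d + 1)) ∧ (lengthBudget n N b : ℝ) ≤ A * y ^ (8 * (d + 1)) := by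
    intro n N b y hy0 hy
    have h1 : lengthBudget n N b + 1 ≤ 51 * (n + N + b + 1) ^ 8 := by
      have := lengthBudget_le n N b
      have : 1 ≤ (n + N + b + 1) ^ 8 := Nat.one_le_pow _ _ (by omega)
      omega
    have h2 : ((lengthBudget n N b + 1 : ℕ) : ℝ) ≤ 51 * 7 ^ 8 * y ^ 8 := by
      calc ((lengthBudget n N b + 1 : ℕ) : ℝ) ≤ ((51 * (n + N + b + 1) ^ 8 : ℕ) : ℝ) := by
            exact_mod_cast h1
        _ = 51 * (n + N + b + 1 : ℝ) ^ 8 := by push_cast; ring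
        _ ≤ 51 * (7 * y) ^ 8 := by gcongr
        _ = _ := by ring
    have h3 : (c + 1 : ℝ) * ((lengthBudget n N b + 1 : ℕ) : ℝ) ^ (d + 1) ≤
        A * y ^ (8 * (d + 1)) := by
      calc (c + 1 : ℝ) * ((lengthBudget n N b + 1 : ℕ) : ℝ) ^ (d + 1) ≤
            (c + 1) * (51 * 7 ^ 8 * y ^ 8) ^ (d + 1) := by gcongr
        _ = _ := by rw [hA]; push_cast; rw [mul_pow, pow_mul]; ring
    have h4 : ((lengthBudget n N b + 1 : ℕ) : ℝ) ≤
        ((lengthBudget n N b + 1 : ℕ) : ℝ) ^ (d + 1) := by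
      exact_mod_cast Nat.le_self_pow (by omega) (lengthBudget n N b + 1)
    have h5 : (0 : ℝ) ≤ ((lengthBudget n N b + 1 : ℕ) : ℝ) ^ (d + 1) := by positivity
    have hc0 : (0 : ℝ) ≤ c := Nat.cast_nonneg c
    constructor
    · refine le_trans ?_ h3
      rw [Nat.cast_mul, Nat.cast_mul, Nat.cast_pow, mul_assoc, ← pow_succ]
      linarith
    · have h6 : (lengthBudget n N b : ℝ) ≤ ((lengthBudget n N b + 1 : ℕ) : ℝ) := by
        push_cast; linarith
      nlinarith
  refine ⟨A, 8 * (d + 1), fun I ε hε => ?_⟩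
  have hε' : 0 < 1 / ε := by positivity
  have e5 : 5 / ε = 5 * (1 / ε) := by ring
  obtain ⟨N, hN, hrun⟩ := exec_robustKnapsack I hε
  rw [e5] at hN
  have hn0 : (0 : ℝ) ≤ I.n := Nat.cast_nonneg _
  obtain ⟨ν, t, hexec, ht, hlen, happ⟩ := hrun unitCost _ lengthModel_unitCost 0
    (fun _ => trivial) (fun _ => trivial) trivial trivial
  -- The factor `7` comes from `n + N + 1 ≤ n + 5 / ε + 6`; in the bit model the left side is at
  -- most `2 * inputLength I ε + 5 / ε + 6`, and `7` suffices again.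
  obtain ⟨k1, k2⟩ := key I.n N 0 (I.n + 1 / ε + 1) (by positivity) (by push_cast; linarith)
  refine ⟨ν, happ, le_trans (by exact_mod_cast hlen) k2, ⟨t, hexec, le_trans ?_ k1⟩, ?_⟩
  · exact_mod_cast ht.trans (Nat.mul_le_mul_right _ (hcd _))
  · rintro ⟨hs, hv, hC, hεq⟩
    obtain ⟨bs, bv, bC, bε⟩ := bitCost_le_inputLength I ε
    obtain ⟨ν', t', hexec', ht', -, -⟩ := hrun bitCost _ lengthModel_bitCost (inputLength I ε)
      (fun e => ratLength_of_bitCost_le (hs e) (bs e))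
      (fun e => ratLength_of_bitCost_le (hv e) (bv e)) (ratLength_of_bitCost_le hC bC)
      (ratLength_of_bitCost_le hεq bε)
    -- The two runs differ only in their accounting, so the output certified in the real-number
    -- model is also the one of the bit model.
    obtain rfl := hexec.deterministic hexec'
    have hnl : (I.n : ℝ) ≤ inputLength I ε := by exact_mod_cast items_le_inputLength I ε
    obtain ⟨k3, -⟩ := key I.n N (inputLength I ε) (inputLength I ε + 1 / ε + 1) (by positivity)
      (by linarith)
    exact ⟨t', hexec', le_trans (by exact_mod_cast ht'.trans (Nat.mul_le_mul_right _ (hcd _))) k3⟩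

end CardRobust

theorem theorem4p10 : ∃ P : CardRobust.Program, CardRobust.IsFPTAS P :=
  ⟨_, CardRobust.isFPTAS_robustKnapsack⟩
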